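/- Let $\mathbb F$ be a field of characteristic $0$, let $\mathfrak g$ be a reductive Lie algebra over $\mathbb F$, and let $\varphi:\mathfrak g\to\operatorname{End}V$ be a faithful representation on a finite-dimensional vector space $V$ whose trace form $(a|b)=\operatorname{tr}_V(\varphi(a)\varphi(b))$ is non-degenerate. Let $\{f,2x,e\}$ be an $\mathfrak{sl}_2$-triple in $\mathfrak g$, i.e. $[x,e]=e$, $[x,f]=-f$, $[e,f]=2x$ (the case $f=x=e=0$ is allowed). Let $\mathfrak g=\bigoplus_{k\in\frac12\mathbb Z}\mathfrak g_k$ be the $\operatorname{ad}x$-eigenspace decomposition, let $d$ be the largest eigenvalue of $\operatorname{ad}x$, and let $\mathfrak g^f$ be the centralizer of $f$. Let $\{u_i\}_{i\in I}$ be a basis of $\mathfrak g$ consisting of $\operatorname{ad}x$-eigenvectors and containing a basis $\{u_i\}_{i\in I_f}$ of $\mathfrak g^f$. Let $\{u^i\}_{i\in I}$ be the dual basis with respect to the trace form, and put $U^i=\varphi(u^i)$. Let $I_{\le\frac12}$ be the set of $i\in I$ such that $u_i\in\mathfrak g_k$ for some $k\le\frac12$. For a subspace $\mathfrak a\subset\mathfrak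 g$ let $\mathcal V(\mathfrak a)$ be the algebra of differential polynomials over $\mathfrak a$, with derivation $\partial$. For $\epsilon\in\mathbb F$ and $s\in\mathfrak g_d$ let $\{\cdot\,_\lambda\,\cdot\}_\epsilon$ be the affine $\lambda$-bracket on $\mathcal V(\mathfrak g)$, given on generators by $\{a_\lambda b\}_\epsilon=[a,b]+(a|b)\lambda+\epsilon(s|[a,b])$. Let $\rho:\mathcal V(\mathfrak g)\to\mathcal V(\mathfrak g_{\le\frac12})$ be the differential algebra homomorphism with $\rho(a)=\pi_{\le\frac12}(a)+(f|a)$ for $a\in\mathfrak g$, where $\pi_{\le\frac12}$ is the projection onto $\mathfrak g_{\le\frac12}$ with kernel $\mathfrak g_{\ge1}$. The classical affine $\mathcal W$-algebra is, as a differential algebra, $$\mathcal W_\epsilon(\mathfrak g,f,s)=\{w\in\mathcal V(\mathfrak g_{\le\frac12})\mid\rho\{a_\lambda w\}_\epsilon=0\ \text{for all}\ a\in\mathfrak g_{\ge\frac12}\},$$ and $\mathcal W(\mathfrak g,f)$ denotes this algebra for $\epsilon=0$. Let $\pi:\mathcal V(\mathfrak g_{\le\frac12})\to\mathcal V(\mathfrak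 g^f)$ be the quotient map by the differential ideal generated by the $u_i$ with $i\in I_{\le\frac12}\setminus I_f$. Put $F=\varphi(f)$ and $X=\varphi(x)$, let $D+1$ be the nilpotency index of $F$ (the size of its largest Jordan block), and let $(\operatorname{End}V)[D]=\{A\in\operatorname{End}V\mid[X,A]=DA\}$. Then $\pi$ restricts to an isomorphism of differential algebras $\mathcal W(\mathfrak g,f)\to\mathcal V(\mathfrak g^f)$; let $w$ be its inverse and $w_i=w(u_i)$, $i\in I_f$, the corresponding free generators of $\mathcal W(\mathfrak g,f)$. Moreover, let $s\in\mathfrak g_d$, $S=\varphi(s)$ and $\epsilon\in\mathbb F$. Then $\mathcal W_\epsilon(\mathfrak g,f,s)=\mathcal W(\mathfrak g,f)$. Let $T\in(\operatorname{End}V)[D]$ satisfy $V=\ker T\oplus F^D(\operatorname{im}T)$, let $J:V\twoheadrightarrow\operatorname{im}T$ be the map $T$ and $I:\operatorname{im}T\hookrightarrow V$ the inclusion. Then the $(I,J)$-generalized quasideterminant $$L_\epsilon(\partial)=\Big(J\big(\partial\mathbb 1_V+F+\sum_{i\in I_{\le\frac12}}u_iU^i+\epsilon S\big)^{-1}I\Big)^{-1}$$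 is well defined: the operator in the inner parentheses is invertible in $\mathcal V(\mathfrak g_{\le\frac12})((\partial^{-1}))\otimes\operatorname{End}V$, and the operator in the outer parentheses is invertible in $\mathcal V(\mathfrak g_{\le\frac12})((\partial^{-1}))\otimes\operatorname{End}(\operatorname{im}T)$. Its coefficients lie in the $\mathcal W$-algebra, i.e. $L_\epsilon(\partial)\in\mathcal W(\mathfrak g,f)((\partial^{-1}))\otimes\operatorname{End}(\operatorname{im}T)$, and $$L_\epsilon(\partial)=\Big(J\big(\partial\mathbb 1_V+F+\sum_{i\in I_f}w_iU^i+\epsilon S\big)^{-1}I\Big)^{-1},$$ where both inverses on the right-hand side exist as well. -/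

import Mathlib

open scoped TensorProduct

noncomputable section

namespace ClassicalW

/-! ### Scalar pseudodifferential operators over a differential algebra -/

section PseudoDiff

variable {F R : Type*} [CommRing F] [CommRing R] [Algebra F R]

/-- Families `(a n)`, indexed by the integers, that vanish for all large `n`. -/
def boundedAbove (F R : Type*) [CommRing F] [CommRing R] [Algebra F R] :
    Submodule F (ℤ → R) where
  carrier := {a | ∃ N : ℤ, ∀ n, N < n → a n = 0}
  zero_mem' := ⟨0, fun _ _ => rfl⟩
  add_mem' := by
    rintro a b ⟨N, hN⟩ ⟨M, hM⟩
    refine ⟨max N M, fun n hn => ?_⟩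
    simp [hN n (lt_of_le_of_lt (le_max_left _ _) hn),
      hM n (lt_of_le_of_lt (le_max_right _ _) hn)]
  smul_mem' := by
    rintro c a ⟨N, hN⟩
    exact ⟨N, fun n hn => by simp [hN n hn]⟩

/-- The algebra `R((∂⁻¹))` of scalar pseudodifferential operators with coefficients in the
differential algebra `(R, δ)`. The family `a` stands for the operator `∑ₙ aₙ ∂ⁿ`. -/
def PseudoDiffOp (_δ : Derivation F R R) : Type _ := boundedAbove F R

namespace PseudoDiffOp

variable {δ : Derivation F R R}

instance : AddCommGroup (PseudoDiffOp δ) := inferInstanceAs (AddCommGroup (boundedAbove F R))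

instance : Module F (PseudoDiffOp δ) := inferInstanceAs (Module F (boundedAbove F R))

/-- The coefficient of `∂ⁿ`. -/
def coeff (a : PseudoDiffOp δ) (n : ℤ) : R := a.1 n

@[ext] theorem ext {a b : PseudoDiffOp δ} (h : ∀ n, a.coeff n = b.coeff n) : a = b :=
  Subtype.ext (funext h)

theorem bdd (a : PseudoDiffOp δ) : ∃ N : ℤ, ∀ n, N < n → a.coeff n = 0 := a.2

@[simp] theorem coeff_zero (n : ℤ) : (0 : PseudoDiffOp δ).coeff n = 0 := rfl
@[simp] theorem coeff_add (a b : PseudoDiffOp δ) (n : ℤ) :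
    (a + b).coeff n = a.coeff n + b.coeff n := rfl
@[simp] theorem coeff_smul (c : F) (a : PseudoDiffOp δ) (n : ℤ) :
    (c • a).coeff n = c • a.coeff n := rfl

/-- The coefficients of `∂ⁱ ∘ u`: by the Leibniz rule,
`∂ⁱ ∘ u = ∑ₘ ∑ₖ (i choose k) uₘ⁽ᵏ⁾ ∂^(m + i - k)`, for all integers `i`. -/
def pw (δ : Derivation F R R) (i : ℤ) (u : ℤ → R) (n : ℤ) : R :=
  ∑ᶠ k : ℕ, Ring.choose i k • (δ^[k] (u (n - i + k)))

theorem iter_zero (k : ℕ) : δ^[k] (0 : R) = 0 := by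
  induction k with
  | zero => rfl
  | succ k ih => rw [Function.iterate_succ_apply', ih, map_zero]

theorem iter_add (k : ℕ) (x y : R) : δ^[k] (x + y) = δ^[k] x + δ^[k] y := by
  induction k with
  | zero => rfl
  | succ k ih => simp only [Function.iterate_succ_apply', ih, map_add]

theorem iter_smul (k : ℕ) (c : F) (x : R) : δ^[k] (c • x) = c • δ^[k] x := by
  induction k with
  | zero => rfl
  | succ k ih =>
    rw [Function.iterate_succ_apply', ih, Function.iterate_succ_apply']
    exact δ.map_smul c _

theorem pw_fin {u : ℤ → R} {N : ℤ} (hN : ∀ n, N < n → u n = 0) (i n : ℤ) (l : ℕ) :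
    (Function.support fun k : ℕ => Ring.choose i k • (δ^[k + l] (u (n - i + k)))).Finite := by
  refine (Set.finite_Iic (N - n + i).toNat).subset fun k hk => ?_
  by_contra hk'
  apply hk
  have : u (n - i + k) = 0 := hN _ (by simp only [Set.mem_Iic, not_le] at hk'; omega)
  simp [this]

theorem pw_eq_zero {u : ℤ → R} {N : ℤ} (hN : ∀ n, N < n → u n = 0) {i n : ℤ}
    (h : N + i < n) : pw δ i u n = 0 := by
  unfold pw
  rw [← finsum_zero (α := ℕ)]
  refine finsum_congr fun k => ?_
  rw [hN _ (by omega), iter_zero, smul_zero]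

theorem pw_zero (u : ℤ → R) (n : ℤ) : pw δ 0 u n = u n := by
  unfold pw
  rw [finsum_eq_single _ 0]
  · simp
  · intro k hk
    obtain ⟨k, rfl⟩ := Nat.exists_eq_succ_of_ne_zero hk
    simp [Ring.choose_zero_succ]

theorem pw_succ {u : ℤ → R} {N : ℤ} (hN : ∀ n, N < n → u n = 0) (i n : ℤ) :
    pw δ (i + 1) u n = pw δ i u (n - 1) + δ (pw δ i u n) := by
  have e0 : ∀ f : ℕ → R, (Function.support f).Finite →
      ∑ᶠ k, f k = f 0 + ∑ᶠ k, f (k + 1) := by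
    intro f hf
    obtain ⟨M, hM⟩ := hf.bddAbove
    rw [finsum_eq_sum_of_support_subset (s := Finset.range (M + 2)),
      finsum_eq_sum_of_support_subset (s := Finset.range (M + 1)), Finset.sum_range_succ']
    · rw [add_comm]
    · intro k hk
      have := hM (show k + 1 ∈ Function.support f from hk)
      simp; omega
    · intro k hk
      have := hM hk
      simp; omega
  have h1 := pw_fin (δ := δ) hN (i + 1) n 0
  have h2 := pw_fin (δ := δ) hN i (n - 1) 0
  have h3 := pw_fin (δ := δ) hN i n 1
  simp only [add_zero] at h1 h2
  have hd : δ (pw δ i u n) = ∑ᶠ k : ℕ, Ring.choose i k • (δ^[k + 1] (u (n - i + k))) := by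
    unfold pw
    have h4 := pw_fin (δ := δ) hN i n 0
    simp only [add_zero] at h4
    have := (δ : R →+ R).map_finsum (f := fun k : ℕ =>
      Ring.choose i k • (δ^[k] (u (n - i + k)))) h4
    refine Eq.trans this (finsum_congr fun k => ?_)
    rw [Function.iterate_succ_apply']
    exact map_zsmul (δ : R →+ R) _ _
  rw [hd]
  unfold pw
  rw [e0 _ h1, e0 _ h2, add_assoc, ← finsum_add_distrib]
  · congr 1
    · simp [sub_sub, add_comm]
    · refine finsum_congr fun k => ?_
      rw [Ring.choose_succ_succ, add_smul, add_comm]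
      congr 4 <;> push_cast <;> ring_nf
  · refine (h2.preimage (f := fun k : ℕ => k + 1) ?_)
    intro a _ b _ h
    simpa using h
  · exact h3

theorem pw_add (i : ℤ) {u v : ℤ → R} {N M : ℤ} (hN : ∀ n, N < n → u n = 0)
    (hM : ∀ n, M < n → v n = 0) (n : ℤ) :
    pw δ i (u + v) n = pw δ i u n + pw δ i v n := by
  have h1 := pw_fin (δ := δ) hN i n 0
  have h2 := pw_fin (δ := δ) hM i n 0
  simp only [add_zero] at h1 h2
  unfold pw
  rw [← finsum_add_distrib h1 h2]
  exact finsum_congr fun k => by rw [Pi.add_apply, iter_add, smul_add]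

theorem pw_smul (i : ℤ) (c : F) {u : ℤ → R} {N : ℤ} (hN : ∀ n, N < n → u n = 0) (n : ℤ) :
    pw δ i (c • u) n = c • pw δ i u n := by
  have h1 := pw_fin (δ := δ) hN i n 0
  simp only [add_zero] at h1
  unfold pw
  rw [smul_finsum' c h1]
  exact finsum_congr fun k => by rw [Pi.smul_apply, iter_smul, smul_comm]

/-- Coefficients of the composition `a ∘ u = ∑ᵢ aᵢ (∂ⁱ ∘ u)`. -/
def comp (δ : Derivation F R R) (a u : ℤ → R) (n : ℤ) : R := ∑ᶠ i : ℤ, a i * pw δ i u n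

theorem comp_fin {a u v : ℤ → R} {A N : ℤ} (hA : ∀ n, A < n → a n = 0)
    (hN : ∀ n, N < n → u n = 0) (n : ℤ) (hv : ∀ i, pw δ i u n = 0 → v i = 0) :
    (Function.support fun i : ℤ => a i * v i).Finite := by
  refine (Set.finite_Icc (n - N) A).subset fun i hi => ?_
  by_contra hi'
  apply hi
  simp only [Set.mem_Icc, not_and_or, not_le] at hi'
  rcases hi' with h | h
  · have := hv i (pw_eq_zero hN (by omega)); simp [this]
  · simp [hA i h]

theorem comp_eq_zero {a u : ℤ → R} {A N : ℤ} (hA : ∀ n, A < n → a n = 0)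
    (hN : ∀ n, N < n → u n = 0) {n : ℤ} (h : A + N < n) : comp δ a u n = 0 := by
  unfold comp
  rw [← finsum_zero (α := ℤ)]
  refine finsum_congr fun i => ?_
  by_cases hi : A < i
  · simp [hA i hi]
  · rw [pw_eq_zero hN (by omega), mul_zero]

theorem comp_d {a u : ℤ → R} {A N : ℤ} (hA : ∀ n, A < n → a n = 0)
    (hN : ∀ n, N < n → u n = 0) (n : ℤ) :
    comp δ (fun m => a (m - 1) + δ (a m)) u n = comp δ a u (n - 1) + δ (comp δ a u n) := by
  have hδA : ∀ n, A < n → δ (a n) = 0 := fun n h => by rw [hA n h, map_zero]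
  have f1 := comp_fin (δ := δ) hA hN n (fun _ h => h)
  have f1' := comp_fin (δ := δ) hA hN (n - 1) (fun _ h => h)
  have f2 := comp_fin (δ := δ) hδA hN n (fun _ h => h)
  have f3 := comp_fin (δ := δ) (v := fun i => δ (pw δ i u n)) hA hN n
    (fun _ h => by simp [h])
  have hd : δ (comp δ a u n) =
      ∑ᶠ i, (a i * δ (pw δ i u n)) + ∑ᶠ i, (δ (a i) * pw δ i u n) := by
    rw [← finsum_add_distrib f3 f2]
    unfold comp
    refine Eq.trans ((δ : R →+ R).map_finsum (f := fun i : ℤ => a i * pw δ i u n) f1)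
      (finsum_congr fun i => ?_)
    refine (Derivation.leibniz δ _ _).trans ?_
    simp only [smul_eq_mul]; ring
  have hs : ∑ᶠ i : ℤ, a (i - 1) * pw δ i u n
      = comp δ a u (n - 1) + ∑ᶠ i, (a i * δ (pw δ i u n)) := by
    rw [← finsum_comp_equiv (Equiv.addRight (1 : ℤ))]
    unfold comp
    rw [← finsum_add_distrib f1' f3]
    refine finsum_congr fun i => ?_
    simp only [Equiv.coe_addRight, add_sub_cancel_right]
    rw [pw_succ hN, mul_add]
  rw [hd, ← add_assoc, ← hs]
  unfold comp
  have hA' : ∀ n, A + 1 < n → a (n - 1) = 0 := fun n h => hA _ (by omega)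
  rw [← finsum_add_distrib (comp_fin (a := fun i => a (i - 1)) hA' hN n (fun _ h => h)) f2]
  exact finsum_congr fun i => add_mul _ _ _

theorem d_inj {u v : ℤ → R} {N : ℤ} (hu : ∀ n, N < n → u n = 0) (hv : ∀ n, N < n → v n = 0)
    (h : ∀ n, u (n - 1) + δ (u n) = v (n - 1) + δ (v n)) : u = v := by
  have key : ∀ k : ℕ, u (N + 1 - k) = v (N + 1 - k) := by
    intro k
    induction k with
    | zero => rw [hu _ (by simp), hv _ (by simp)]
    | succ k ih =>
      have := h (N + 1 - k)
      rw [ih] at this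
      have := add_right_cancel this
      convert this using 2 <;> push_cast <;> ring
  funext n
  by_cases hn : N < n
  · rw [hu n hn, hv n hn]
  · convert key (N + 1 - n).toNat using 2 <;> omega

theorem comp_pw {a u : ℤ → R} {A N : ℤ} (hA : ∀ n, A < n → a n = 0)
    (hN : ∀ n, N < n → u n = 0) (i : ℤ) :
    comp δ (pw δ i a) u = pw δ i (comp δ a u) := by
  have hAN : ∀ n, A + N < n → comp δ a u n = 0 := fun n => comp_eq_zero hA hN
  have hpa : ∀ i n, A + i < n → pw δ i a n = 0 := fun i n => pw_eq_zero hA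
  have step : ∀ i n, comp δ (pw δ (i + 1) a) u n =
      comp δ (pw δ i a) u (n - 1) + δ (comp δ (pw δ i a) u n) := by
    intro i n
    rw [← comp_d (hpa i) hN]
    congr 1
    funext m
    exact pw_succ hA i m
  induction i using Int.induction_on with
  | zero =>
    have e : ∀ w : ℤ → R, pw δ 0 w = w := fun w => funext fun n => pw_zero w n
    rw [e, e]
  | succ i ih => funext n; rw [step, ih, pw_succ hAN]
  | pred i ih =>
    refine d_inj (δ := δ) (N := A + N + (-(i : ℤ) - 1))
      (fun n hn => comp_eq_zero (hpa _) hN (by omega))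
      (fun n hn => pw_eq_zero hAN hn) fun n => ?_
    rw [← step, ← pw_succ hAN]
    simp only [sub_add_cancel]
    exact congrFun ih n

theorem comp_assoc {a b c : ℤ → R} {A B C : ℤ} (hA : ∀ n, A < n → a n = 0)
    (hB : ∀ n, B < n → b n = 0) (hC : ∀ n, C < n → c n = 0) :
    comp δ (comp δ a b) c = comp δ a (comp δ b c) := by
  funext n
  have e1 : comp δ a (comp δ b c) n =
      ∑ᶠ i : ℤ, ∑ᶠ l : ℤ, a i * (pw δ i b l * pw δ l c n) := by
    refine finsum_congr fun i => ?_
    rw [← comp_pw hB hC]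
    refine mul_finsum' _ _ ?_
    exact comp_fin (δ := δ) (fun n => pw_eq_zero (N := B) hB) hC n (fun _ h => h)
  have e2 : comp δ (comp δ a b) c n =
      ∑ᶠ l : ℤ, ∑ᶠ i : ℤ, a i * (pw δ i b l * pw δ l c n) := by
    refine finsum_congr fun l => ?_
    have := finsum_mul' (fun i : ℤ => a i * pw δ i b l) (pw δ l c n)
      (comp_fin (δ := δ) hA hB l (fun _ h => h))
    refine Eq.trans this (finsum_congr fun i => mul_assoc _ _ _)
  have hfin : (Function.support fun p : ℤ × ℤ =>
      a p.1 * (pw δ p.1 b p.2 * pw δ p.2 c n)).Finite := by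
    refine ((Set.finite_Icc (n - C - B) A).prod
      (Set.finite_Icc (n - C) (A + B))).subset fun p hp => ?_
    by_contra hp'
    apply hp
    by_cases h1 : A < p.1
    · simp [hA _ h1]
    by_cases h2 : B + p.1 < p.2
    · simp [pw_eq_zero hB h2]
    by_cases h3 : C + p.2 < n
    · simp [pw_eq_zero hC h3]
    exact absurd (by simp only [Set.mem_prod, Set.mem_Icc]; omega) hp'
  rw [e1, e2, ← finsum_curry _ hfin,
    ← finsum_comp_equiv (Equiv.prodComm ℤ ℤ), finsum_curry]
  · rfl
  · exact hfin.preimage (Equiv.prodComm ℤ ℤ).injective.injOn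

instance : Mul (PseudoDiffOp δ) where
  mul a b := ⟨comp δ a.coeff b.coeff, by
    obtain ⟨A, hA⟩ := a.bdd
    obtain ⟨B, hB⟩ := b.bdd
    exact ⟨A + B, fun n => comp_eq_zero hA hB⟩⟩

theorem coeff_mul (a b : PseudoDiffOp δ) (n : ℤ) : (a * b).coeff n =
    ∑ᶠ i : ℤ, a.coeff i * ∑ᶠ k : ℕ, Ring.choose i k • (δ^[k] (b.coeff (n - i + k))) := rfl

/-- The monomial `r ∂ᵐ`. -/
def monomial (δ : Derivation F R R) (m : ℤ) (r : R) : PseudoDiffOp δ :=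
  ⟨Pi.single m r, m, fun n hn => by simp [hn.ne']⟩

theorem coeff_monomial (m : ℤ) (r : R) (n : ℤ) :
    (monomial δ m r).coeff n = if n = m then r else 0 := by
  simp [monomial, coeff, Pi.single_apply]

instance : One (PseudoDiffOp δ) := ⟨monomial δ 0 1⟩

theorem pw_one (i n : ℤ) : pw δ i (1 : PseudoDiffOp δ).coeff n = if n = i then 1 else 0 := by
  have h1 : ∀ m, (1 : PseudoDiffOp δ).coeff m = if m = 0 then 1 else 0 :=
    fun m => coeff_monomial 0 1 m
  unfold pw
  rw [finsum_eq_single _ 0]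
  · simp [h1, sub_eq_zero]
  · intro k hk
    obtain ⟨k, rfl⟩ := Nat.exists_eq_succ_of_ne_zero hk
    have hδ : δ ((1 : PseudoDiffOp δ).coeff (n - i + (k + 1 : ℕ))) = 0 := by
      rw [h1]; split_ifs <;> simp
    rw [Function.iterate_succ_apply, hδ, iter_zero, smul_zero]

instance : Ring (PseudoDiffOp δ) :=
  { (inferInstance : AddCommGroup (PseudoDiffOp δ)),
    (inferInstance : Mul (PseudoDiffOp δ)),
    (inferInstance : One (PseudoDiffOp δ)) with
    left_distrib := fun a b c => by
      obtain ⟨A, hA⟩ := a.bdd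
      obtain ⟨B, hB⟩ := b.bdd
      obtain ⟨C, hC⟩ := c.bdd
      ext n
      refine Eq.trans ?_ (finsum_add_distrib (comp_fin (δ := δ) hA hB n fun _ h => h)
        (comp_fin (δ := δ) hA hC n fun _ h => h))
      refine finsum_congr fun i => ?_
      rw [← mul_add, ← pw_add i hB hC]
      rfl
    right_distrib := fun a b c => by
      obtain ⟨A, hA⟩ := a.bdd
      obtain ⟨B, hB⟩ := b.bdd
      obtain ⟨C, hC⟩ := c.bdd
      ext n
      refine Eq.trans ?_ (finsum_add_distrib (comp_fin (δ := δ) hA hC n fun _ h => h)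
        (comp_fin (δ := δ) hB hC n fun _ h => h))
      exact finsum_congr fun i => add_mul _ _ _
    zero_mul := fun a => by
      ext n
      refine Eq.trans (finsum_congr fun i => ?_) (finsum_zero (α := ℤ))
      exact zero_mul _
    mul_zero := fun a => by
      ext n
      refine Eq.trans (finsum_congr fun i => ?_) (finsum_zero (α := ℤ))
      have : pw δ i (0 : PseudoDiffOp δ).coeff n = 0 := by
        refine Eq.trans (finsum_congr fun k => ?_) (finsum_zero (α := ℕ))
        rw [coeff_zero, iter_zero, smul_zero]
      exact (congrArg _ this).trans (mul_zero _)
    mul_assoc := fun a b c => by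
      obtain ⟨A, hA⟩ := a.bdd
      obtain ⟨B, hB⟩ := b.bdd
      obtain ⟨C, hC⟩ := c.bdd
      exact ext (congrFun (comp_assoc hA hB hC))
    one_mul := fun a => by
      ext n
      refine Eq.trans (finsum_eq_single _ 0 fun i hi => ?_) ?_
      · have : (1 : PseudoDiffOp δ).coeff i = 0 := by
          refine (coeff_monomial 0 1 i).trans ?_; simp [hi]
        rw [this, zero_mul]
      · have : (1 : PseudoDiffOp δ).coeff 0 = 1 := by
          refine (coeff_monomial 0 1 0).trans ?_; simp
        rw [this, one_mul, pw_zero]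
    mul_one := fun a => by
      ext n
      refine Eq.trans (finsum_eq_single _ n fun i hi => ?_) ?_
      · rw [pw_one, if_neg hi.symm, mul_zero]
      · rw [pw_one, if_pos rfl, mul_one] }

instance : Algebra F (PseudoDiffOp δ) :=
  Algebra.ofModule
    (fun r a b => by
      obtain ⟨A, hA⟩ := a.bdd
      obtain ⟨B, hB⟩ := b.bdd
      ext n
      refine Eq.trans ?_ (smul_finsum' r (comp_fin (δ := δ) hA hB n fun _ h => h)).symm
      exact finsum_congr fun i => smul_mul_assoc _ _ _)
    (fun r a b => by
      obtain ⟨A, hA⟩ := a.bdd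
      obtain ⟨B, hB⟩ := b.bdd
      ext n
      refine Eq.trans ?_ (smul_finsum' r (comp_fin (δ := δ) hA hB n fun _ h => h)).symm
      refine finsum_congr fun i => ?_
      rw [← mul_smul_comm, ← pw_smul i r hB]
      rfl)

/-- The operators all of whose coefficients lie in the subalgebra `W`, i.e. `W((∂⁻¹))`. -/
def coeffsIn (δ : Derivation F R R) (W : Subalgebra F R) : Submodule F (PseudoDiffOp δ) where
  carrier := {a | ∀ n, a.coeff n ∈ W}
  zero_mem' := fun _ => W.zero_mem
  add_mem' := fun ha hb n => W.add_mem (ha n) (hb n)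
  smul_mem' := fun c _ ha n => W.smul_mem (ha n) c

end PseudoDiffOp

end PseudoDiff

/-! ### Generalized quasideterminants -/

section Quasidet

variable {F : Type*} [Field F] {Ψ : Type*} [Ring Ψ] [Algebra F Ψ]
  {V V' : Type*} [AddCommGroup V] [Module F V] [AddCommGroup V'] [Module F V']

/-- `A ↦ J A I`, from `Ψ ⊗ End V` to `Ψ ⊗ End V'`. -/
def sandwich (J : V →ₗ[F] V') (I : V' →ₗ[F] V) :
    Ψ ⊗[F] Module.End F V →ₗ[F] Ψ ⊗[F] Module.End F V' :=
  LinearMap.lTensor Ψ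
    ((LinearMap.llcomp F V' V V' J) ∘ₗ (LinearMap.lcomp F V I) :
      Module.End F V →ₗ[F] Module.End F V')

/-- The `(I, J)`-quasideterminant `(J A⁻¹ I)⁻¹` is well defined: both inverses exist. -/
def QuasidetExists (J : V →ₗ[F] V') (I : V' →ₗ[F] V) (A : Ψ ⊗[F] Module.End F V) : Prop :=
  IsUnit A ∧ IsUnit (sandwich J I (Ring.inverse A))

/-- The `(I, J)`-quasideterminant `(J A⁻¹ I)⁻¹`, meaningful when `QuasidetExists J I A`. -/
def quasidet (J : V →ₗ[F] V') (I : V' →ₗ[F] V) (A : Ψ ⊗[F] Module.End F V) :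
    Ψ ⊗[F] Module.End F V' :=
  Ring.inverse (sandwich J I (Ring.inverse A))

/-- The `End V`-valued differential operator `∂ 𝟙 + M + ∑ᵢ aᵢ Nᵢ`. -/
def firstOrder {R : Type*} [CommRing R] [Algebra F R] (δ : Derivation F R R)
    (M : Module.End F V) {κ : Type*} [Fintype κ] (a : κ → R) (N : κ → Module.End F V) :
    PseudoDiffOp δ ⊗[F] Module.End F V :=
  PseudoDiffOp.monomial δ 1 1 ⊗ₜ[F] 1 + 1 ⊗ₜ[F] M
    + ∑ i, PseudoDiffOp.monomial δ 0 (a i) ⊗ₜ[F] N i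

end Quasidet

/-! ### Differential polynomials -/

section DiffPoly

/-- Differential polynomials over `F` in the differential variables `uᵢ`, `i ∈ κ`;
the variable `(i, n)` is the `n`-th derivative of `uᵢ`. -/
abbrev DiffPoly (F κ : Type*) [CommRing F] := MvPolynomial (κ × ℕ) F

variable {F κ : Type*} [CommRing F]

/-- The total derivative `∂`. -/
def der (F κ : Type*) [CommRing F] : Derivation F (DiffPoly F κ) (DiffPoly F κ) :=
  MvPolynomial.mkDerivation F fun p => MvPolynomial.X (p.1, p.2 + 1)

/-- The differential variable `uᵢ`. -/
def var (F : Type*) {κ : Type*} [CommRing F] (i : κ) : DiffPoly F κ := MvPolynomial.X (i, 0)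

/-- The differential algebra homomorphism to `(R, δ)` that sends `uᵢ` to `v i`. -/
def diffAeval {R : Type*} [CommRing R] [Algebra F R] (δ : Derivation F R R) (v : κ → R) :
    DiffPoly F κ →ₐ[F] R :=
  MvPolynomial.aeval fun p => δ^[p.2] (v p.1)

end DiffPoly

/-! ### Lie algebras -/

section Lie

/-- A finite-dimensional Lie algebra is reductive if its radical is its center. -/
def IsReductive (F g : Type*) [Field F] [LieRing g] [LieAlgebra F g] : Prop :=
  LieAlgebra.radical F g = LieAlgebra.center F g

variable {F g : Type*} [Field F] [LieRing g] [LieAlgebra F g]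

/-- `{f, 2x, e}` is an `sl₂`-triple (the zero triple is allowed). -/
structure IsTriple (f x e : g) : Prop where
  lie_x_e : ⁅x, e⁆ = e
  lie_x_f : ⁅x, f⁆ = -f
  lie_e_f : ⁅e, f⁆ = x + x

/-- The `ad x`-eigenspace of eigenvalue `n / 2`. -/
def piece (F : Type*) {g : Type*} [Field F] [LieRing g] [LieAlgebra F g] (x : g) (n : ℤ) :
    Submodule F g :=
  Module.End.eigenspace (LieAlgebra.ad F g x) ((n : F) / 2)

/-- The eigenspace of `ad X` on `End V` of eigenvalue `k`. -/
def endPiece {V : Type*} [AddCommGroup V] [Module F V] (X : Module.End F V) (k : F) :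
    Submodule F (Module.End F V) :=
  Module.End.eigenspace (LinearMap.mulLeft F X - LinearMap.mulRight F X) k

/-- Twice the depth `d`: the largest `n` such that `n / 2` is an eigenvalue of `ad x`. -/
def twiceDepth (F : Type*) {g : Type*} [Field F] [LieRing g] [LieAlgebra F g] (x : g) : ℤ :=
  sSup {n : ℤ | piece F x n ≠ ⊥}

end Lie

/-! ### The classical affine W-algebra -/

section WAlgebra

variable {F g ι : Type*} [Field F] [LieRing g] [LieAlgebra F g] [Fintype ι]

/-- The inclusion of `g` in `V(g)`, where `V(g)` is the algebra of differential polynomials in the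
basis `b`. -/
def gen (b : Module.Basis ι F g) (a : g) : DiffPoly F ι := ∑ i, b.repr a i • var F i

/-- The operator `λ + ∂` on `R[λ]`. -/
def lambdaAdd {R : Type*} [CommRing R] [Algebra F R] (δ : Derivation F R R)
    (p : Polynomial R) : Polynomial R :=
  Polynomial.X * p + PolynomialModule.equivPolynomialSelf (δ.mapCoeffs p)

/-- For `a ∈ g`, the map `h ↦ {a_λ h}_ε` on `V(g)`, for the affine `λ`-bracket
`{a_λ b}_ε = [a, b] + (a|b) λ + ε (s|[a, b])`, extended to differential polynomials `h` by the
Leibniz rule and by sesquilinearity `{a_λ ∂h} = (λ + ∂){a_λ h}`. -/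
def lambdaBracket (b : Module.Basis ι F g) (B : LinearMap.BilinForm F g) (s : g) (ε : F) (a : g) :
    Derivation F (DiffPoly F ι) (Polynomial (DiffPoly F ι)) :=
  MvPolynomial.mkDerivation F fun p => (lambdaAdd (der F ι))^[p.2]
    (Polynomial.C (gen b ⁅a, b p.1⁆)
      + Polynomial.C (MvPolynomial.C (B a (b p.1))) * Polynomial.X
      + Polynomial.C (MvPolynomial.C (ε * B s ⁅a, b p.1⁆)))

/-- The indices of basis vectors of `g_{≤ 1/2}`, where `deg i` is twice the `ad x`-eigenvalue. -/
abbrev Low (deg : ι → ℤ) : Type _ := {i : ι // deg i ≤ 1}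

open Classical in
/-- The differential algebra homomorphism `ρ : V(g) → V(g_{≤ 1/2})`, `a ↦ π_{≤ 1/2}(a) + (f|a)`. -/
def rho (b : Module.Basis ι F g) (B : LinearMap.BilinForm F g) (deg : ι → ℤ) (f : g) :
    DiffPoly F ι →ₐ[F] DiffPoly F (Low deg) :=
  diffAeval (der F (Low deg)) fun i =>
    (if h : deg i ≤ 1 then var F (⟨i, h⟩ : Low deg) else 0) + MvPolynomial.C (B f (b i))

/-- The inclusion `V(g_{≤ 1/2}) ⊆ V(g)`. -/
def incl (F : Type*) {ι : Type*} [Field F] (deg : ι → ℤ) :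
    DiffPoly F (Low deg) →ₐ[F] DiffPoly F ι :=
  diffAeval (der F ι) fun i => var F i.1

/-- The differential algebra `W_ε(g, f, s)`: all `w ∈ V(g_{≤ 1/2})` such that
`ρ {a_λ w}_ε = 0` for all `a ∈ g_{≥ 1/2}`. -/
def WAlg (b : Module.Basis ι F g) (B : LinearMap.BilinForm F g) (deg : ι → ℤ) (f x s : g) (ε : F) :
    Subalgebra F (DiffPoly F (Low deg)) where
  carrier := {w | ∀ a ∈ ⨆ n ∈ Set.Ici (1 : ℤ), piece F x n,
    (lambdaBracket b B s ε a (incl F deg w)).map (rho b B deg f).toRingHom = 0}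
  mul_mem' := by
    intro v w hv hw a ha
    have hv' := hv a ha
    have hw' := hw a ha
    rw [map_mul, Derivation.leibniz, Polynomial.map_add, Polynomial.smul_eq_C_mul,
      Polynomial.smul_eq_C_mul, Polynomial.map_mul, Polynomial.map_mul, hv', hw',
      mul_zero, mul_zero, add_zero]
  add_mem' := by
    intro v w hv hw a ha
    rw [map_add, map_add, Polynomial.map_add, hv a ha, hw a ha, add_zero]
  algebraMap_mem' := by
    intro c a _
    rw [AlgHom.commutes, Derivation.map_algebraMap, Polynomial.map_zero]

open Classical in
/-- The quotient map `V(g_{≤ 1/2}) → V(g^f)` whose kernel is the differential ideal generated by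
the `uᵢ`, `i ∉ If`. Here `V(g^f)` is the algebra of differential polynomials in `uᵢ`, `i ∈ If`. -/
def projCentralizer (F : Type*) {ι : Type*} [Field F] (deg : ι → ℤ) (If : Finset ι) :
    DiffPoly F (Low deg) →ₐ[F] DiffPoly F If :=
  diffAeval (der F If) fun i => if h : i.1 ∈ If then var F (⟨i.1, h⟩ : If) else 0

end WAlgebra

end ClassicalW

end

open ClassicalW

/-!
Everything rests on gauge transformations of the operator `L = ∂ + φ(f) + ∑ uᵢ Uⁱ`, where `i` runs
over the basis vectors of `g_{≤ 1/2}`. If `N` is invertible and of the form `1 + (positive degree)`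
for the grading of `End V` by `ad φ(x)`, the operator `N L N⁻¹` is a gauge transform of `L`
(`IsGauge` states this in `R ⊗ End V`, without `∂`).

*Canonical forms.* Since the dual basis vectors `uⁱ` with `uᵢ ∉ g^f` lie in the image of `ad f`, all
`uᵢ`-terms with `i ∉ I_f` can be removed degree by degree, by conjugation with exponentials of
elements of `g_{≥ 1/2}` (`IsAdapted.exists_gauge`). The result `∂ + φ(f) + ∑_{i ∈ I_f} lᵢ Uⁱ` is
unique, over every differential algebra (`IsAdapted.eq_of_isGauge`): by `IsAdapted.mem_filt_succ`,
two canonical forms are related only by `N = 1`.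

*The generators lie in the W-algebra.* The map `ρ{a_λ ·}` with `a ∈ g_{≥ 1/2}` is an infinitesimal
gauge transformation. It becomes the gauge transformation by `1 - τ a` over the dual numbers
`V(g_{≤ 1/2})[λ][τ]`, `τ² = 0`, with `∂τ = λτ` (`IsAdapted.isGauge_dual`). Uniqueness of canonical
forms over this differential algebra says that `ρ{a_λ lᵢ} = 0` (`IsAdapted.mem_WAlg_of_isGauge`).
Uniqueness over `V(g^f)` says that `π(lᵢ) = uᵢ` (`IsAdapted.projCentralizer_of_isGauge`).

*They generate freely.* It remains to see that `π` is injective on the W-algebra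
(`IsAdapted.eq_zero_of_projCentralizer_eq_zero`). Give the `n`-th derivative of a generator the
weight `n + 1`. If `[f, a] = uʲ`, the coefficient of `λᵏ` in `ρ{a_λ ·}` is, in lowest weight, the
partial derivative by the `k`-th derivative of `uⱼ`. Hence the lowest part of an element of the
W-algebra contains no `uⱼ` with `j ∉ I_f`, and an element of the kernel of `π` has no lowest part.

*Quasideterminants.* For `s ∈ g_d` one has `[s, g_{≥ 1/2}] = 0`. So `ε` does not matter for the
W-algebra, and `N` commutes with `φ(s)`. As `T` has the largest possible degree `D`, it is
annihilated on both sides by endomorphisms of positive degree, and gauge transformations do not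
change `J L⁻¹ I` (`quasidet_eq_of_isGauge`). This gives the equality of the two quasideterminants.
The canonical form has coefficients in the W-algebra, so its quasideterminant can be computed over this
differential algebra. Existence of the quasideterminants (`quasidetExists`) follows from a geometric
series: for degree reasons only the `D`-th power of `φ(f) ∂⁻¹` contributes to the leading
coefficient of `J L⁻¹ I`, which is `J (-φ(f))ᴰ I ∂^(-D-1)`, and `J φ(f)ᴰ I` is invertible because
`V = ker T ⊕ φ(f)ᴰ(im T)`.
-/

noncomputable section

namespace ClassicalW

/-! ### Spans of pure tensors and slices -/

section Tensor

variable {F : Type*} [Field F] {A B A' B' : Type*}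

section Module

variable [AddCommGroup A] [Module F A] [AddCommGroup B] [Module F B]
  [AddCommGroup A'] [Module F A'] [AddCommGroup B'] [Module F B']

/-- The image of `P ⊗ Q` in `A ⊗ B`: the span of the pure tensors `p ⊗ q` with `p ∈ P`,
`q ∈ Q`. -/
def tens (P : Submodule F A) (Q : Submodule F B) : Submodule F (A ⊗[F] B) :=
  Submodule.map₂ (TensorProduct.mk F A B) P Q

theorem tmul_mem_tens {P : Submodule F A} {Q : Submodule F B} {a : A} {b : B} (ha : a ∈ P)
    (hb : b ∈ Q) : a ⊗ₜ[F] b ∈ tens P Q :=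
  Submodule.apply_mem_map₂ _ ha hb

theorem tens_le {P : Submodule F A} {Q : Submodule F B} {S : Submodule F (A ⊗[F] B)} :
    tens P Q ≤ S ↔ ∀ a ∈ P, ∀ b ∈ Q, a ⊗ₜ[F] b ∈ S :=
  Submodule.map₂_le

theorem tens_mono {P P' : Submodule F A} {Q Q' : Submodule F B} (h : P ≤ P') (h' : Q ≤ Q') :
    tens P Q ≤ tens P' Q' :=
  Submodule.map₂_le_map₂ h h'

theorem tens_bot_right (P : Submodule F A) : tens P (⊥ : Submodule F B) = ⊥ :=
  Submodule.map₂_bot_right _ _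

/-- A linear map on `A ⊗ B` that sends the pure tensors of `P ⊗ Q` into `S` sends all of `P ⊗ Q`
into `S`. -/
theorem map_mem_of_mem_tens {C : Type*} [AddCommGroup C] [Module F C] {P : Submodule F A}
    {Q : Submodule F B} {x : A ⊗[F] B} (hx : x ∈ tens P Q) (h : A ⊗[F] B →ₗ[F] C)
    (S : Submodule F C) (H : ∀ a ∈ P, ∀ b ∈ Q, h (a ⊗ₜ b) ∈ S) : h x ∈ S :=
  (tens_le (S := S.comap h)).2 H hx

/-- Contraction of the first tensor factor against a linear form. -/
def slice (B : Type*) [AddCommGroup B] [Module F B] (c : A →ₗ[F] F) : A ⊗[F] B →ₗ[F] B :=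
  (TensorProduct.lid F B).toLinearMap ∘ₗ LinearMap.rTensor B c

@[simp] theorem slice_tmul (c : A →ₗ[F] F) (a : A) (b : B) : slice B c (a ⊗ₜ b) = c a • b := by
  simp [slice]

theorem mem_tens_top_iff {Q : Submodule F B} {x : A ⊗[F] B} :
    x ∈ tens ⊤ Q ↔ ∀ c : A →ₗ[F] F, slice B c x ∈ Q := by
  classical
  constructor
  · intro hx c
    refine map_mem_of_mem_tens hx _ _ fun a _ b hb => ?_
    rw [slice_tmul]
    exact Q.smul_mem _ hb
  · intro h
    let β := Module.Basis.ofVectorSpace F A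
    have key : ∀ (z : A ⊗[F] B) i,
        TensorProduct.equivFinsuppOfBasisLeft β z i = slice B (β.coord i) z := by
      intro z i
      induction z with
      | zero => simp
      | tmul a b => simp
      | add x y hx hy => simp only [map_add, Finsupp.add_apply, hx, hy]
    rw [← (TensorProduct.equivFinsuppOfBasisLeft β).symm_apply_apply x,
      TensorProduct.equivFinsuppOfBasisLeft_symm_apply]
    refine Submodule.sum_mem _ fun i _ => tmul_mem_tens trivial ?_
    rw [key]
    exact h _

/-- Elements `∑ᵢ rᵢ ⊗ vᵢ` with linearly independent `vᵢ` determine the coefficients `rᵢ`. -/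
theorem coeff_eq_of_sum_tmul_eq {κ : Type*} [Fintype κ] {v : κ → B} (hv : LinearIndependent F v)
    {r r' : κ → A} (h : ∑ i, r i ⊗ₜ[F] v i = ∑ i, r' i ⊗ₜ[F] v i) : r = r' := by
  funext i
  rw [← sub_eq_zero]
  refine (Module.forall_dual_apply_eq_zero_iff F _).1 fun c => ?_
  have h' := congrArg (slice B c) h
  simp only [map_sum, slice_tmul] at h'
  rw [← sub_eq_zero, ← Finset.sum_sub_distrib] at h'
  simp only [← sub_smul] at h'
  rw [map_sub]
  exact Fintype.linearIndependent_iff.1 hv _ h' i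

end Module

section Algebra

variable [Ring A] [Algebra F A] [Ring B] [Algebra F B] [Ring A'] [Algebra F A']

theorem mul_mem_tens {P P' P'' : Submodule F A} {Q Q' Q'' : Submodule F B}
    (hP : ∀ a ∈ P, ∀ b ∈ P', a * b ∈ P'') (hQ : ∀ a ∈ Q, ∀ b ∈ Q', a * b ∈ Q'')
    {x y : A ⊗[F] B} (hx : x ∈ tens P Q) (hy : y ∈ tens P' Q') : x * y ∈ tens P'' Q'' := by
  refine map_mem_of_mem_tens hx (LinearMap.mulRight F y) _ fun a ha b hb => ?_
  refine map_mem_of_mem_tens hy (LinearMap.mulLeft F (a ⊗ₜ[F] b)) _ fun a' ha' b' hb' => ?_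
  simpa using tmul_mem_tens (hP a ha a' ha') (hQ b hb b' hb')

theorem mul_sub_one_mem_tens {Q : Submodule F B} (hQ : ∀ a ∈ Q, ∀ c ∈ Q, a * c ∈ Q)
    {x y : A ⊗[F] B} (hx : x - 1 ∈ tens ⊤ Q) (hy : y - 1 ∈ tens ⊤ Q) : x * y - 1 ∈ tens ⊤ Q := by
  have e : x * y - 1 = (x - 1) * (y - 1) + (x - 1) + (y - 1) := by
    simp only [sub_mul, mul_sub, mul_one, one_mul]
    abel
  rw [e]
  exact add_mem (add_mem (mul_mem_tens (fun _ _ _ _ => Submodule.mem_top) hQ hx hy) hx) hy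

theorem slice_one_tmul_mul (c : A →ₗ[F] F) (b : B) (x : A ⊗[F] B) :
    slice B c (1 ⊗ₜ b * x) = b * slice B c x := by
  induction x with
  | zero => simp
  | tmul a b' => simp
  | add x y hx hy => rw [mul_add, map_add, map_add, mul_add, hx, hy]

theorem slice_mul_one_tmul (c : A →ₗ[F] F) (b : B) (x : A ⊗[F] B) :
    slice B c (x * 1 ⊗ₜ b) = slice B c x * b := by
  induction x with
  | zero => simp
  | tmul a b' => simp
  | add x y hx hy => rw [add_mul, map_add, map_add, add_mul, hx, hy]

/-- The algebra homomorphism `h ⊗ id`. -/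
def baseMap (B : Type*) [Ring B] [Algebra F B] (h : A →ₐ[F] A') : A ⊗[F] B →ₐ[F] A' ⊗[F] B :=
  Algebra.TensorProduct.map h (AlgHom.id F B)

@[simp] theorem baseMap_tmul (h : A →ₐ[F] A') (a : A) (b : B) :
    baseMap B h (a ⊗ₜ b) = h a ⊗ₜ b := by
  simp [baseMap]

theorem baseMap_mem_tens_top {Q : Submodule F B} (h : A →ₐ[F] A') {x : A ⊗[F] B}
    (hx : x ∈ tens ⊤ Q) : baseMap B h x ∈ tens ⊤ Q := by
  refine map_mem_of_mem_tens hx (baseMap B h).toLinearMap _ fun a _ b hb => ?_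
  rw [AlgHom.toLinearMap_apply, baseMap_tmul]
  exact tmul_mem_tens trivial hb

end Algebra

section Derivation

variable [CommRing A] [Algebra F A] [CommRing A'] [Algebra F A'] [Ring B] [Algebra F B]

/-- The derivation `δ ⊗ id` of `A ⊗ B`, as a linear map. -/
def tensDer (B : Type*) [Ring B] [Algebra F B] (δ : Derivation F A A) :
    A ⊗[F] B →ₗ[F] A ⊗[F] B :=
  LinearMap.rTensor B (δ : A →ₗ[F] A)

@[simp] theorem tensDer_tmul (δ : Derivation F A A) (a : A) (b : B) :
    tensDer B δ (a ⊗ₜ b) = δ a ⊗ₜ b := by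
  simp [tensDer]

theorem tensDer_mul (δ : Derivation F A A) (x y : A ⊗[F] B) :
    tensDer B δ (x * y) = x * tensDer B δ y + tensDer B δ x * y := by
  induction x with
  | zero => simp
  | add x y hx hy => simp only [add_mul, map_add, hx, hy]; abel
  | tmul a b =>
    induction y with
    | zero => simp
    | add x y hx hy => simp only [mul_add, map_add, hx, hy]; abel
    | tmul a' b' =>
      simp only [Algebra.TensorProduct.tmul_mul_tmul, tensDer_tmul, Derivation.leibniz,
        TensorProduct.add_tmul, smul_eq_mul]
      rw [mul_comm a' (δ a)]

@[simp] theorem tensDer_one (δ : Derivation F A A) : tensDer B δ 1 = 0 := by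
  rw [Algebra.TensorProduct.one_def, tensDer_tmul, Derivation.map_one_eq_zero,
    TensorProduct.zero_tmul]

theorem tensDer_mem_tens_top {Q : Submodule F B} (δ : Derivation F A A) {x : A ⊗[F] B}
    (hx : x ∈ tens ⊤ Q) : tensDer B δ x ∈ tens ⊤ Q := by
  refine map_mem_of_mem_tens hx _ _ fun a _ b hb => ?_
  rw [tensDer_tmul]
  exact tmul_mem_tens trivial hb

theorem baseMap_tensDer {δ : Derivation F A A} {δ' : Derivation F A' A'} {h : A →ₐ[F] A'}
    (hδ : ∀ a, h (δ a) = δ' (h a)) (x : A ⊗[F] B) :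
    baseMap B h (tensDer B δ x) = tensDer B δ' (baseMap B h x) := by
  induction x with
  | zero => simp
  | add x y hx hy => simp only [map_add, hx, hy]
  | tmul a b => simp [hδ]

end Derivation

end Tensor

/-! ### Order filtration and functoriality of pseudodifferential operators -/

namespace PseudoDiffOp

section Ring

variable {F R : Type*} [CommRing F] [CommRing R] [Algebra F R] {δ : Derivation F R R}

/-- The operator with coefficients `c n`, which vanish for `n > N`. -/
def ofCoeff (δ : Derivation F R R) (c : ℤ → R) (N : ℤ) (h : ∀ n, N < n → c n = 0) :
    PseudoDiffOp δ := ⟨c, N, h⟩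

theorem coeff_ofCoeff (c : ℤ → R) (N : ℤ) (h : ∀ n, N < n → c n = 0) (n : ℤ) :
    (ofCoeff δ c N h).coeff n = c n := rfl

theorem coeff_sub (a b : PseudoDiffOp δ) (n : ℤ) : (a - b).coeff n = a.coeff n - b.coeff n := rfl

theorem coeff_sum {κ : Type*} (s : Finset κ) (a : κ → PseudoDiffOp δ) (n : ℤ) :
    (∑ k ∈ s, a k).coeff n = ∑ k ∈ s, (a k).coeff n := by
  classical
  induction s using Finset.induction_on with
  | empty => rfl
  | insert k s hk ih => rw [Finset.sum_insert hk, Finset.sum_insert hk, coeff_add, ih]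

theorem coeff_monomial_mul (m : ℤ) (r : R) (b : PseudoDiffOp δ) (n : ℤ) :
    (monomial δ m r * b).coeff n = r * pw δ m b.coeff n := by
  refine (finsum_eq_single _ m fun i hi => ?_).trans ?_
  · rw [coeff_monomial, if_neg hi, zero_mul]
  · rw [coeff_monomial, if_pos rfl]

theorem pw_monomial_one (m n k : ℤ) :
    pw δ m (monomial δ n 1).coeff k = if k = m + n then 1 else 0 := by
  unfold pw
  rw [finsum_eq_single _ 0]
  · simp only [coeff_monomial, Nat.cast_zero, add_zero, Ring.choose_zero_right, one_smul,
      Function.iterate_zero, id_eq]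
    congr 1
    rw [eq_iff_iff]
    omega
  · intro l hl
    obtain ⟨l, rfl⟩ := Nat.exists_eq_succ_of_ne_zero hl
    have h : δ ((monomial δ n 1).coeff (k - m + (l + 1 : ℕ))) = 0 := by
      rw [coeff_monomial]; split_ifs <;> simp
    rw [Function.iterate_succ_apply, h, iter_zero, smul_zero]

theorem monomial_mul_monomial_one (m n : ℤ) (r : R) :
    monomial δ m r * monomial δ n 1 = monomial δ (m + n) r := by
  ext k
  rw [coeff_monomial_mul, pw_monomial_one, coeff_monomial]
  split_ifs <;> simp

theorem monomial_zero_mul_monomial (r r' : R) (n : ℤ) :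
    monomial δ 0 r * monomial δ n r' = monomial δ n (r * r') := by
  ext k
  rw [coeff_monomial_mul, pw_zero, coeff_monomial, coeff_monomial]
  split_ifs <;> simp

theorem monomial_one_mul_monomial_zero (r : R) :
    monomial δ 1 1 * monomial δ 0 r = monomial δ 0 r * monomial δ 1 1 + monomial δ 0 (δ r) := by
  obtain ⟨N, hN⟩ := (monomial δ 0 r).bdd
  ext k
  have h := pw_succ (δ := δ) hN 0 k
  rw [zero_add, pw_zero, pw_zero] at h
  rw [coeff_monomial_mul, one_mul, h, monomial_mul_monomial_one, coeff_add]
  simp only [coeff_monomial, sub_eq_zero, zero_add]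
  split_ifs <;> simp

theorem one_eq_monomial : (1 : PseudoDiffOp δ) = monomial δ 0 1 := rfl

/-- The inclusion `R → R((∂⁻¹))` of the differential operators of order zero. -/
def constHom (δ : Derivation F R R) : R →ₐ[F] PseudoDiffOp δ where
  toFun r := monomial δ 0 r
  map_one' := rfl
  map_mul' r r' := (monomial_zero_mul_monomial r r' 0).symm
  map_zero' := by ext n; rw [coeff_monomial]; simp
  map_add' r r' := by
    ext n
    simp only [coeff_add, coeff_monomial]
    split_ifs <;> simp
  commutes' c := by
    rw [Algebra.algebraMap_eq_smul_one (A := PseudoDiffOp δ), one_eq_monomial]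
    ext n
    simp only [coeff_smul, coeff_monomial]
    split_ifs
    · rw [Algebra.algebraMap_eq_smul_one]
    · simp

theorem constHom_apply (r : R) : constHom δ r = monomial δ 0 r := rfl

/-- The operators of order at most `m`. -/
def ordLE (δ : Derivation F R R) (m : ℤ) : Submodule F (PseudoDiffOp δ) where
  carrier := {a | ∀ n, m < n → a.coeff n = 0}
  zero_mem' := fun _ _ => rfl
  add_mem' := fun ha hb n hn => by rw [coeff_add, ha n hn, hb n hn, add_zero]
  smul_mem' := fun c a ha n hn => by rw [coeff_smul, ha n hn, smul_zero]

theorem ordLE_mono {m n : ℤ} (h : m ≤ n) : ordLE δ m ≤ ordLE δ n :=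
  fun _ ha k hk => ha k (by omega)

theorem mul_mem_ordLE {m n : ℤ} {a b : PseudoDiffOp δ} (ha : a ∈ ordLE δ m)
    (hb : b ∈ ordLE δ n) : a * b ∈ ordLE δ (m + n) :=
  fun _ hk => comp_eq_zero ha hb hk

theorem monomial_mem_ordLE {m : ℤ} (r : R) : monomial δ m r ∈ ordLE δ m := by
  intro n hn
  rw [coeff_monomial, if_neg (by omega)]

theorem eq_zero_of_forall_mem_ordLE {a : PseudoDiffOp δ} (h : ∀ m : ℕ, a ∈ ordLE δ (-m)) :
    a = 0 := by
  ext n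
  exact h (1 - n).toNat n (by omega)

/-- Completeness for the order filtration: a series `∑ₖ aₖ` with `aₖ` of order at most `-k`
converges. -/
theorem exists_sum (a : ℕ → PseudoDiffOp δ) (ha : ∀ k : ℕ, a k ∈ ordLE δ (-k)) :
    ∃ s : PseudoDiffOp δ, ∀ m : ℕ, s - ∑ k ∈ Finset.range m, a k ∈ ordLE δ (-m) := by
  refine ⟨ofCoeff δ (fun n => ∑ k ∈ Finset.range (1 - n).toNat, (a k).coeff n) 0 fun n hn => ?_,
    fun m n hn => ?_⟩
  · rw [show (1 - n).toNat = 0 by omega, Finset.range_zero, Finset.sum_empty]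
  · rw [coeff_sub, coeff_ofCoeff, coeff_sum, sub_eq_zero]
    refine Finset.sum_subset (Finset.range_subset_range.2 (by omega)) fun k _ hk => ?_
    refine ha k n ?_
    rw [Finset.mem_range] at hk
    omega

variable {R' : Type*} [CommRing R'] [Algebra F R'] {δ' : Derivation F R' R'}

theorem map_iterate {h : R →ₐ[F] R'} (hδ : ∀ a, h (δ a) = δ' (h a)) (k : ℕ) (r : R) :
    h (δ^[k] r) = δ'^[k] (h r) := by
  induction k with
  | zero => rfl
  | succ k ih => rw [Function.iterate_succ_apply', Function.iterate_succ_apply', hδ, ih]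

theorem map_pw {h : R →ₐ[F] R'} (hδ : ∀ a, h (δ a) = δ' (h a)) {u : ℤ → R} {N : ℤ}
    (hN : ∀ n, N < n → u n = 0) (i n : ℤ) :
    h (pw δ i u n) = pw δ' i (fun m => h (u m)) n := by
  have hf := pw_fin (δ := δ) hN i n 0
  simp only [add_zero] at hf
  refine ((h : R →+ R').map_finsum hf).trans (finsum_congr fun k => ?_)
  change h (_ • _) = _
  rw [map_zsmul, map_iterate hδ]

/-- A homomorphism of differential algebras, applied to all coefficients. -/
def map (h : R →ₐ[F] R') (hδ : ∀ a, h (δ a) = δ' (h a)) :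
    PseudoDiffOp δ →ₐ[F] PseudoDiffOp δ' where
  toFun a := ⟨fun n => h (a.coeff n), by
    obtain ⟨N, hN⟩ := a.bdd
    exact ⟨N, fun n hn => by dsimp only; rw [hN n hn, map_zero]⟩⟩
  map_one' := by
    ext n
    change h ((1 : PseudoDiffOp δ).coeff n) = (1 : PseudoDiffOp δ').coeff n
    rw [one_eq_monomial, one_eq_monomial, coeff_monomial, coeff_monomial]
    split_ifs <;> simp
  map_mul' a b := by
    obtain ⟨A, hA⟩ := a.bdd
    obtain ⟨B, hB⟩ := b.bdd
    ext n
    refine ((h : R →+ R').map_finsum (comp_fin (δ := δ) hA hB n fun _ h => h)).trans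
      (finsum_congr fun i => ?_)
    change h (_ * _) = _
    rw [map_mul, map_pw hδ hB]
    rfl
  map_zero' := by ext n; exact map_zero h
  map_add' a b := by ext n; exact map_add h _ _
  commutes' c := by
    rw [Algebra.algebraMap_eq_smul_one, Algebra.algebraMap_eq_smul_one, one_eq_monomial,
      one_eq_monomial]
    ext n
    change h ((c • monomial δ 0 1).coeff n) = _
    rw [coeff_smul, coeff_smul, coeff_monomial, coeff_monomial, map_smul]
    split_ifs <;> simp

theorem coeff_map (h : R →ₐ[F] R') (hδ : ∀ a, h (δ a) = δ' (h a)) (a : PseudoDiffOp δ) (n : ℤ) :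
    (map h hδ a).coeff n = h (a.coeff n) := rfl

theorem map_monomial (h : R →ₐ[F] R') (hδ : ∀ a, h (δ a) = δ' (h a)) (m : ℤ) (r : R) :
    map h hδ (monomial δ m r) = monomial δ' m (h r) := by
  ext n
  rw [coeff_map, coeff_monomial, coeff_monomial]
  split_ifs <;> simp

end Ring

section Complete

variable {F R : Type*} [Field F] [CommRing R] [Algebra F R] {δ : Derivation F R R}
  {E : Type*} [Ring E] [Algebra F E]

theorem mem_tens_ordLE_iff {κ : Type*} [Fintype κ] [DecidableEq κ] (β : Module.Basis κ F E)
    {m : ℤ} {x : PseudoDiffOp δ ⊗[F] E} : x ∈ tens (ordLE δ m) ⊤ ↔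
      ∀ i, TensorProduct.equivFinsuppOfBasisRight β x i ∈ ordLE δ m := by
  constructor
  · intro hx i
    refine map_mem_of_mem_tens hx (Finsupp.lapply i ∘ₗ
      (TensorProduct.equivFinsuppOfBasisRight β).toLinearMap) _ fun a ha b _ => ?_
    simpa using Submodule.smul_mem _ _ ha
  · intro h
    rw [← (TensorProduct.equivFinsuppOfBasisRight β).symm_apply_apply x,
      TensorProduct.equivFinsuppOfBasisRight_symm_apply]
    exact Submodule.sum_mem _ fun i _ => tmul_mem_tens (h i) trivial

theorem mul_mem_tens_ordLE {m n : ℤ} {x y : PseudoDiffOp δ ⊗[F] E}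
    (hx : x ∈ tens (ordLE δ m) ⊤) (hy : y ∈ tens (ordLE δ n) ⊤) :
    x * y ∈ tens (ordLE δ (m + n)) ⊤ :=
  mul_mem_tens (fun _ ha _ hb => mul_mem_ordLE ha hb) (fun _ _ _ _ => Submodule.mem_top) hx hy

theorem pow_mem_tens_ordLE {x : PseudoDiffOp δ ⊗[F] E} (hx : x ∈ tens (ordLE δ (-1)) ⊤) (k : ℕ) :
    x ^ k ∈ tens (ordLE δ (-k)) ⊤ := by
  induction k with
  | zero =>
    rw [pow_zero, Algebra.TensorProduct.one_def]
    refine tmul_mem_tens ?_ trivial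
    simpa [one_eq_monomial] using monomial_mem_ordLE (δ := δ) (m := 0) (1 : R)
  | succ k ih =>
    rw [pow_succ]
    convert mul_mem_tens_ordLE ih hx using 2
    push_cast; ring_nf

variable [FiniteDimensional F E]

theorem eq_zero_of_forall_mem_tens {x : PseudoDiffOp δ ⊗[F] E}
    (h : ∀ m : ℕ, x ∈ tens (ordLE δ (-m)) ⊤) : x = 0 := by
  let β := Module.finBasis F E
  refine (TensorProduct.equivFinsuppOfBasisRight β).map_eq_zero_iff.1 (Finsupp.ext fun i => ?_)
  exact eq_zero_of_forall_mem_ordLE fun m => (mem_tens_ordLE_iff β).1 (h m) i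

theorem exists_tens_sum (a : ℕ → PseudoDiffOp δ ⊗[F] E)
    (ha : ∀ k : ℕ, a k ∈ tens (ordLE δ (-k)) ⊤) :
    ∃ s, ∀ m : ℕ, s - ∑ k ∈ Finset.range m, a k ∈ tens (ordLE δ (-m)) ⊤ := by
  let β := Module.finBasis F E
  choose s hs using fun i => exists_sum
    (fun k => TensorProduct.equivFinsuppOfBasisRight β (a k) i)
    fun k : ℕ => (mem_tens_ordLE_iff β).1 (ha k) i
  refine ⟨(TensorProduct.equivFinsuppOfBasisRight β).symm (Finsupp.equivFunOnFinite.symm s),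
    fun m => (mem_tens_ordLE_iff β).2 fun i => ?_⟩
  have := hs i m
  rwa [map_sub, LinearEquiv.apply_symm_apply, map_sum, Finsupp.sub_apply, Finsupp.finsetSum_apply]

/-- The geometric series: if `x` has negative order, `1 - x` is invertible, and its inverse is
`1 + x + ⋯ + x ^ (m - 1)` up to operators of order at most `-m`. -/
theorem exists_inverse_one_sub {x : PseudoDiffOp δ ⊗[F] E} (hx : x ∈ tens (ordLE δ (-1)) ⊤) :
    ∃ s, s * (1 - x) = 1 ∧ (1 - x) * s = 1 ∧
      ∀ m : ℕ, s - ∑ k ∈ Finset.range m, x ^ k ∈ tens (ordLE δ (-m)) ⊤ := by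
  obtain ⟨s, hs⟩ := exists_tens_sum (fun k => x ^ k) (pow_mem_tens_ordLE hx)
  have h1 : (1 - x) ∈ tens (ordLE δ 0) (⊤ : Submodule F E) := by
    refine sub_mem ?_ (tens_mono (ordLE_mono (by norm_num)) le_rfl hx)
    simpa using pow_mem_tens_ordLE hx 0
  refine ⟨s, ?_, ?_, hs⟩ <;> rw [← sub_eq_zero] <;>
    refine eq_zero_of_forall_mem_tens (δ := δ) fun m => ?_
  · have e : s * (1 - x) - 1 = (s - ∑ k ∈ Finset.range m, x ^ k) * (1 - x) - x ^ m := by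
      rw [sub_mul, geom_sum_mul_neg]; abel
    rw [e]
    refine sub_mem ?_ (pow_mem_tens_ordLE hx m)
    simpa using mul_mem_tens_ordLE (hs m) h1
  · have e : (1 - x) * s - 1 = (1 - x) * (s - ∑ k ∈ Finset.range m, x ^ k) - x ^ m := by
      rw [mul_sub, mul_neg_geom_sum]; abel
    rw [e]
    refine sub_mem ?_ (pow_mem_tens_ordLE hx m)
    simpa using mul_mem_tens_ordLE h1 (hs m)

theorem isUnit_one_sub {x : PseudoDiffOp δ ⊗[F] E} (hx : x ∈ tens (ordLE δ (-1)) ⊤) :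
    IsUnit (1 - x) := by
  obtain ⟨s, h1, h2, -⟩ := exists_inverse_one_sub hx
  exact isUnit_iff_exists.2 ⟨s, h2, h1⟩

end Complete

end PseudoDiffOp

/-! ### Gradings and `sl₂`-theory -/

section Above

variable {F : Type*} [Field F] {A B C : Type*} [AddCommGroup A] [Module F A] [AddCommGroup B]
  [Module F B] [AddCommGroup C] [Module F C]

/-- The sum of the subspaces `P m` with `m ≥ n`. -/
def above (P : ℤ → Submodule F A) (n : ℤ) : Submodule F A := ⨆ m ∈ Set.Ici n, P m

theorem above_le {P : ℤ → Submodule F A} {n : ℤ} {S : Submodule F A} :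
    above P n ≤ S ↔ ∀ m, n ≤ m → P m ≤ S := by
  simp [above]

theorem le_above {P : ℤ → Submodule F A} {n m : ℤ} (h : n ≤ m) : P m ≤ above P n :=
  above_le.1 le_rfl m h

theorem above_antitone (P : ℤ → Submodule F A) : Antitone (above P) :=
  fun _ _ h => above_le.2 fun _ hm => le_above (h.trans hm)

theorem bilin_mem_above {P : ℤ → Submodule F A} {Q : ℤ → Submodule F B} {S : ℤ → Submodule F C}
    (h : A →ₗ[F] B →ₗ[F] C) (H : ∀ m n, ∀ a ∈ P m, ∀ b ∈ Q n, h a b ∈ S (m + n))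
    {m n : ℤ} {a : A} {b : B} (ha : a ∈ above P m) (hb : b ∈ above Q n) :
    h a b ∈ above S (m + n) := by
  have h1 : above P m ≤ (above S (m + n)).comap (h.flip b) := by
    refine above_le.2 fun k hk a ha => ?_
    have h2 : above Q n ≤ (above S (m + n)).comap (h a) :=
      above_le.2 fun l hl b hb => le_above (by omega) (H k l a ha b hb)
    exact h2 hb
  exact h1 ha

/-- An element of degree at least `n` is the sum of one of degree `n` and one of higher degree. -/
theorem exists_add_of_mem_above {P : ℤ → Submodule F A} {n : ℤ} {a : A} (ha : a ∈ above P n) :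
    ∃ a₀ ∈ P n, ∃ a₁ ∈ above P (n + 1), a = a₀ + a₁ := by
  have h : above P n ≤ P n ⊔ above P (n + 1) := by
    refine above_le.2 fun m hm => ?_
    rcases hm.eq_or_lt with rfl | hm
    · exact le_sup_left
    · exact (le_above (by omega)).trans le_sup_right
  obtain ⟨a₀, h₀, a₁, h₁, rfl⟩ := Submodule.mem_sup.1 (h ha)
  exact ⟨a₀, h₀, a₁, h₁, rfl⟩

/-- An eigenvector of eigenvalue `n / 2` is not a sum of eigenvectors of larger eigenvalues. -/
theorem disjoint_eigenspace_above [CharZero F] (T : Module.End F A) {n m : ℤ} (h : n < m) :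
    Disjoint (T.eigenspace ((n : F) / 2)) (above (fun k => T.eigenspace ((k : F) / 2)) m) := by
  refine (T.eigenspaces_iSupIndep ((n : F) / 2)).mono_right (above_le.2 fun k hk => ?_)
  refine le_iSup₂_of_le ((k : F) / 2) ?_ le_rfl
  intro h'
  have : (k : F) = n := by linear_combination 2 * h'
  have := Int.cast_injective this
  omega

end Above

section Eigen

variable {F : Type*} [Field F] [CharZero F] {A : Type*} [AddCommGroup A] [Module F A]
  [FiniteDimensional F A]

/-- A sequence of eigenvectors with pairwise distinct eigenvalues in arithmetic progression
reaches zero. -/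
theorem exists_eq_zero_of_eigenvalue_progression (T : Module.End F A) (c d : F) (hd : d ≠ 0)
    (v : ℕ → A) (hv : ∀ k, T (v k) = (c + k * d) • v k) : ∃ k, v k = 0 := by
  by_contra! h
  have hs : (Set.range fun k : ℕ => c + k * d).Infinite :=
    Set.infinite_range_of_injective fun a b hab => by simpa [hd] using hab
  refine hs (T.finite_hasEigenvalue.subset ?_)
  rintro _ ⟨k, rfl⟩
  exact Module.End.hasEigenvalue_of_hasEigenvector
    ⟨Module.End.mem_eigenspace_iff.2 (hv k), h k⟩

end Eigen

section Grading

variable {F g V : Type*} [Field F] [LieRing g] [LieAlgebra F g] [AddCommGroup V] [Module F V]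

theorem mem_endPiece {X A : Module.End F V} {k : F} :
    A ∈ endPiece X k ↔ X * A - A * X = k • A := by
  simp [endPiece]

theorem mul_mem_endPiece {X A B : Module.End F V} {k l : F} (hA : A ∈ endPiece X k)
    (hB : B ∈ endPiece X l) : A * B ∈ endPiece X (k + l) := by
  rw [mem_endPiece] at *
  calc X * (A * B) - A * B * X = (X * A - A * X) * B + A * (X * B - B * X) := by noncomm_ring
    _ = _ := by rw [hA, hB, smul_mul_assoc, mul_smul_comm, add_smul]

theorem one_mem_endPiece (X : Module.End F V) : 1 ∈ endPiece X 0 := by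
  simp [mem_endPiece]

theorem mem_piece {x a : g} {n : ℤ} : a ∈ piece F x n ↔ ⁅x, a⁆ = ((n : F) / 2) • a := by
  simp [piece]

theorem lie_mem_piece {x a b : g} {m n : ℤ} (ha : a ∈ piece F x m) (hb : b ∈ piece F x n) :
    ⁅a, b⁆ ∈ piece F x (m + n) := by
  rw [mem_piece] at *
  rw [leibniz_lie, ha, hb, smul_lie, lie_smul, ← add_smul]
  push_cast
  ring_nf

theorem IsTriple.f_mem [CharZero F] {f x e : g} (h : IsTriple f x e) : f ∈ piece F x (-2) := by
  rw [mem_piece, h.lie_x_f]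
  norm_num

variable (F) in
theorem IsTriple.isSl2Triple [CharZero F] {f x e : g} (h : IsTriple f x e) (hf : f ≠ 0) :
    IsSl2Triple (x + x) e f where
  h_ne_zero := by
    intro h0
    have hx : x = 0 := by
      rw [← two_smul F x] at h0
      exact (smul_eq_zero.1 h0).resolve_left two_ne_zero
    apply hf
    rw [← neg_eq_zero, ← h.lie_x_f, hx, zero_lie]
  lie_e_f := h.lie_e_f
  lie_h_e_nsmul := by rw [add_lie, h.lie_x_e, two_smul]
  lie_h_f_nsmul := by rw [add_lie, h.lie_x_f, two_smul, neg_add]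

variable (F) in
theorem IsTriple.x_eq_zero [CharZero F] {f x e : g} (h : IsTriple f x e) (hf : f = 0) :
    x = 0 := by
  have h0 := h.lie_e_f
  rw [hf, lie_zero, ← two_smul F x] at h0
  exact (smul_eq_zero.1 h0.symm).resolve_left two_ne_zero

variable [LieRingModule g V] [LieModule F g V]

theorem toEnd_lie (a b : g) : LieModule.toEnd F g V ⁅a, b⁆ =
    LieModule.toEnd F g V a * LieModule.toEnd F g V b -
      LieModule.toEnd F g V b * LieModule.toEnd F g V a := by
  ext v
  simp

theorem toEnd_mem_endPiece {x a : g} {n : ℤ} (ha : a ∈ piece F x n) :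
    LieModule.toEnd F g V a ∈ endPiece (LieModule.toEnd F g V x) ((n : F) / 2) := by
  rw [mem_piece] at ha
  rw [mem_endPiece, ← toEnd_lie, ha, map_smul]

theorem lie_end_eq (a : g) (A : Module.End F V) :
    ⁅a, A⁆ = LieModule.toEnd F g V a * A - A * LieModule.toEnd F g V a := by
  ext v
  simp

/-- The trace pairing only sees degree zero. -/
theorem trace_eq_zero_of_mem_endPiece {X A : Module.End F V} {k : F} (hk : k ≠ 0)
    (hA : A ∈ endPiece X k) : LinearMap.trace F V A = 0 := by
  have h := congrArg (LinearMap.trace F V) (mem_endPiece.1 hA)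
  rw [map_sub, LinearMap.trace_mul_comm, sub_self, map_smul, smul_eq_mul] at h
  exact (mul_eq_zero.1 h.symm).resolve_left hk

theorem pow_mem_endPiece {X A : Module.End F V} {k : F} (hA : A ∈ endPiece X k) (n : ℕ) :
    A ^ n ∈ endPiece X (n * k) := by
  induction n with
  | zero => simpa using one_mem_endPiece X
  | succ n ih =>
    rw [pow_succ]
    convert mul_mem_endPiece ih hA using 2
    push_cast; ring

variable [CharZero F] [FiniteDimensional F V]

/-- The lowering operator is injective on endomorphisms of positive degree: an element of its kernel
is a primitive vector for the opposite triple, of negative weight. -/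
theorem eq_zero_of_commute_of_mem_endPiece {f x e : g} (h : IsTriple f x e)
    {A : Module.End F V} {j : ℤ} (hj : 0 < j)
    (hA : A ∈ endPiece (LieModule.toEnd F g V x) ((j : F) / 2))
    (hf : LieModule.toEnd F g V f * A = A * LieModule.toEnd F g V f) : A = 0 := by
  have hj' : (j : F) ≠ 0 := by exact_mod_cast hj.ne'
  by_cases hf0 : f = 0
  · rw [h.x_eq_zero F hf0, mem_endPiece, map_zero, zero_mul, mul_zero, sub_zero] at hA
    exact (smul_eq_zero.1 hA.symm).resolve_left (by simpa using hj')
  by_contra hne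
  have hA' := mem_endPiece.1 hA
  have P : (h.isSl2Triple F hf0).symm.HasPrimitiveVectorWith A (-(j : F)) :=
    { ne_zero := hne
      lie_h := by
        rw [neg_lie, add_lie, lie_end_eq, hA', ← add_smul, add_halves, neg_smul]
      lie_e := by rw [lie_end_eq, hf, sub_self] }
  obtain ⟨n, hn⟩ := P.exists_nat
  have : (-j : ℤ) = n := by exact_mod_cast hn
  omega

theorem IsTriple.pow_toEnd_f_eq_zero {f x e : g} (h : IsTriple f x e) :
    LieModule.toEnd F g V f ^ (nilpotencyClass (LieModule.toEnd F g V f) - 1 + 1) = 0 := by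
  set φf := LieModule.toEnd F g V f
  have hf : φf ∈ endPiece (LieModule.toEnd F g V x) (-1) := by
    convert toEnd_mem_endPiece (V := V) (h.f_mem (F := F)) using 2
    norm_num
  obtain ⟨k, hk⟩ := exists_eq_zero_of_eigenvalue_progression
    (LinearMap.mulLeft F (LieModule.toEnd F g V x) - LinearMap.mulRight F (LieModule.toEnd F g V x))
    0 (-1) (by norm_num) (fun k => φf ^ k) fun k => by
      rw [zero_add]
      exact Module.End.mem_eigenspace_iff.1 (pow_mem_endPiece hf k)
  exact pow_eq_zero_of_le (by omega) (pow_nilpotencyClass ⟨k, hk⟩)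

/-- If `φ(f) ^ (D + 1) = 0`, the endomorphisms have degrees at most `D`: otherwise the submodule of
`End V` generated by one of degree `m / 2 > D` contains a primitive vector of weight larger than
`2 D`, while `(ad φ(f)) ^ (2 D + 1) = 0`. -/
theorem endPiece_eq_bot {f x e : g} (h : IsTriple f x e) {D : ℕ}
    (hD : LieModule.toEnd F g V f ^ (D + 1) = 0) {m : ℤ} (hm : 2 * (D : ℤ) < m) :
    endPiece (LieModule.toEnd F g V x) ((m : F) / 2) = ⊥ := by
  rw [eq_bot_iff]
  intro A hA
  rw [Submodule.mem_bot]
  have hm' : (m : F) ≠ 0 := by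
    have : m ≠ 0 := by omega
    exact_mod_cast this
  by_cases hf0 : f = 0
  · rw [h.x_eq_zero F hf0, mem_endPiece, map_zero, zero_mul, mul_zero, sub_zero] at hA
    exact (smul_eq_zero.1 hA.symm).resolve_left (by simpa using hm')
  by_contra hne
  have t := h.isSl2Triple F hf0
  let E := LieModule.toEnd F g (Module.End F V) e
  have hE : ∀ k : ℕ, ⁅x + x, (E ^ k) A⁆ = ((m : F) + k * 2) • (E ^ k) A := by
    intro k
    induction k with
    | zero =>
      rw [pow_zero, Module.End.one_apply, add_lie, lie_end_eq, mem_endPiece.1 hA, ← add_smul]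
      simp
    | succ k ih =>
      rw [pow_succ', Module.End.mul_apply]
      change ⁅x + x, ⁅e, (E ^ k) A⁆⁆ = _ • ⁅e, (E ^ k) A⁆
      rw [leibniz_lie, ih, t.lie_h_e_nsmul, nsmul_lie, lie_smul, ← Nat.cast_smul_eq_nsmul F,
        ← add_smul]
      push_cast
      ring_nf
  have h0 := exists_eq_zero_of_eigenvalue_progression
    (LieModule.toEnd F g (Module.End F V) (x + x)) (m : F) 2 two_ne_zero (fun k => (E ^ k) A) hE
  obtain ⟨k, hk, hk'⟩ := Nat.exists_not_and_succ_of_not_zero_of_exists (p := fun k => (E ^ k) A = 0)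
    (by simpa using hne) h0
  have P : t.HasPrimitiveVectorWith ((E ^ k) A) ((m : F) + k * 2) :=
    { ne_zero := hk
      lie_h := hE k
      lie_e := by rw [pow_succ', Module.End.mul_apply] at hk'; exact hk' }
  obtain ⟨n, hn⟩ := P.exists_nat
  have hn' : m + k * 2 = n := by exact_mod_cast hn
  refine P.pow_toEnd_f_ne_zero_of_eq_nat hn (i := n) le_rfl ?_
  have hadf : LieModule.toEnd F g (Module.End F V) f =
      LinearMap.mulLeft F (LieModule.toEnd F g V f) +
        LinearMap.mulRight F (-LieModule.toEnd F g V f) := by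
    ext1 B
    rw [LieModule.toEnd_apply_apply, lie_end_eq]
    simp [sub_eq_add_neg]
  have hz : LieModule.toEnd F g (Module.End F V) f ^ n = 0 := by
    rw [hadf]
    refine Commute.add_pow_eq_zero_of_add_le_succ_of_pow_eq_zero ?_ (m := D + 1) (n := D + 1)
      ?_ ?_ (by omega)
    · exact LinearMap.commute_mulLeft_right _ _
    · rw [LinearMap.pow_mulLeft, hD, LinearMap.mulLeft_zero_eq_zero]
    · rw [LinearMap.pow_mulRight, neg_pow, hD, mul_zero, LinearMap.mulRight_zero_eq_zero]
  rw [hz, LinearMap.zero_apply]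

end Grading

/-! ### Existence of the quasideterminant -/

section Filtration

variable {F V : Type*} [Field F] [AddCommGroup V] [Module F V]

/-- The endomorphisms of degree at least `n / 2` for the grading by `ad X`. -/
def filt (X : Module.End F V) (n : ℤ) : Submodule F (Module.End F V) :=
  above (fun k => endPiece X ((k : F) / 2)) n

theorem filt_antitone (X : Module.End F V) : Antitone (filt X) := above_antitone _

theorem endPiece_le_filt (X : Module.End F V) {n m : ℤ} (h : n ≤ m) :
    endPiece X ((m : F) / 2) ≤ filt X n :=
  le_above (P := fun k : ℤ => endPiece X ((k : F) / 2)) h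

theorem mul_mem_filt {X A B : Module.End F V} {m n : ℤ} (hA : A ∈ filt X m) (hB : B ∈ filt X n) :
    A * B ∈ filt X (m + n) := by
  refine bilin_mem_above (LinearMap.mul F (Module.End F V)) (fun k l a ha b hb => ?_) hA hB
  have := mul_mem_endPiece ha hb
  rw [← add_div] at this
  push_cast
  exact this

theorem one_mem_filt (X : Module.End F V) : 1 ∈ filt X 0 := by
  refine endPiece_le_filt X le_rfl ?_
  simpa using one_mem_endPiece X

theorem pow_mem_filt {X A : Module.End F V} {n : ℤ} (hA : A ∈ filt X n) (k : ℕ) :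
    A ^ k ∈ filt X (k * n) := by
  induction k with
  | zero => simpa using one_mem_filt X
  | succ k ih =>
    rw [pow_succ]
    convert mul_mem_filt ih hA using 2
    push_cast; ring

end Filtration

section Lift

variable {F R : Type*} [Field F] [CommRing R] [Algebra F R] (δ : Derivation F R R)
  (E : Type*) [Ring E] [Algebra F E]

/-- The inclusion `R ⊗ E → R((∂⁻¹)) ⊗ E`. -/
def constLift : R ⊗[F] E →ₐ[F] PseudoDiffOp δ ⊗[F] E := baseMap E (PseudoDiffOp.constHom δ)

variable {E}

@[simp] theorem constLift_tmul (r : R) (a : E) :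
    constLift δ E (r ⊗ₜ a) = PseudoDiffOp.monomial δ 0 r ⊗ₜ a := by
  rw [constLift, baseMap_tmul, PseudoDiffOp.constHom_apply]

theorem partial_mul_constLift (x : R ⊗[F] E) :
    PseudoDiffOp.monomial δ 1 1 ⊗ₜ[F] 1 * constLift δ E x =
      constLift δ E x * PseudoDiffOp.monomial δ 1 1 ⊗ₜ[F] 1 + constLift δ E (tensDer E δ x) := by
  induction x with
  | zero => simp
  | add x y hx hy => simp only [map_add, mul_add, add_mul, hx, hy]; abel
  | tmul r a =>
    simp only [constLift_tmul, tensDer_tmul, Algebra.TensorProduct.tmul_mul_tmul, one_mul, mul_one,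
      PseudoDiffOp.monomial_one_mul_monomial_zero, TensorProduct.add_tmul]

theorem constLift_mem_tens_ordLE (x : R ⊗[F] E) :
    constLift δ E x ∈ tens (PseudoDiffOp.ordLE δ 0) ⊤ := by
  induction x with
  | zero => simp
  | add x y hx hy => rw [map_add]; exact add_mem hx hy
  | tmul r a =>
    rw [constLift_tmul]
    exact tmul_mem_tens (PseudoDiffOp.monomial_mem_ordLE r) trivial

theorem firstOrder_eq {V : Type*} [AddCommGroup V] [Module F V] (M : Module.End F V) {κ : Type*}
    [Fintype κ] (a : κ → R) (N : κ → Module.End F V) :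
    firstOrder δ M a N = PseudoDiffOp.monomial δ 1 1 ⊗ₜ[F] 1 +
      constLift δ _ (1 ⊗ₜ M + ∑ i, a i ⊗ₜ N i) := by
  rw [firstOrder, map_add, map_sum, add_assoc]
  simp only [constLift_tmul]
  rfl

end Lift

section Quasidet

variable {F : Type*} [Field F]

@[simp] theorem sandwich_tmul {Ψ V V' : Type*} [Ring Ψ] [Algebra F Ψ] [AddCommGroup V] [Module F V]
    [AddCommGroup V'] [Module F V'] (J : V →ₗ[F] V') (I : V' →ₗ[F] V) (ψ : Ψ)
    (A : Module.End F V) :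
    sandwich J I (ψ ⊗ₜ A) = ψ ⊗ₜ[F] ((J ∘ₗ A ∘ₗ I : V' →ₗ[F] V') : Module.End F V') := by
  simp only [sandwich, LinearMap.lTensor_tmul]
  rfl

theorem inverse_eq_of_mul_eq_one {S : Type*} [Ring S] {a b : S} (h : a * b = 1) (h' : b * a = 1) :
    Ring.inverse a = b :=
  Ring.inverse_unit ⟨a, b, h, h'⟩

variable {V : Type*} [AddCommGroup V] [Module F V]
  {R : Type*} [CommRing R] [Algebra F R] {δ : Derivation F R R}

open PseudoDiffOp in
/-- The powers of an operator `f₀ ∂⁻¹ + Q ∂⁻¹`, with `Q` of degree larger than that of `f₀`, are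
those of `f₀ ∂⁻¹` up to terms of larger degree. -/
theorem pow_sub_mem_tens {X f₀ : Module.End F V} (hf₀ : f₀ ∈ filt X (-2))
    {x : PseudoDiffOp δ ⊗[F] Module.End F V}
    (hx : x - monomial δ (-1) 1 ⊗ₜ f₀ ∈ tens ⊤ (filt X (-1))) (k : ℕ) :
    x ^ k - monomial δ (-k) 1 ⊗ₜ (f₀ ^ k) ∈ tens ⊤ (filt X (-2 * k + 1)) := by
  have hx' : x ∈ tens ⊤ (filt X (-2)) := by
    rw [← sub_add_cancel x (monomial δ (-1) 1 ⊗ₜ f₀)]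
    exact add_mem (tens_mono le_rfl (filt_antitone X (by norm_num)) hx)
      (tmul_mem_tens trivial hf₀)
  induction k with
  | zero =>
    rw [pow_zero, pow_zero]
    simp only [Nat.cast_zero, neg_zero]
    rw [← one_eq_monomial, ← Algebra.TensorProduct.one_def, sub_self]
    exact zero_mem _
  | succ k ih =>
    have e : x ^ (k + 1) - monomial δ (-(k + 1 : ℕ)) 1 ⊗ₜ (f₀ ^ (k + 1)) =
        (x ^ k - monomial δ (-k) 1 ⊗ₜ (f₀ ^ k)) * x +
          monomial δ (-k) 1 ⊗ₜ (f₀ ^ k) * (x - monomial δ (-1) 1 ⊗ₜ f₀) := by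
      rw [sub_mul, mul_sub, Algebra.TensorProduct.tmul_mul_tmul, monomial_mul_monomial_one,
        ← pow_succ, ← pow_succ]
      push_cast
      rw [neg_add]
      abel
    rw [e]
    refine add_mem ?_ ?_
    · refine mul_mem_tens (fun _ _ _ _ => Submodule.mem_top) (fun a ha b hb => ?_) ih hx'
      exact filt_antitone X (by push_cast; omega) (mul_mem_filt ha hb)
    · refine mul_mem_tens (P := ⊤) (Q := filt X (k * (-2))) (fun _ _ _ _ => Submodule.mem_top)
        (fun a ha b hb => ?_) (tmul_mem_tens trivial (pow_mem_filt hf₀ k)) hx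
      exact filt_antitone X (by push_cast; omega) (mul_mem_filt ha hb)

/-- `J A I = 0` when the degree of `T A T` exceeds the top degree of `End V`. -/
theorem sandwich_eq_zero [CharZero F] {X T : Module.End F V} {D : ℕ} (hbot : filt X (2 * D + 1) = ⊥)
    (hT : T ∈ endPiece X (D : F)) {Ψ : Type*} [Ring Ψ] [Algebra F Ψ] {n : ℤ} (hn : -2 * D < n)
    {y : Ψ ⊗[F] Module.End F V} (hy : y ∈ tens ⊤ (filt X n)) :
    sandwich T.rangeRestrict (LinearMap.range T).subtype y = 0 := by
  have hT' : T ∈ filt X (2 * D) := by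
    refine endPiece_le_filt X le_rfl ?_
    simpa using hT
  rw [← Submodule.mem_bot F]
  refine map_mem_of_mem_tens hy _ _ fun ψ _ A hA => ?_
  rw [sandwich_tmul, Submodule.mem_bot]
  have h0 : T * A * T = 0 := by
    rw [← Submodule.mem_bot F, ← hbot]
    exact filt_antitone X (by omega) (mul_mem_filt (mul_mem_filt hT' hA) hT')
  have h1 : T.rangeRestrict ∘ₗ A ∘ₗ (LinearMap.range T).subtype = 0 := by
    ext ⟨_, v, rfl⟩
    exact LinearMap.congr_fun h0 v
  rw [h1]
  exact TensorProduct.tmul_zero _ ψ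

variable [FiniteDimensional F V]

/-- `J f₀ᴰ I` is invertible, by the condition `V = ker T ⊕ f₀ᴰ(im T)`. -/
theorem isUnit_comp {T f₀ : Module.End F V} {D : ℕ}
    (hc : IsCompl (LinearMap.ker T) ((LinearMap.range T).map (f₀ ^ D))) :
    IsUnit ((T.rangeRestrict ∘ₗ ((-f₀) ^ D) ∘ₗ (LinearMap.range T).subtype :
      LinearMap.range T →ₗ[F] LinearMap.range T) : Module.End F (LinearMap.range T)) := by
  rw [Module.End.isUnit_iff]
  refine (fun h => ⟨LinearMap.injective_iff_surjective.2 h, h⟩) ?_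
  rintro ⟨_, v, rfl⟩
  have hv : v ∈ LinearMap.ker T ⊔ (LinearMap.range T).map (f₀ ^ D) := hc.sup_eq_top ▸ trivial
  obtain ⟨k, hk, _, ⟨t, ht, rfl⟩, rfl⟩ := Submodule.mem_sup.1 hv
  refine ⟨(-1 : F) ^ D • ⟨t, ht⟩, Subtype.ext ?_⟩
  have e : (-f₀) ^ D = (-1 : F) ^ D • f₀ ^ D := by
    rw [← neg_one_smul F f₀, smul_pow]
  rw [e]
  simp only [LinearMap.coe_comp, Submodule.coe_subtype, Function.comp_apply, map_smul,
    LinearMap.smul_apply, smul_smul, ← mul_pow, neg_mul_neg, one_mul, one_pow, one_smul,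
    LinearMap.codRestrict_apply, map_add, LinearMap.mem_ker.1 hk, zero_add]

open PseudoDiffOp in
/-- The quasideterminant of `∂ + f₀ + Q` exists, for `f₀` of degree `-1` and `Q` of degree at least
`-1/2`: by degree reasons, the leading term of `J (∂ + f₀ + Q)⁻¹ I` is `∂^(-D-1) J (-f₀)ᴰ I`. -/
theorem quasidetExists [CharZero F] {X f₀ T : Module.End F V} {D : ℕ}
    (hbot : filt X (2 * D + 1) = ⊥)
    (hf₀ : f₀ ∈ filt X (-2)) (hT : T ∈ endPiece X (D : F))
    (hc : IsCompl (LinearMap.ker T) ((LinearMap.range T).map (f₀ ^ D)))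
    {Q : R ⊗[F] Module.End F V} (hQ : Q ∈ tens ⊤ (filt X (-1))) :
    QuasidetExists T.rangeRestrict (LinearMap.range T).subtype
      (monomial δ 1 1 ⊗ₜ[F] 1 + constLift δ _ (1 ⊗ₜ f₀ + Q)) := by
  set J := T.rangeRestrict
  set I := (LinearMap.range T).subtype
  set d : PseudoDiffOp δ ⊗[F] Module.End F V := monomial δ 1 1 ⊗ₜ[F] 1
  set d' : PseudoDiffOp δ ⊗[F] Module.End F V := monomial δ (-1) 1 ⊗ₜ[F] 1
  have hdd' : d * d' = 1 := by
    simp only [d, d', Algebra.TensorProduct.tmul_mul_tmul, monomial_mul_monomial_one, mul_one]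
    rfl
  have hd'd : d' * d = 1 := by
    simp only [d, d', Algebra.TensorProduct.tmul_mul_tmul, monomial_mul_monomial_one, mul_one]
    rfl
  have hd' : d' ∈ tens (ordLE δ (-1)) ⊤ := tmul_mem_tens (monomial_mem_ordLE 1) trivial
  have hd'0 : d' ∈ tens ⊤ (filt X 0) := tmul_mem_tens trivial (one_mem_filt X)
  set Z := constLift δ (Module.End F V) (1 ⊗ₜ f₀ + Q)
  -- `d + Z = (1 - N) d`, so that the inverse of `d + Z` is `d'` times a geometric series in `N`
  set N := -(Z * d')
  have hN : N ∈ tens (ordLE δ (-1)) ⊤ := by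
    have := mul_mem_tens_ordLE (constLift_mem_tens_ordLE δ (1 ⊗ₜ f₀ + Q)) hd'
    rw [zero_add] at this
    exact neg_mem this
  have hN1 : N - monomial δ (-1) 1 ⊗ₜ (-f₀) ∈ tens ⊤ (filt X (-1)) := by
    have e : N - monomial δ (-1) 1 ⊗ₜ (-f₀) = -(constLift δ _ Q * d') := by
      simp only [N, Z, d', map_add, constLift_tmul, add_mul, TensorProduct.tmul_neg,
        Algebra.TensorProduct.tmul_mul_tmul, monomial_mul_monomial_one, mul_one, zero_add]
      abel
    rw [e]
    refine neg_mem (mul_mem_tens (fun _ _ _ _ => Submodule.mem_top) (fun a ha b hb => ?_)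
      (baseMap_mem_tens_top _ hQ) hd'0)
    simpa using mul_mem_filt ha hb
  obtain ⟨s, hs1, hs2, hs⟩ := exists_inverse_one_sub hN
  have hA : d + Z = (1 - N) * d := by
    rw [sub_neg_eq_add, add_mul, one_mul, mul_assoc, hd'd, mul_one]
  have h1 : (d + Z) * (d' * s) = 1 := by
    rw [hA, mul_assoc, ← mul_assoc d, hdd', one_mul, hs2]
  have h2 : (d' * s) * (d + Z) = 1 := by
    rw [hA, mul_assoc, ← mul_assoc s, hs1, one_mul, hd'd]
  refine ⟨isUnit_iff_exists.2 ⟨_, h1, h2⟩, ?_⟩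
  rw [inverse_eq_of_mul_eq_one h1 h2]
  -- the terms `d' * N ^ k` with `k < D` do not contribute
  have hlow : ∀ k ∈ Finset.range D, sandwich J I (d' * N ^ k) = 0 := by
    intro k hk
    rw [Finset.mem_range] at hk
    refine sandwich_eq_zero hbot hT (n := -2 * k) (by omega) ?_
    have hNk : N ^ k ∈ tens ⊤ (filt X (-2 * k)) := by
      rw [← sub_add_cancel (N ^ k) (monomial δ (-k) 1 ⊗ₜ ((-f₀) ^ k))]
      refine add_mem (tens_mono le_rfl (filt_antitone X (by omega))
        (pow_sub_mem_tens (neg_mem hf₀) hN1 k)) (tmul_mem_tens trivial ?_)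
      convert pow_mem_filt (neg_mem hf₀) k using 2
      ring
    refine mul_mem_tens (fun _ _ _ _ => Submodule.mem_top) (fun a ha b hb => ?_) hd'0 hNk
    simpa using mul_mem_filt ha hb
  set C : Module.End F (LinearMap.range T) := J ∘ₗ ((-f₀) ^ D) ∘ₗ I
  have htop : sandwich J I (d' * N ^ D) = monomial δ (-D - 1) 1 ⊗ₜ C := by
    have e : d' * N ^ D = d' * (N ^ D - monomial δ (-D) 1 ⊗ₜ ((-f₀) ^ D)) +
        monomial δ (-D - 1) 1 ⊗ₜ ((-f₀) ^ D) := by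
      simp only [mul_sub, d', Algebra.TensorProduct.tmul_mul_tmul, monomial_mul_monomial_one,
        one_mul]
      rw [show (-1 : ℤ) + -D = -D - 1 by ring]
      abel
    rw [e, map_add, sandwich_tmul, sandwich_eq_zero hbot hT (n := -2 * D + 1) (by omega), zero_add]
    refine mul_mem_tens (fun _ _ _ _ => Submodule.mem_top) (fun a ha b hb => ?_) hd'0
      (pow_sub_mem_tens (neg_mem hf₀) hN1 D)
    simpa using mul_mem_filt ha hb
  have hrest : sandwich J I (d' * s) - monomial δ (-D - 1) 1 ⊗ₜ C ∈ tens (ordLE δ (-D - 2)) ⊤ := by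
    have e : sandwich J I (d' * s) - monomial δ (-D - 1) 1 ⊗ₜ C =
        sandwich J I (d' * (s - ∑ k ∈ Finset.range (D + 1), N ^ k)) := by
      rw [mul_sub, map_sub, Finset.mul_sum, map_sum, Finset.sum_range_succ,
        Finset.sum_eq_zero hlow, zero_add, htop]
    rw [e]
    have hm := mul_mem_tens_ordLE hd' (hs (D + 1))
    refine map_mem_of_mem_tens hm _ _ fun ψ hψ A _ => ?_
    rw [sandwich_tmul]
    exact tmul_mem_tens (ordLE_mono (by push_cast; omega) hψ) trivial
  -- an operator with invertible leading coefficient is invertible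
  have hC : IsUnit C := isUnit_comp hc
  obtain ⟨C', hC1, hC2⟩ := isUnit_iff_exists.1 hC
  have hu : IsUnit (monomial δ (-D - 1) 1 ⊗ₜ[F] C) := by
    refine isUnit_iff_exists.2 ⟨monomial δ (D + 1) 1 ⊗ₜ C', ?_, ?_⟩ <;>
    · simp only [Algebra.TensorProduct.tmul_mul_tmul, monomial_mul_monomial_one, hC1, hC2]
      ring_nf
      rfl
  have hfac : sandwich J I (d' * s) = monomial δ (-D - 1) 1 ⊗ₜ[F] C * (1 -
      -(monomial δ (D + 1) 1 ⊗ₜ C' * (sandwich J I (d' * s) - monomial δ (-D - 1) 1 ⊗ₜ C))) := by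
    rw [sub_neg_eq_add, mul_add, mul_one, ← mul_assoc, Algebra.TensorProduct.tmul_mul_tmul,
      monomial_mul_monomial_one, hC1, show (-D - 1 + (D + 1) : ℤ) = 0 by ring, ← one_eq_monomial,
      ← Algebra.TensorProduct.one_def, one_mul]
    abel
  rw [hfac]
  refine hu.mul (isUnit_one_sub (neg_mem ?_))
  have h3 : monomial δ (D + 1) 1 ⊗ₜ[F] C' ∈ tens (ordLE δ (D + 1)) ⊤ :=
    tmul_mem_tens (monomial_mem_ordLE 1) trivial
  convert mul_mem_tens_ordLE h3 hrest using 2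
  ring_nf

end Quasidet

/-! ### Gauge transformations -/

section Exp

variable {F S : Type*} [Field F] [Ring S] [Algebra F S]

/-- The inner derivation `a ↦ y a - a y`. -/
def innerDer (F : Type*) {S : Type*} [Field F] [Ring S] [Algebra F S] (y : S) : Module.End F S :=
  LinearMap.mulLeft F y - LinearMap.mulRight F y

theorem innerDer_apply (y a : S) : innerDer F y a = y * a - a * y := rfl

variable (F) in
/-- Conjugation by the exponential of a nilpotent element is the exponential of the inner
derivation, of which the terms up to first order are singled out; `1 + E₀` and `1 + E₁` are the
exponentials of `y` and `-y`. -/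
theorem exists_exp_conj [CharZero F] {y : S} (hy : IsNilpotent y) (a : S) :
    ∃ E₀ ∈ Submodule.span F (Set.range fun k : ℕ => y ^ (k + 1)),
    ∃ E₁ ∈ Submodule.span F (Set.range fun k : ℕ => y ^ (k + 1)),
    ∃ z ∈ Submodule.span F (Set.range fun k : ℕ => (innerDer F y ^ (k + 2)) a),
      (1 + E₀) * (1 + E₁) = 1 ∧ (1 + E₁) * (1 + E₀) = 1 ∧
      (1 + E₀) * a = (a + innerDer F y a + z) * (1 + E₀) := by
  let : Module ℚ S := Module.compHom S (algebraMap ℚ F)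
  have hsmul : ∀ (q : ℚ) (s : S), q • s = (q : F) • s := fun q s => rfl
  have hexp : ∀ y : S, IsNilpotent y → ∃ E₀ ∈ Submodule.span F
      (Set.range fun k : ℕ => y ^ (k + 1)), IsNilpotent.exp y = 1 + E₀ := by
    rintro y ⟨n, hn⟩
    rw [IsNilpotent.exp_eq_sum (k := n + 1) (by rw [pow_succ, hn, zero_mul]),
      Finset.sum_range_succ']
    refine ⟨_, ?_, by simpa using add_comm _ _⟩
    refine Submodule.sum_mem _ fun k _ => ?_
    rw [hsmul]
    exact Submodule.smul_mem _ _ (Submodule.subset_span ⟨k, rfl⟩)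
  obtain ⟨E₀, hE₀, h0⟩ := hexp y hy
  obtain ⟨E₁, hE₁, h1⟩ := hexp (-y) hy.neg
  have hE₁' : E₁ ∈ Submodule.span F (Set.range fun k : ℕ => y ^ (k + 1)) := by
    refine Submodule.span_le.2 ?_ hE₁
    rintro _ ⟨k, rfl⟩
    have e : (-y) ^ (k + 1) = (-1 : F) ^ (k + 1) • y ^ (k + 1) := by
      rw [← smul_pow, neg_one_smul]
    dsimp only
    rw [e]
    exact Submodule.smul_mem _ _ (Submodule.subset_span ⟨k, rfl⟩)
  have hL : IsNilpotent (LinearMap.mulLeft F y) := by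
    obtain ⟨n, hn⟩ := hy
    exact ⟨n, by rw [LinearMap.pow_mulLeft, hn, LinearMap.mulLeft_zero_eq_zero]⟩
  have hR : IsNilpotent (LinearMap.mulRight F y) := by
    obtain ⟨n, hn⟩ := hy
    exact ⟨n, by rw [LinearMap.pow_mulRight, hn, LinearMap.mulRight_zero_eq_zero]⟩
  have hcomm : Commute (LinearMap.mulLeft F y) (LinearMap.mulRight F y) :=
    LinearMap.commute_mulLeft_right y y
  have hI : IsNilpotent (innerDer F y) := hcomm.isNilpotent_sub hL hR
  have hcomm' : Commute (LinearMap.mulRight F y) (innerDer F y) :=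
    hcomm.symm.sub_right (Commute.refl _)
  have hsum : LinearMap.mulLeft F y = LinearMap.mulRight F y + innerDer F y := by
    rw [innerDer]; abel
  have hexpL : IsNilpotent.exp (LinearMap.mulLeft F y) a = IsNilpotent.exp y * a := by
    obtain ⟨n, hn⟩ := hy
    rw [IsNilpotent.exp_eq_sum hn, IsNilpotent.exp_eq_sum (k := n)
      (by rw [LinearMap.pow_mulLeft, hn, LinearMap.mulLeft_zero_eq_zero])]
    simp only [LinearMap.pow_mulLeft, LinearMap.sum_apply, Finset.sum_mul]
    refine Finset.sum_congr rfl fun k _ => ?_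
    rw [hsmul, smul_mul_assoc]
    rfl
  have hexpR : ∀ c, IsNilpotent.exp (LinearMap.mulRight F y) c = c * IsNilpotent.exp y := by
    intro c
    obtain ⟨n, hn⟩ := hy
    rw [IsNilpotent.exp_eq_sum hn, IsNilpotent.exp_eq_sum (k := n)
      (by rw [LinearMap.pow_mulRight, hn, LinearMap.mulRight_zero_eq_zero])]
    simp only [LinearMap.pow_mulRight, LinearMap.sum_apply, Finset.mul_sum]
    refine Finset.sum_congr rfl fun k _ => ?_
    rw [hsmul, mul_smul_comm]
    rfl
  have hexpI : ∃ z ∈ Submodule.span F (Set.range fun k : ℕ => (innerDer F y ^ (k + 2)) a),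
      IsNilpotent.exp (innerDer F y) a = a + innerDer F y a + z := by
    obtain ⟨n, hn⟩ := hI
    rw [IsNilpotent.exp_eq_sum (k := n + 2) (by rw [pow_add, hn, zero_mul]),
      Finset.sum_range_succ', Finset.sum_range_succ']
    refine ⟨(∑ k ∈ Finset.range n, ((k + 1 + 1).factorial : ℚ)⁻¹ • innerDer F y ^ (k + 1 + 1)) a,
      ?_, ?_⟩
    · rw [LinearMap.sum_apply]
      refine Submodule.sum_mem _ fun k _ => ?_
      change (((k + 1 + 1).factorial : ℚ)⁻¹ : ℚ) • (innerDer F y ^ (k + 2)) a ∈ _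
      rw [hsmul]
      exact Submodule.smul_mem _ _ (Submodule.subset_span ⟨k, rfl⟩)
    · simp [LinearMap.add_apply]
      abel
  obtain ⟨z, hz, hz'⟩ := hexpI
  refine ⟨E₀, hE₀, E₁, hE₁', z, hz, ?_, ?_, ?_⟩
  · rw [← h0, ← h1, IsNilpotent.exp_mul_exp_neg_self hy]
  · rw [← h0, ← h1, IsNilpotent.exp_neg_mul_exp_self hy]
  · rw [← h0, ← hexpL, hsum, IsNilpotent.exp_add_of_commute hcomm' hR hI, Module.End.mul_apply,
      hexpR, hz']

/-- The relation `N (∂ + L) = (∂ + L') N`: the gauge transformation by `N` sends `∂ + L` to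
`∂ + L'`. -/
def IsGauge (d : S →ₗ[F] S) (N L L' : S) : Prop := N * L - L' * N = d N

theorem IsGauge.comp {d : S →ₗ[F] S} (hd : ∀ a b, d (a * b) = a * d b + d a * b)
    {N₁ N₂ L L₁ L₂ : S} (h₁ : IsGauge d N₁ L L₁) (h₂ : IsGauge d N₂ L₁ L₂) :
    IsGauge d (N₂ * N₁) L L₂ := by
  unfold IsGauge at *
  rw [hd, ← h₁, ← h₂]
  noncomm_ring

theorem IsGauge.inv {d : S →ₗ[F] S} (hd : ∀ a b, d (a * b) = a * d b + d a * b) (hd1 : d 1 = 0)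
    {N N' L L' : S} (h : IsGauge d N L L') (h₁ : N * N' = 1) (h₂ : N' * N = 1) :
    IsGauge d N' L' L := by
  unfold IsGauge at *
  have h3 : N' * d N * N' + d N' = 0 := by
    have := hd N' N
    rw [h₂, hd1] at this
    have h4 := congrArg (· * N') this
    simp only [zero_mul, add_mul, mul_assoc, h₁, mul_one] at h4
    rw [mul_assoc, ← h4]
  calc N' * L' - L * N' = -(N' * (N * L - L' * N) * N') := by
        have e1 : N' * (N * L) * N' = L * N' := by rw [← mul_assoc, h₂, one_mul]
        have e2 : N' * (L' * N) * N' = N' * L' := by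
          rw [mul_assoc N', mul_assoc L', h₁, mul_one]
        rw [mul_sub, sub_mul, e1, e2]
        abel
    _ = d N' := by rw [h, neg_eq_iff_eq_neg, ← sub_eq_zero, sub_neg_eq_add, h3]

/-- The gauge transformation by the exponential of a nilpotent element. -/
theorem exists_exp_gauge [CharZero F] {d : S →ₗ[F] S} (hd : ∀ a b, d (a * b) = a * d b + d a * b)
    (hd1 : d 1 = 0) {n : S} (hn : IsNilpotent n) (L : S) :
    ∃ E₀ ∈ Submodule.span F (Set.range fun k : ℕ => n ^ (k + 1)),
    ∃ E₁ ∈ Submodule.span F (Set.range fun k : ℕ => n ^ (k + 1)),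
    ∃ z ∈ Submodule.span F (Set.range fun k : ℕ => (innerDer F n ^ (k + 1)) (innerDer F n L - d n)),
      (1 + E₀) * (1 + E₁) = 1 ∧ (1 + E₁) * (1 + E₀) = 1 ∧
      IsGauge d (1 + E₀) L (L + (innerDer F n L - d n) + z) := by
  -- `d + L` is an operator on `S`, and the inner derivation by `n` sends it to `[n, L] - d n`
  let ℓ : S →ₐ[F] Module.End F S := Algebra.lmul F S
  have hℓ : ∀ a c, ℓ a c = a * c := fun _ _ => rfl
  have hinj : Function.Injective ℓ := fun a c h => by
    simpa [hℓ] using LinearMap.congr_fun h 1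
  have h1 : innerDer F (ℓ n) (d + ℓ L) = ℓ (innerDer F n L - d n) := by
    ext c
    simp only [innerDer_apply, LinearMap.sub_apply, Module.End.mul_apply, LinearMap.add_apply, hℓ,
      hd, sub_mul, mul_add, add_mul, mul_assoc]
    abel
  have h2 : ∀ (k : ℕ) a, (innerDer F (ℓ n) ^ k) (ℓ a) = ℓ ((innerDer F n ^ k) a) := by
    intro k a
    induction k with
    | zero => rfl
    | succ k ih =>
      rw [pow_succ', Module.End.mul_apply, ih, pow_succ', Module.End.mul_apply, innerDer_apply,
        innerDer_apply, map_sub, map_mul, map_mul]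
  have hspan : ∀ (v : ℕ → S) (E : Module.End F S),
      E ∈ Submodule.span F (Set.range fun k => ℓ (v k)) →
      ∃ a ∈ Submodule.span F (Set.range v), ℓ a = E := by
    intro v E hE
    have : Set.range (fun k => ℓ (v k)) = ℓ.toLinearMap '' Set.range v := by
      rw [← Set.range_comp]; rfl
    rw [this, ← Submodule.map_span] at hE
    exact hE
  obtain ⟨E₀, hE₀, E₁, hE₁, z, hz, h01, h10, hE⟩ :=
    exists_exp_conj F (hn.map ℓ) (d + ℓ L)
  simp only [← map_pow] at hE₀ hE₁
  simp only [pow_succ (innerDer F (ℓ n)) (_ + 1), Module.End.mul_apply, h1, h2] at hz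
  obtain ⟨e₀, he₀, rfl⟩ := hspan _ _ hE₀
  obtain ⟨e₁, he₁, rfl⟩ := hspan _ _ hE₁
  obtain ⟨w, hw, rfl⟩ := hspan _ _ hz
  refine ⟨e₀, he₀, e₁, he₁, w, hw, hinj ?_, hinj ?_, ?_⟩
  · simpa using h01
  · simpa using h10
  · have h3 := LinearMap.congr_fun hE 1
    rw [h1] at h3
    simp only [Module.End.mul_apply, LinearMap.add_apply, Module.End.one_apply, hℓ, hd1, zero_add,
      mul_one, map_add] at h3
    unfold IsGauge
    rw [map_add, hd1, zero_add, sub_eq_iff_eq_add]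
    rw [add_mul, one_mul, h3]
    simp only [mul_add, add_mul, mul_one]
    abel

end Exp

/-! ### Bases adapted to the grading and to the centralizer -/

section Adapted

variable {F g V ι : Type*} [Field F] [LieRing g] [LieAlgebra F g]
  [AddCommGroup V] [Module F V] [LieRingModule g V] [LieModule F g V]

variable (V) in
/-- A basis `b` of `g` consisting of `ad x`-eigenvectors, where `deg i` is twice the eigenvalue of
`b i`, which contains the basis `b i`, `i ∈ If`, of the centralizer of `f`; here `(f, 2x, e)` is an
`sl₂`-triple, and the trace form of `V` is non-degenerate. -/
structure IsAdapted (f x e : g) (b : Module.Basis ι F g) (deg : ι → ℤ) (If : Finset ι) : Prop where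
  triple : IsTriple f x e
  nondeg : (LieModule.traceForm F g V).Nondegenerate
  mem_piece : ∀ i, b i ∈ piece F x (deg i)
  span_eq : Submodule.span F (b '' If) = LinearMap.ker (LieAlgebra.ad F g f)

namespace IsAdapted

variable {f x e : g} {b : Module.Basis ι F g} {deg : ι → ℤ} {If : Finset ι}

theorem lie_eq_zero (h : IsAdapted V f x e b deg If) {i : ι} (hi : i ∈ If) : ⁅f, b i⁆ = 0 := by
  have : b i ∈ LinearMap.ker (LieAlgebra.ad F g f) :=
    h.span_eq ▸ Submodule.subset_span (Set.mem_image_of_mem b hi)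
  exact this

theorem traceForm_eq_zero [CharZero F] {a c : g} {m n : ℤ} (ha : a ∈ piece F x m)
    (hc : c ∈ piece F x n)
    (hmn : m + n ≠ 0) : LieModule.traceForm F g V a c = 0 := by
  rw [LieModule.traceForm_apply_apply]
  refine trace_eq_zero_of_mem_endPiece (k := ((m + n : ℤ) : F) / 2) ?_
    (?_ : LieModule.toEnd F g V a * LieModule.toEnd F g V c ∈
      endPiece (LieModule.toEnd F g V x) _)
  · have : ((m + n : ℤ) : F) ≠ 0 := by exact_mod_cast hmn
    simpa using this
  · have := mul_mem_endPiece (toEnd_mem_endPiece (V := V) ha) (toEnd_mem_endPiece (V := V) hc)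
    rwa [← add_div, ← Int.cast_add] at this

/-- An element of degree at least `n / 2` only involves dual basis vectors of degree at least
`n / 2`. -/
theorem traceForm_eq_zero_of_mem_above [CharZero F] (h : IsAdapted V f x e b deg If) {a : g} {n : ℤ}
    (ha : a ∈ above (piece F x) n) {i : ι} (hi : -n < deg i) :
    LieModule.traceForm F g V a (b i) = 0 := by
  have h1 : above (piece F x) n ≤ LinearMap.ker ((LieModule.traceForm F g V).flip (b i)) :=
    above_le.2 fun m hm c hc => traceForm_eq_zero hc (h.mem_piece i) (by omega)
  exact h1 ha

theorem deg_nonpos [CharZero F] [FiniteDimensional F V]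
    [LieModule.IsFaithful F g V] (h : IsAdapted V f x e b deg If) {i : ι} (hi : i ∈ If) :
    deg i ≤ 0 := by
  by_contra! hpos
  have h0 : LieModule.toEnd F g V (b i) = 0 := by
    refine eq_zero_of_commute_of_mem_endPiece h.triple hpos
      (toEnd_mem_endPiece (h.mem_piece i)) ?_
    rw [← sub_eq_zero, ← toEnd_lie, h.lie_eq_zero hi, map_zero]
  refine b.ne_zero i (LieModule.IsFaithful.injective_toEnd (R := F) (L := g) (M := V) ?_)
  rw [h0, map_zero]

variable [Fintype ι]

open Classical in
/-- The dual basis with respect to the trace form. -/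
def dual (h : IsAdapted V f x e b deg If) : Module.Basis ι F g :=
  (LieModule.traceForm F g V).dualBasis h.nondeg b

theorem dual_eq [d : DecidableEq ι] (h : IsAdapted V f x e b deg If) :
    h.dual = (LieModule.traceForm F g V).dualBasis h.nondeg b := by
  rw [Subsingleton.elim d (Classical.decEq ι)]
  rfl

theorem dual_repr (h : IsAdapted V f x e b deg If) (a : g) (i : ι) :
    h.dual.repr a i = LieModule.traceForm F g V a (b i) := by
  classical
  rw [dual_eq, LinearMap.BilinForm.dualBasis_repr_apply]

theorem traceForm_dual [DecidableEq ι] (h : IsAdapted V f x e b deg If) (i j : ι) :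
    LieModule.traceForm F g V (h.dual i) (b j) = if j = i then 1 else 0 := by
  rw [dual_eq, LinearMap.BilinForm.apply_dualBasis_left]

theorem traceForm_dual_left (h : IsAdapted V f x e b deg If) (i : ι) (a : g) :
    LieModule.traceForm F g V (h.dual i) a = b.repr a i := by
  classical
  conv_lhs => rw [← b.sum_repr a]
  simp only [map_sum, map_smul, h.traceForm_dual]
  simp

theorem sum_dual (h : IsAdapted V f x e b deg If) (a : g) :
    ∑ i, LieModule.traceForm F g V a (b i) • h.dual i = a := by
  simp only [← h.dual_repr]
  exact h.dual.sum_repr a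

theorem ext_traceForm (h : IsAdapted V f x e b deg If) {a c : g}
    (hac : ∀ i, LieModule.traceForm F g V a (b i) = LieModule.traceForm F g V c (b i)) : a = c := by
  rw [← h.sum_dual a, ← h.sum_dual c]
  simp only [hac]

/-- The endomorphism `Uⁱ` by which the dual basis vector acts. -/
def U (h : IsAdapted V f x e b deg If) (i : ι) : Module.End F V :=
  LieModule.toEnd F g V (h.dual i)

theorem toEnd_eq_sum (h : IsAdapted V f x e b deg If) (a : g) :
    LieModule.toEnd F g V a = ∑ i, LieModule.traceForm F g V a (b i) • h.U i := by
  conv_lhs => rw [← h.sum_dual a]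
  rw [map_sum]
  simp only [map_smul]
  rfl

theorem linearIndependent_U [LieModule.IsFaithful F g V] (h : IsAdapted V f x e b deg If) :
    LinearIndependent F h.U :=
  h.dual.linearIndependent.map' (LieModule.toEnd F g V : g →ₗ[F] Module.End F V)
    (LinearMap.ker_eq_bot.2 (LieModule.IsFaithful.injective_toEnd (R := F) (L := g) (M := V)))

/-- By invariance of the trace form, the image of `ad f` is the orthogonal complement of `g^f`. -/
theorem dual_mem_range (h : IsAdapted V f x e b deg If) {i : ι} (hi : i ∉ If) :
    h.dual i ∈ LinearMap.range (LieAlgebra.ad F g f) := by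
  classical
  have : FiniteDimensional F g := b.finiteDimensional_of_finite
  have hrefl : (LieModule.traceForm F g V).IsRefl := (LieModule.traceForm_isSymm F g V).isRefl
  rw [← LinearMap.BilinForm.orthogonal_orthogonal h.nondeg hrefl
    (LinearMap.range (LieAlgebra.ad F g f))]
  rw [LinearMap.BilinForm.mem_orthogonal_iff]
  intro z hz
  have hz' : z ∈ LinearMap.ker (LieAlgebra.ad F g f) := by
    rw [LinearMap.mem_ker, LieAlgebra.ad_apply]
    refine h.ext_traceForm fun j => ?_
    rw [map_zero, LinearMap.zero_apply, LieModule.traceForm_apply_lie_apply', neg_eq_zero]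
    exact hrefl _ _ (LinearMap.BilinForm.mem_orthogonal_iff.1 hz _ ⟨b j, rfl⟩)
  rw [← h.span_eq] at hz'
  have hle : Submodule.span F (b '' If) ≤
      LinearMap.ker ((LieModule.traceForm F g V).flip (h.dual i)) := by
    rw [Submodule.span_le]
    rintro _ ⟨j, hj, rfl⟩
    change LieModule.traceForm F g V (b j) (h.dual i) = 0
    rw [LieModule.traceForm_comm, h.traceForm_dual, if_neg]
    rintro rfl
    exact hi hj
  exact hle hz'

variable [CharZero F]

theorem dual_mem (h : IsAdapted V f x e b deg If) (i : ι) : h.dual i ∈ piece F x (-deg i) := by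
  classical
  rw [ClassicalW.mem_piece]
  refine h.ext_traceForm fun j => ?_
  rw [LieModule.traceForm_apply_lie_apply', ClassicalW.mem_piece.1 (h.mem_piece j), map_smul,
    map_smul, LinearMap.smul_apply, h.traceForm_dual]
  split_ifs with hij
  · subst hij
    push_cast
    simp only [smul_eq_mul]
    ring
  · simp

theorem U_mem (h : IsAdapted V f x e b deg If) (i : ι) :
    h.U i ∈ filt (LieModule.toEnd F g V x) (-deg i) :=
  endPiece_le_filt _ le_rfl (toEnd_mem_endPiece (h.dual_mem i))

theorem exists_eq_deg (h : IsAdapted V f x e b deg If) {n : ℤ} {a : g} (ha : a ∈ piece F x n)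
    (ha0 : a ≠ 0) : ∃ i, deg i = -n := by
  by_contra! hne
  apply ha0
  refine h.ext_traceForm fun i => ?_
  rw [map_zero, LinearMap.zero_apply]
  refine traceForm_eq_zero ha (h.mem_piece i) fun h0 => hne i (by omega)

/-- Outside the centralizer, the dual basis vectors are `ad f`-images of eigenvectors. -/
theorem exists_lift (h : IsAdapted V f x e b deg If) {i : ι} (hi : i ∉ If) :
    ∃ a ∈ piece F x (2 - deg i), ⁅f, a⁆ = h.dual i := by
  classical
  obtain ⟨a, ha⟩ := h.dual_mem_range hi
  rw [LieAlgebra.ad_apply] at ha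
  refine ⟨∑ k with deg k = 2 - deg i, b.repr a k • b k, Submodule.sum_mem _ fun k hk => ?_, ?_⟩
  · rw [← (Finset.mem_filter.1 hk).2]
    exact Submodule.smul_mem _ _ (h.mem_piece k)
  · refine h.ext_traceForm fun j => ?_
    have hfb : ∀ k, ⁅f, b k⁆ ∈ piece F x (-2 + deg k) := fun k =>
      lie_mem_piece h.triple.f_mem (h.mem_piece k)
    have ha' : ⁅f, a⁆ = ∑ k, b.repr a k • ⁅f, b k⁆ := by
      conv_lhs => rw [← b.sum_repr a]
      rw [lie_sum]
      simp only [lie_smul]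
    by_cases hj : deg j = deg i
    · rw [← ha, ha', lie_sum]
      simp only [lie_smul, map_sum, map_smul, LinearMap.sum_apply, LinearMap.smul_apply]
      refine Finset.sum_subset (Finset.filter_subset _ _) fun k _ hk => ?_
      rw [traceForm_eq_zero (hfb k) (h.mem_piece j), smul_zero]
      intro h0
      apply hk
      rw [Finset.mem_filter]
      exact ⟨Finset.mem_univ _, by omega⟩
    · rw [traceForm_eq_zero (h.dual_mem i) (h.mem_piece j) (by omega), lie_sum, map_sum,
        LinearMap.sum_apply]
      refine Finset.sum_eq_zero fun k hk => ?_
      rw [lie_smul, map_smul, LinearMap.smul_apply, traceForm_eq_zero (hfb k) (h.mem_piece j),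
        smul_zero]
      have := (Finset.mem_filter.1 hk).2
      omega

variable [FiniteDimensional F V]

/-- The span of the `Uⁱ`, `i ∈ If`, meets the image of `ad φ(f)` trivially, and `ad φ(f)` is
injective in positive degrees. Hence `n` has no component of degree `j / 2 > 0`, if the commutator of
`n` with `φ(f)` has none of degree `j / 2 - 1` modulo the `Uⁱ`. -/
theorem mem_filt_succ (h : IsAdapted V f x e b deg If) {j : ℤ} (hj : 1 ≤ j) (c : If → F)
    {n : Module.End F V} (hn : n ∈ filt (LieModule.toEnd F g V x) j)
    (hc : ∑ i, c i • h.U i + (n * LieModule.toEnd F g V f - LieModule.toEnd F g V f * n) ∈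
      filt (LieModule.toEnd F g V x) (j - 1)) :
    n ∈ filt (LieModule.toEnd F g V x) (j + 1) := by
  classical
  set φ := LieModule.toEnd F g V
  obtain ⟨n₀, hn₀, n₁, hn₁, rfl⟩ := exists_add_of_mem_above hn
  change n₁ ∈ filt (φ x) (j + 1) at hn₁
  have hf : φ f ∈ endPiece (φ x) (((-2 : ℤ) : F) / 2) := toEnd_mem_endPiece h.triple.f_mem
  have hf' : φ f ∈ filt (φ x) (-2) := endPiece_le_filt _ le_rfl hf
  have hn₀f : n₀ * φ f - φ f * n₀ ∈ endPiece (φ x) (((j - 2 : ℤ) : F) / 2) := by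
    have e1 := mul_mem_endPiece hn₀ hf
    have e2 := mul_mem_endPiece hf hn₀
    rw [← add_div, ← Int.cast_add] at e1 e2
    rw [add_comm] at e2
    exact sub_mem e1 e2
  have hn₁f : n₁ * φ f - φ f * n₁ ∈ filt (φ x) (j - 1) :=
    sub_mem (filt_antitone _ (by omega) (mul_mem_filt hn₁ hf'))
      (filt_antitone _ (by omega) (mul_mem_filt hf' hn₁))
  have hc' : ∑ i, c i • h.U i + (n₀ * φ f - φ f * n₀) ∈ filt (φ x) (j - 1) := by
    have := sub_mem hc hn₁f
    convert this using 1
    noncomm_ring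
  -- pairing with the centralizer of `f` determines the coefficients of low degree
  have htr : ∀ i : If, 1 - j < deg i → c i = 0 := by
    intro i hi
    have h1 : ∀ A ∈ filt (φ x) (j - 1), LinearMap.trace F V (A * φ (b i)) = 0 := by
      intro A hA
      have hle : filt (φ x) (j - 1) ≤
          LinearMap.ker (LinearMap.trace F V ∘ₗ LinearMap.mulRight F (φ (b i))) := by
        refine above_le.2 fun m hm A hA => ?_
        have h2 := mul_mem_endPiece hA (toEnd_mem_endPiece (V := V) (h.mem_piece i))
        rw [← add_div, ← Int.cast_add] at h2
        refine trace_eq_zero_of_mem_endPiece ?_ h2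
        have : ((m + deg i : ℤ) : F) ≠ 0 := by
          have : m + deg i ≠ 0 := by omega
          exact_mod_cast this
        simpa using this
      exact hle hA
    have h3 := h1 _ hc'
    have h4 : φ f * φ (b i) = φ (b i) * φ f := by
      rw [← sub_eq_zero, ← toEnd_lie, h.lie_eq_zero i.2, map_zero]
    rw [add_mul, map_add, sub_mul, map_sub, mul_assoc n₀, h4, ← mul_assoc n₀,
      LinearMap.trace_mul_comm F (n₀ * _), ← mul_assoc, LinearMap.trace_mul_comm F (φ f * n₀),
      ← mul_assoc, ← h4, sub_self, add_zero, Finset.sum_mul, map_sum] at h3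
    rw [Finset.sum_eq_single i] at h3
    · have h5 : LinearMap.trace F V (h.U i * φ (b i)) = 1 := by
        have := h.traceForm_dual i i
        rw [if_pos rfl, LieModule.traceForm_apply_apply] at this
        exact this
      rw [smul_mul_assoc, map_smul, h5, smul_eq_mul, mul_one] at h3
      exact h3
    · intro k _ hk
      have := h.traceForm_dual k i
      rw [if_neg fun h0 => hk (Subtype.ext h0).symm, LieModule.traceForm_apply_apply] at this
      rw [smul_mul_assoc, map_smul]
      exact (congrArg (c k • ·) this).trans (smul_zero _)
    · simp
  have hsum : ∑ i, c i • h.U i ∈ filt (φ x) (j - 1) := by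
    refine Submodule.sum_mem _ fun i _ => ?_
    by_cases hi : 1 - j < deg i
    · rw [htr i hi, zero_smul]
      exact zero_mem _
    · exact Submodule.smul_mem _ _ (filt_antitone _ (by omega) (h.U_mem i))
  have hz : n₀ * φ f - φ f * n₀ = 0 := by
    have h6 : n₀ * φ f - φ f * n₀ ∈ filt (φ x) (j - 1) := by
      simpa using sub_mem hc' hsum
    exact Submodule.disjoint_def.1 (disjoint_eigenspace_above _ (by omega : j - 2 < j - 1)) _
      hn₀f h6
  have hn0 : n₀ = 0 :=
    eq_zero_of_commute_of_mem_endPiece h.triple (by omega) hn₀ (sub_eq_zero.1 hz).symm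
  rw [hn0, zero_add]
  exact hn₁

end IsAdapted

end Adapted

/-! ### Canonical forms under gauge transformations -/

namespace IsAdapted

variable {F g V ι : Type*} [Field F] [LieRing g] [LieAlgebra F g]
  [AddCommGroup V] [Module F V] [LieRingModule g V] [LieModule F g V]
  {f x e : g} {b : Module.Basis ι F g} {deg : ι → ℤ} {If : Finset ι} [Fintype ι]
  {R : Type*} [CommRing R] [Algebra F R]

/-- The operator `φ(f) + ∑ᵢ qᵢ Uⁱ`, the sum being over `i ∈ κ`. -/
def lax (h : IsAdapted V f x e b deg If) {κ : Type*} [Fintype κ] (j : κ → ι) (q : κ → R) :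
    R ⊗[F] Module.End F V :=
  1 ⊗ₜ LieModule.toEnd F g V f + ∑ i, q i ⊗ₜ h.U (j i)

theorem lax_injective [LieModule.IsFaithful F g V] (h : IsAdapted V f x e b deg If) {κ : Type*}
    [Fintype κ] {j : κ → ι} (hj : Function.Injective j) :
    Function.Injective (h.lax (R := R) j) := fun _ _ hq =>
  coeff_eq_of_sum_tmul_eq (h.linearIndependent_U.comp j hj) (add_left_cancel hq)

theorem baseMap_lax (h : IsAdapted V f x e b deg If) {κ : Type*} [Fintype κ] (j : κ → ι)
    {R' : Type*} [CommRing R'] [Algebra F R'] (E : R →ₐ[F] R') (q : κ → R) :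
    baseMap _ E (h.lax j q) = h.lax j fun i => E (q i) := by
  simp only [lax, map_add, map_sum, baseMap_tmul, map_one]

/-- Families supported on a subtype give the same operator as their restrictions. -/
theorem lax_subtype (h : IsAdapted V f x e b deg If) (p : ι → Prop) [Fintype {i // p i}]
    (q : ι → R) (hq : ∀ i, ¬ p i → q i = 0) :
    h.lax (fun i : {i // p i} => i.1) (fun i => q i.1) = h.lax id q := by
  classical
  unfold lax
  congr 1
  rw [← Finset.sum_subtype (Finset.univ.filter p) (by simp) (fun i => q i ⊗ₜ[F] h.U i)]
  refine Finset.sum_subset (Finset.filter_subset _ _) fun i _ hi => ?_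
  rw [hq i fun hp => hi (by simp [hp])]
  exact TensorProduct.zero_tmul _ _

theorem isNilpotent_of_mem [CharZero F] {X : Module.End F V} {K : ℕ} (hK : filt X K = ⊥)
    {n : R ⊗[F] Module.End F V} (hn : n ∈ tens ⊤ (filt X 1)) : IsNilpotent n := by
  have hpow : ∀ k : ℕ, n ^ k ∈ tens ⊤ (filt X k) := by
    intro k
    induction k with
    | zero =>
      rw [pow_zero, Algebra.TensorProduct.one_def]
      exact tmul_mem_tens trivial (one_mem_filt X)
    | succ k ih =>
      rw [pow_succ]
      refine mul_mem_tens (fun _ _ _ _ => Submodule.mem_top) (fun a ha c hc => ?_) ih hn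
      push_cast
      exact mul_mem_filt ha hc
  refine ⟨K, ?_⟩
  have := hpow K
  rwa [hK, tens_bot_right, Submodule.mem_bot] at this

variable [CharZero F] [FiniteDimensional F V] [LieModule.IsFaithful F g V]

/-- Canonical forms are unique: a unipotent gauge transformation between two canonical forms is
trivial. By induction, `N - 1` has arbitrarily large degree. -/
theorem eq_of_isGauge (h : IsAdapted V f x e b deg If) {δ : Derivation F R R} {K : ℕ}
    (hK : filt (LieModule.toEnd F g V x) K = ⊥) {N : R ⊗[F] Module.End F V}
    (hN : N - 1 ∈ tens ⊤ (filt (LieModule.toEnd F g V x) 1)) {l l' : If → R}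
    (hg : IsGauge (tensDer _ δ) N (h.lax (fun i : If => i.1) l) (h.lax (fun i : If => i.1) l')) :
    l = l' := by
  set X := LieModule.toEnd F g V x
  have hP : ∀ l : If → R, ∑ i, l i ⊗ₜ[F] h.U i ∈ tens ⊤ (filt X 0) := fun l =>
    Submodule.sum_mem _ fun i _ => tmul_mem_tens trivial
      (filt_antitone _ (by have := h.deg_nonpos i.2; omega) (h.U_mem i))
  have hind : ∀ k : ℕ, N - 1 ∈ tens ⊤ (filt X (k + 1)) := by
    intro k
    induction k with
    | zero => simpa using hN
    | succ k ih =>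
      set n := N - 1 with hn
      have hg' : ∑ i, (l i - l' i) ⊗ₜ[F] h.U i + (n * 1 ⊗ₜ LieModule.toEnd F g V f -
          1 ⊗ₜ LieModule.toEnd F g V f * n) =
          tensDer _ δ n - n * ∑ i, l i ⊗ₜ[F] h.U i + (∑ i, l' i ⊗ₜ[F] h.U i) * n := by
        have e : tensDer _ δ n = tensDer _ δ N := by rw [hn, map_sub, tensDer_one, sub_zero]
        rw [e, ← hg, show N = n + 1 by rw [hn]; abel]
        simp only [lax, TensorProduct.sub_tmul, Finset.sum_sub_distrib]
        noncomm_ring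
      have hmem : tensDer _ δ n - n * ∑ i, l i ⊗ₜ[F] h.U i + (∑ i, l' i ⊗ₜ[F] h.U i) * n ∈
          tens ⊤ (filt X (k + 1)) := by
        refine add_mem (sub_mem (tensDer_mem_tens_top δ ih) ?_) ?_
        · refine mul_mem_tens (fun _ _ _ _ => Submodule.mem_top) (fun a ha c hc => ?_) ih (hP l)
          simpa using mul_mem_filt ha hc
        · refine mul_mem_tens (fun _ _ _ _ => Submodule.mem_top) (fun a ha c hc => ?_) (hP l') ih
          simpa using mul_mem_filt ha hc
      rw [mem_tens_top_iff] at ih ⊢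
      intro c
      push_cast
      refine h.mem_filt_succ (by omega) (fun i => c (l i - l' i)) (ih c) ?_
      have h1 := mem_tens_top_iff.1 hmem c
      rw [← hg', map_add, map_sub, slice_mul_one_tmul, slice_one_tmul_mul, map_sum] at h1
      simp only [slice_tmul] at h1
      exact filt_antitone _ (by omega) h1
  have hN1 : N = 1 := by
    have := tens_mono le_rfl (filt_antitone X (by omega : (K : ℤ) ≤ K + 1)) (hind K)
    rwa [hK, tens_bot_right, Submodule.mem_bot, sub_eq_zero] at this
  refine h.lax_injective Subtype.val_injective ?_
  have h2 : _ = _ := hg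
  rwa [hN1, one_mul, mul_one, tensDer_one, sub_eq_zero] at h2

/-- The image in `End V` of the elements of `g` of degree at least `n / 2`. -/
def lieFilt (F V : Type*) {g : Type*} [Field F] [LieRing g] [LieAlgebra F g] [AddCommGroup V]
    [Module F V] [LieRingModule g V] [LieModule F g V] (x : g) (n : ℤ) :
    Submodule F (Module.End F V) :=
  (above (piece F x) n).map (LieModule.toEnd F g V : g →ₗ[F] Module.End F V)

end IsAdapted

section LieFilt

open IsAdapted

variable {F g V : Type*} [Field F] [LieRing g] [LieAlgebra F g]
  [AddCommGroup V] [Module F V] [LieRingModule g V] [LieModule F g V]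

theorem lieFilt_antitone (x : g) : Antitone (lieFilt F V x) :=
  fun _ _ h => Submodule.map_mono (above_antitone _ h)

theorem toEnd_mem_lieFilt {x a : g} {m n : ℤ} (h : m ≤ n) (ha : a ∈ piece F x n) :
    LieModule.toEnd F g V a ∈ lieFilt F V x m :=
  ⟨a, le_above (P := piece F x) h ha, rfl⟩

theorem lieFilt_le_filt (x : g) (n : ℤ) :
    lieFilt F V x n ≤ filt (LieModule.toEnd F g V x) n := by
  refine Submodule.map_le_iff_le_comap.2 (above_le.2 fun m hm a ha => ?_)
  exact endPiece_le_filt _ hm (toEnd_mem_endPiece ha)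

theorem lie_mem_above {x : g} {m n : ℤ} {a c : g} (ha : a ∈ above (piece F x) m)
    (hc : c ∈ above (piece F x) n) : ⁅a, c⁆ ∈ above (piece F x) (m + n) :=
  bilin_mem_above (P := piece F x) (Q := piece F x) (S := piece F x)
    (LieModule.toEnd F g g : g →ₗ[F] Module.End F g)
    (fun _ _ _ ha _ hc => lie_mem_piece ha hc) ha hc

theorem lie_mem_lieFilt {x : g} {m n : ℤ} {A C : Module.End F V} (hA : A ∈ lieFilt F V x m)
    (hC : C ∈ lieFilt F V x n) : A * C - C * A ∈ lieFilt F V x (m + n) := by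
  obtain ⟨a, ha, rfl⟩ := hA
  obtain ⟨c, hc, rfl⟩ := hC
  exact ⟨⁅a, c⁆, lie_mem_above ha hc, toEnd_lie a c⟩

theorem innerDer_mem_tens_lieFilt {R : Type*} [CommRing R] [Algebra F R] {x : g} {m n : ℤ}
    {y z : R ⊗[F] Module.End F V} (hy : y ∈ tens ⊤ (lieFilt F V x m))
    (hz : z ∈ tens ⊤ (lieFilt F V x n)) :
    innerDer F y z ∈ tens ⊤ (lieFilt F V x (m + n)) := by
  have h1 : ∀ z' : R ⊗[F] Module.End F V,
      innerDer F y z' = (LinearMap.mulRight F z' - LinearMap.mulLeft F z') y := fun _ => rfl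
  rw [h1]
  refine map_mem_of_mem_tens hy _ _ fun r _ a ha => ?_
  have h2 : (LinearMap.mulRight F z - LinearMap.mulLeft F z) (r ⊗ₜ[F] a) =
      (LinearMap.mulLeft F (r ⊗ₜ[F] a) - LinearMap.mulRight F (r ⊗ₜ[F] a)) z := rfl
  rw [h2]
  refine map_mem_of_mem_tens hz _ _ fun r' _ c hc => ?_
  have h3 : (LinearMap.mulLeft F (r ⊗ₜ[F] a) - LinearMap.mulRight F (r ⊗ₜ[F] a)) (r' ⊗ₜ[F] c) =
      (r * r') ⊗ₜ (a * c - c * a) := by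
    simp [TensorProduct.tmul_sub, mul_comm r']
  rw [h3]
  exact tmul_mem_tens trivial (lie_mem_lieFilt ha hc)

end LieFilt

namespace IsAdapted

variable {F g V ι : Type*} [Field F] [LieRing g] [LieAlgebra F g]
  [AddCommGroup V] [Module F V] [LieRingModule g V] [LieModule F g V]
  {f x e : g} {b : Module.Basis ι F g} {deg : ι → ℤ} {If : Finset ι} [Fintype ι]
  {R : Type*} [CommRing R] [Algebra F R] [CharZero F]

theorem U_mem_lieFilt (h : IsAdapted V f x e b deg If) {i : ι} {n : ℤ} (hi : deg i ≤ -n) :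
    h.U i ∈ lieFilt F V x n :=
  toEnd_mem_lieFilt (by omega) (h.dual_mem i)

/-- Elements of `R ⊗ g` of degree at least `n / 2` are combinations of the dual basis vectors of
degree at least `n / 2`. -/
theorem exists_eq_sum (h : IsAdapted V f x e b deg If) {n : ℤ} {y : R ⊗[F] Module.End F V}
    (hy : y ∈ tens ⊤ (lieFilt F V x n)) :
    ∃ r : ι → R, y = ∑ i, r i ⊗ₜ h.U i ∧ ∀ i, -n < deg i → r i = 0 := by
  let S : Submodule F (R ⊗[F] Module.End F V) :=
    { carrier := {y | ∃ r : ι → R, y = ∑ i, r i ⊗ₜ h.U i ∧ ∀ i, -n < deg i → r i = 0}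
      zero_mem' := ⟨0, by simp, fun _ _ => rfl⟩
      add_mem' := by
        rintro _ _ ⟨r, rfl, hr⟩ ⟨r', rfl, hr'⟩
        refine ⟨r + r', ?_, fun i hi => by simp [hr i hi, hr' i hi]⟩
        simp [TensorProduct.add_tmul, Finset.sum_add_distrib]
      smul_mem' := by
        rintro c _ ⟨r, rfl, hr⟩
        refine ⟨c • r, ?_, fun i hi => by simp [hr i hi]⟩
        simp [TensorProduct.smul_tmul', Finset.smul_sum] }
  have hle : tens ⊤ (lieFilt F V x n) ≤ S := by
    refine tens_le.2 ?_
    rintro r - _ ⟨a, ha, rfl⟩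
    refine ⟨fun i => LieModule.traceForm F g V a (b i) • r, ?_, fun i hi => ?_⟩
    · have := h.toEnd_eq_sum a
      change r ⊗ₜ LieModule.toEnd F g V a = _
      rw [this, TensorProduct.tmul_sum]
      simp only [TensorProduct.smul_tmul]
    · dsimp only
      rw [h.traceForm_eq_zero_of_mem_above ha hi, zero_smul]
  exact hle hy

/-- One step of the reduction to canonical form: the components of degree `j / 2 - 1` outside the
span of the `Uⁱ`, `i ∈ If`, are removed, at the cost of terms of higher degree. The subalgebra
`𝒦` without unit keeps track of where the gauge transformation comes from. -/
theorem exists_gauge_step (h : IsAdapted V f x e b deg If) (δ : Derivation F R R) {K : ℕ}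
    (hK : filt (LieModule.toEnd F g V x) K = ⊥) {𝒦 : Submodule F (Module.End F V)}
    (hmul : ∀ a ∈ 𝒦, ∀ c ∈ 𝒦, a * c ∈ 𝒦) (hle : lieFilt F V x 1 ≤ 𝒦) {j : ℤ} (hj : 1 ≤ j)
    (q : ι → R) (hq : ∀ i, 1 < deg i → q i = 0) (hqj : ∀ i ∉ If, 2 - j < deg i → q i = 0) :
    ∃ N N' : R ⊗[F] Module.End F V, ∃ q' : ι → R, N * N' = 1 ∧ N' * N = 1 ∧
      N - 1 ∈ tens ⊤ 𝒦 ∧ N' - 1 ∈ tens ⊤ 𝒦 ∧ IsGauge (tensDer _ δ) N (h.lax id q) (h.lax id q') ∧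
      (∀ i, 1 < deg i → q' i = 0) ∧ ∀ i ∉ If, 1 - j < deg i → q' i = 0 := by
  classical
  choose! a ha hfa using fun i (hi : i ∉ If) => h.exists_lift hi
  -- with `[f, aᵢ] = uⁱ`, conjugation by `exp n`, `n = ∑ qᵢ aᵢ`, subtracts `∑ qᵢ Uⁱ` in
  -- lowest degree
  let s : Finset ι := {i | i ∉ If ∧ deg i = 2 - j}
  have hs : ∀ i ∈ s, i ∉ If ∧ deg i = 2 - j := fun i hi => by simpa [s] using hi
  let n : R ⊗[F] Module.End F V := ∑ i ∈ s, q i ⊗ₜ LieModule.toEnd F g V (a i)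
  have hn : n ∈ tens ⊤ (lieFilt F V x j) := by
    refine Submodule.sum_mem _ fun i hi => tmul_mem_tens trivial (toEnd_mem_lieFilt ?_
      (ha i (hs i hi).1))
    have := (hs i hi).2
    omega
  have hn1 : n ∈ tens ⊤ (lieFilt F V x 1) := tens_mono le_rfl (lieFilt_antitone x hj) hn
  have hnil : IsNilpotent n :=
    isNilpotent_of_mem hK (tens_mono le_rfl (lieFilt_le_filt x 1) hn1)
  have hnf : innerDer F n (1 ⊗ₜ LieModule.toEnd F g V f) = -∑ i ∈ s, q i ⊗ₜ[F] h.U i := by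
    simp only [innerDer_apply, n, Finset.sum_mul, Finset.mul_sum, ← Finset.sum_sub_distrib,
      ← Finset.sum_neg_distrib]
    refine Finset.sum_congr rfl fun i hi => ?_
    have hU : h.U i = LieModule.toEnd F g V f * LieModule.toEnd F g V (a i) -
        LieModule.toEnd F g V (a i) * LieModule.toEnd F g V f := by
      rw [← toEnd_lie, hfa i (hs i hi).1]
      rfl
    rw [hU, TensorProduct.tmul_sub]
    simp
  have hqU : ∑ i, q i ⊗ₜ[F] h.U i ∈ tens ⊤ (lieFilt F V x (-1)) := by
    refine Submodule.sum_mem _ fun i _ => ?_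
    by_cases hi : 1 < deg i
    · rw [hq i hi, TensorProduct.zero_tmul]
      exact zero_mem _
    · exact tmul_mem_tens trivial (h.U_mem_lieFilt (by omega))
  set L := h.lax id q
  have hw : innerDer F n L - tensDer _ δ n =
      -∑ i ∈ s, q i ⊗ₜ[F] h.U i + (innerDer F n (∑ i, q i ⊗ₜ h.U i) - tensDer _ δ n) := by
    simp only [L, lax, map_add, hnf, id]
    abel
  have hw' : innerDer F n (∑ i, q i ⊗ₜ h.U i) - tensDer _ δ n ∈ tens ⊤ (lieFilt F V x (j - 1)) :=
    sub_mem (innerDer_mem_tens_lieFilt hn hqU)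
      (tens_mono le_rfl (lieFilt_antitone x (by omega)) (tensDer_mem_tens_top δ hn))
  have hw2 : innerDer F n L - tensDer _ δ n ∈ tens ⊤ (lieFilt F V x (j - 2)) := by
    rw [hw]
    refine add_mem (neg_mem (Submodule.sum_mem _ fun i hi => tmul_mem_tens trivial
      (h.U_mem_lieFilt ?_))) (tens_mono le_rfl (lieFilt_antitone x (by omega)) hw')
    have := (hs i hi).2
    omega
  obtain ⟨E₀, hE₀, E₁, hE₁, z, hz, h01, h10, hG⟩ :=
    exists_exp_gauge (d := tensDer _ δ) (tensDer_mul δ) (tensDer_one δ) hnil L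
  have hpow : Submodule.span F (Set.range fun k : ℕ => n ^ (k + 1)) ≤ tens ⊤ 𝒦 := by
    rw [Submodule.span_le]
    rintro _ ⟨k, rfl⟩
    have hn𝒦 : n ∈ tens ⊤ 𝒦 := tens_mono le_rfl hle hn1
    induction k with
    | zero => simpa using hn𝒦
    | succ k ih =>
      dsimp only
      rw [pow_succ]
      exact mul_mem_tens (fun _ _ _ _ => Submodule.mem_top) hmul ih hn𝒦
  have hz' : z ∈ tens ⊤ (lieFilt F V x (j - 1)) := by
    refine Submodule.span_le.2 ?_ hz
    rintro _ ⟨k, rfl⟩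
    induction k with
    | zero =>
      simp only [zero_add, pow_one]
      exact tens_mono le_rfl (lieFilt_antitone x (by omega)) (innerDer_mem_tens_lieFilt hn hw2)
    | succ k ih =>
      dsimp only at ih ⊢
      rw [pow_succ', Module.End.mul_apply]
      exact tens_mono le_rfl (lieFilt_antitone x (by omega)) (innerDer_mem_tens_lieFilt hn ih)
  obtain ⟨r, hr, hr0⟩ := h.exists_eq_sum (add_mem hw' hz')
  refine ⟨1 + E₀, 1 + E₁, fun i => (if i ∈ s then 0 else q i) + r i, h01, h10, ?_, ?_, ?_, ?_, ?_⟩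
  · rw [add_sub_cancel_left]
    exact hpow hE₀
  · rw [add_sub_cancel_left]
    exact hpow hE₁
  · convert hG using 1
    rw [hw]
    have e1 : ∑ i, ((if i ∈ s then 0 else q i) + r i) ⊗ₜ[F] h.U i =
        ∑ i, q i ⊗ₜ[F] h.U i - ∑ i ∈ s, q i ⊗ₜ[F] h.U i + ∑ i, r i ⊗ₜ[F] h.U i := by
      rw [← Finset.sum_filter_add_sum_filter_not Finset.univ (· ∈ s) fun i => q i ⊗ₜ[F] h.U i]
      simp only [TensorProduct.add_tmul, Finset.sum_add_distrib]
      congr 1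
      rw [Finset.filter_univ_mem, add_sub_cancel_left, Finset.sum_filter]
      refine Finset.sum_congr rfl fun i _ => ?_
      by_cases hi : i ∈ s <;> simp [hi]
    simp only [L, lax, id]
    rw [e1, ← hr]
    abel
  · intro i hi
    dsimp only
    rw [hr0 i (by omega), hq i hi, ite_self, add_zero]
  · intro i hi hi'
    dsimp only
    rw [hr0 i (by omega), add_zero]
    split_ifs with his
    · rfl
    · refine hqj i hi ?_
      have : deg i ≠ 2 - j := fun h0 => his (by simp [s, hi, h0])
      omega

/-- Every `∂ + φ(f) + ∑ qᵢ Uⁱ`, the sum being over `i ∈ I_{≤ 1/2}`, has a canonical form under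
unipotent gauge transformations. -/
theorem exists_gauge (h : IsAdapted V f x e b deg If) (δ : Derivation F R R) {K : ℕ}
    (hK : filt (LieModule.toEnd F g V x) K = ⊥) {𝒦 : Submodule F (Module.End F V)}
    (hmul : ∀ a ∈ 𝒦, ∀ c ∈ 𝒦, a * c ∈ 𝒦) (hle : lieFilt F V x 1 ≤ 𝒦)
    (q : Low deg → R) :
    ∃ N N' : R ⊗[F] Module.End F V, ∃ l : If → R, N * N' = 1 ∧ N' * N = 1 ∧
      N - 1 ∈ tens ⊤ 𝒦 ∧ N' - 1 ∈ tens ⊤ 𝒦 ∧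
      IsGauge (tensDer _ δ) N (h.lax (fun i : Low deg => i.1) q)
        (h.lax (fun i : If => i.1) l) := by
  classical
  let q₀ : ι → R := fun i => if hi : deg i ≤ 1 then q ⟨i, hi⟩ else 0
  have hq₀ : h.lax (fun i : Low deg => i.1) q = h.lax id q₀ := by
    rw [← h.lax_subtype (fun i => deg i ≤ 1) q₀ fun i hi => dif_neg hi]
    congr 1
    funext i
    simp only [q₀, dif_pos i.2]
  have main : ∀ m : ℕ, ∃ N N' : R ⊗[F] Module.End F V, ∃ q' : ι → R, N * N' = 1 ∧ N' * N = 1 ∧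
      N - 1 ∈ tens ⊤ 𝒦 ∧ N' - 1 ∈ tens ⊤ 𝒦 ∧
      IsGauge (tensDer _ δ) N (h.lax id q₀) (h.lax id q') ∧
      (∀ i, 1 < deg i → q' i = 0) ∧ ∀ i ∉ If, 1 - (m : ℤ) < deg i → q' i = 0 := by
    intro m
    induction m with
    | zero =>
      have h0 : ∀ i, 1 < deg i → q₀ i = 0 := fun i hi => dif_neg (by omega)
      refine ⟨1, 1, q₀, mul_one 1, mul_one 1, by simp, by simp, ?_, h0,
        fun i _ hi => h0 i (by simpa using hi)⟩
      rw [IsGauge, one_mul, mul_one, sub_self, tensDer_one]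
    | succ m ih =>
      obtain ⟨N, N', q', h1, h2, h3, h4, h5, h6, h7⟩ := ih
      obtain ⟨M, M', q'', g1, g2, g3, g4, g5, g6, g7⟩ :=
        h.exists_gauge_step δ hK hmul hle (j := m + 1) (by omega) q' h6
          fun i hi hi' => h7 i hi (by omega)
      refine ⟨M * N, N' * M', q'', ?_, ?_, mul_sub_one_mem_tens hmul g3 h3,
        mul_sub_one_mem_tens hmul h4 g4, h5.comp (tensDer_mul δ) g5, g6, fun i hi hi' => g7 i hi ?_⟩
      · rw [mul_assoc, ← mul_assoc N, h1, one_mul, g1]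
      · rw [mul_assoc, ← mul_assoc M', g2, one_mul, h2]
      · push_cast at hi'
        exact hi'
  -- after sufficiently many steps, no degrees are left
  obtain ⟨N, N', q', h1, h2, h3, h4, h5, h6, h7⟩ := main (2 + ∑ i, (deg i).natAbs)
  refine ⟨N, N', fun i => q' i, h1, h2, h3, h4, ?_⟩
  rw [hq₀]
  have e : h.lax (fun i : If => i.1) (fun i => q' i.1) = h.lax id q' := by
    refine h.lax_subtype (fun i => i ∈ If) q' fun i hi => h7 i hi ?_
    have : (deg i).natAbs ≤ ∑ i, (deg i).natAbs :=
      Finset.single_le_sum (f := fun i => (deg i).natAbs) (fun _ _ => Nat.zero_le _)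
        (Finset.mem_univ i)
    push_cast
    zify at this
    have := neg_abs_le (deg i)
    omega
  rw [e]
  exact h5

end IsAdapted

/-! ### Differential polynomials and infinitesimal gauge transformations -/

section DiffPoly

variable {F κ R : Type*} [CommRing F] [CommRing R] [Algebra F R] {δ : Derivation F R R}

theorem der_X (i : κ) (n : ℕ) : der F κ (MvPolynomial.X (i, n)) = MvPolynomial.X (i, n + 1) := by
  simp [der]

theorem iterate_der_var (i : κ) (n : ℕ) : (der F κ)^[n] (var F i) = MvPolynomial.X (i, n) := by
  induction n with
  | zero => rfl
  | succ n ih => rw [Function.iterate_succ_apply', ih, der_X]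

theorem diffAeval_X (v : κ → R) (p : κ × ℕ) :
    diffAeval δ v (MvPolynomial.X p) = δ^[p.2] (v p.1) := by
  simp [diffAeval]

@[simp] theorem diffAeval_var (v : κ → R) (i : κ) : diffAeval δ v (var F i) = v i :=
  diffAeval_X v (i, 0)

theorem diffAeval_der (v : κ → R) (p : DiffPoly F κ) :
    diffAeval δ v (der F κ p) = δ (diffAeval δ v p) := by
  induction p using MvPolynomial.induction_on with
  | C c =>
    rw [← MvPolynomial.algebraMap_eq, Derivation.map_algebraMap, map_zero, AlgHom.commutes,
      Derivation.map_algebraMap]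
  | add p q hp hq => simp only [map_add, hp, hq]
  | mul_X p i hp =>
    rw [Derivation.leibniz, map_mul, Derivation.leibniz, map_add, smul_eq_mul, smul_eq_mul,
      map_mul, map_mul, hp, der_X, diffAeval_X, diffAeval_X, Function.iterate_succ_apply']
    rfl

/-- Differential algebra homomorphisms are determined by the images of the differential
variables. -/
theorem eq_diffAeval {h : DiffPoly F κ →ₐ[F] R} (hδ : ∀ p, h (der F κ p) = δ (h p)) :
    h = diffAeval δ fun i => h (var F i) := by
  refine MvPolynomial.algHom_ext fun p => ?_
  rw [diffAeval_X, ← PseudoDiffOp.map_iterate hδ, iterate_der_var]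

end DiffPoly

section Dual

variable {F R : Type*} [Field F] [CommRing R] [Algebra F R]

/-- The extension of a derivation to polynomials that annihilates the variable. -/
def polyDer (δ : Derivation F R R) : Derivation F (Polynomial R) (Polynomial R) :=
  (PolynomialModule.equivPolynomialSelf (R := R)).toLinearMap.compDer δ.mapCoeffs

theorem lambdaAdd_eq (δ : Derivation F R R) (p : Polynomial R) :
    lambdaAdd δ p = Polynomial.X * p + polyDer δ p := rfl

theorem polyDer_C (δ : Derivation F R R) (r : R) :
    polyDer δ (Polynomial.C r) = Polynomial.C (δ r) := by
  rw [← Polynomial.monomial_zero_left]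
  simp [polyDer, PolynomialModule.equivPolynomialSelf]

theorem coeff_polyDer (δ : Derivation F R R) (p : Polynomial R) (n : ℕ) :
    (polyDer δ p).coeff n = δ (p.coeff n) := by
  rfl

/-- The derivation of the dual numbers over `P` that extends `δ` and satisfies `∂τ = c τ`. -/
def dualDer {P : Type*} [CommRing P] [Algebra F P] (δ : Derivation F P P) (c : P) :
    Derivation F (DualNumber P) (DualNumber P) :=
  Derivation.mk'
    { toFun := fun z => TrivSqZeroExt.inl (δ z.fst) + TrivSqZeroExt.inr (c * z.snd + δ z.snd)
      map_add' := fun z z' => by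
        ext <;> simp
        ring
      map_smul' := fun r z => by
        ext <;> simp }
    fun z z' => by
      ext
      · simp
      · simp
        ring

/-- The algebra `P[τ]`, `τ² = 0`, of dual numbers over a differential algebra `P`. -/
def TauExt (P : Type*) : Type _ := DualNumber P

namespace TauExt

variable {P : Type*} [CommRing P] [Algebra F P]

instance : CommRing (TauExt P) := inferInstanceAs (CommRing (DualNumber P))

instance : Algebra F (TauExt P) := inferInstanceAs (Algebra F (DualNumber P))

variable (F P) in
/-- The inclusion `P → P[τ]`. -/
def const : P →ₐ[F] TauExt P := TrivSqZeroExt.inlAlgHom F P P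

variable (F P) in
/-- The map `p ↦ p τ`. -/
def tau : P →ₗ[F] TauExt P where
  toFun := fun p => (TrivSqZeroExt.inr p : DualNumber P)
  map_add' := TrivSqZeroExt.inr_add P
  map_smul' := TrivSqZeroExt.inr_smul P

theorem tau_injective : Function.Injective (tau F P) := TrivSqZeroExt.inr_injective

theorem const_mul_tau (p m : P) : const F P p * tau F P m = tau F P (p * m) :=
  TrivSqZeroExt.inl_mul_inr p m

theorem tau_mul_const (p m : P) : tau F P m * const F P p = tau F P (p * m) := by
  rw [mul_comm, const_mul_tau]

theorem tau_mul_tau (m m' : P) : tau F P m * tau F P m' = 0 :=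
  TrivSqZeroExt.inr_mul_inr P m m'

/-- The derivation of `P[τ]` that extends `δ` and satisfies `∂τ = c τ`. -/
def der (δ : Derivation F P P) (c : P) : Derivation F (TauExt P) (TauExt P) := dualDer δ c

theorem der_const (δ : Derivation F P P) (c p : P) :
    der δ c (const F P p) = const F P (δ p) := by
  change (TrivSqZeroExt.inl (δ p) + TrivSqZeroExt.inr (c * 0 + δ 0) : DualNumber P) =
    TrivSqZeroExt.inl (δ p)
  simp

theorem der_tau (δ : Derivation F P P) (c m : P) :
    der δ c (tau F P m) = tau F P (c * m + δ m) := by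
  change (TrivSqZeroExt.inl (δ 0) + TrivSqZeroExt.inr (c * m + δ m) : DualNumber P) =
    TrivSqZeroExt.inr (c * m + δ m)
  simp

end TauExt

end Dual

section Bracket

variable {F g ι : Type*} [Field F] [LieRing g] [LieAlgebra F g]
  (b : Module.Basis ι F g) (B : LinearMap.BilinForm F g) (deg : ι → ℤ) (f : g)

theorem incl_X (p : Low deg × ℕ) : incl F deg (MvPolynomial.X p) = MvPolynomial.X (p.1.1, p.2) := by
  rw [incl, diffAeval_X, iterate_der_var]

theorem rho_der (p : DiffPoly F ι) : rho b B deg f (der F ι p) = der F _ (rho b B deg f p) :=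
  diffAeval_der _ p

theorem projCentralizer_der (If : Finset ι) (p : DiffPoly F (Low deg)) :
    projCentralizer F deg If (der F _ p) = der F _ (projCentralizer F deg If p) :=
  diffAeval_der _ p

theorem rho_incl (hf : ∀ i, deg i ≤ 1 → B f (b i) = 0) (p : DiffPoly F (Low deg)) :
    rho b B deg f (incl F deg p) = p := by
  have h := eq_diffAeval (h := (rho b B deg f).comp (incl F deg)) (δ := der F (Low deg))
    fun p => by rw [AlgHom.comp_apply, AlgHom.comp_apply, incl, diffAeval_der, rho_der]
  have h' := eq_diffAeval (h := AlgHom.id F (DiffPoly F (Low deg))) (δ := der F (Low deg))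
    fun p => rfl
  have e : (rho b B deg f).comp (incl F deg) = AlgHom.id F _ := by
    rw [h, h']
    congr 1
    funext i
    rw [AlgHom.comp_apply, incl, diffAeval_var, rho, diffAeval_var, dif_pos i.2, hf i.1 i.2,
      map_zero, add_zero]
    rfl
  exact congrArg (· p) (congrArg DFunLike.coe e)

theorem map_lambdaAdd (p : Polynomial (DiffPoly F ι)) :
    (lambdaAdd (der F ι) p).map (rho b B deg f).toRingHom =
      lambdaAdd (der F (Low deg)) (p.map (rho b B deg f).toRingHom) := by
  rw [lambdaAdd_eq, lambdaAdd_eq, Polynomial.map_add, Polynomial.map_mul, Polynomial.map_X]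
  congr 1
  ext1 n
  rw [Polynomial.coeff_map, coeff_polyDer, coeff_polyDer, Polynomial.coeff_map]
  exact rho_der b B deg f _

/-- The derivation of the differential algebra `V(g_{≤ 1/2})[λ][τ]`, `τ² = 0`, `∂λ = 0`, `∂τ = λτ`,
over which infinitesimal gauge transformations become actual ones. -/
abbrev tauDer (F κ : Type*) [Field F] :
    Derivation F (TauExt (Polynomial (DiffPoly F κ))) (TauExt (Polynomial (DiffPoly F κ))) :=
  TauExt.der (polyDer (der F κ)) Polynomial.X

/-- The inclusion of `V(g_{≤ 1/2})` in `V(g_{≤ 1/2})[λ][τ]`. -/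
def constDual (F κ : Type*) [Field F] : DiffPoly F κ →ₐ[F] TauExt (Polynomial (DiffPoly F κ)) :=
  (TauExt.const F _).comp Polynomial.CAlgHom

theorem constDual_apply {κ : Type*} (w : DiffPoly F κ) :
    constDual F κ w = TauExt.const F _ (Polynomial.C w) := rfl

theorem constDual_der {κ : Type*} (w : DiffPoly F κ) :
    constDual F κ (der F κ w) = tauDer F κ (constDual F κ w) := by
  rw [constDual_apply, constDual_apply, TauExt.der_const, polyDer_C]

theorem iterate_tauDer {κ : Type*} (w : DiffPoly F κ) (m : Polynomial (DiffPoly F κ)) (n : ℕ) :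
    (tauDer F κ)^[n] (constDual F _ w + TauExt.tau F _ m) =
      constDual F _ ((der F _)^[n] w) + TauExt.tau F _ ((lambdaAdd (der F _))^[n] m) := by
  induction n with
  | zero => rfl
  | succ n ih =>
    rw [Function.iterate_succ_apply', ih, map_add, ← constDual_der, Function.iterate_succ_apply',
      Function.iterate_succ_apply', lambdaAdd_eq, TauExt.der_tau]

variable [Fintype ι]

/-- The infinitesimal gauge action `w ↦ ρ{a_λ w}` of `a ∈ g` on `V(g_{≤ 1/2})`. -/
def gaugeAction (a : g) (w : DiffPoly F (Low deg)) : Polynomial (DiffPoly F (Low deg)) :=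
  (lambdaBracket b B 0 0 a (incl F deg w)).map (rho b B deg f).toRingHom

theorem mem_WAlg_iff {x : g} {w : DiffPoly F (Low deg)} : w ∈ WAlg b B deg f x 0 0 ↔
    ∀ a ∈ above (piece F x) 1, gaugeAction b B deg f a w = 0 := Iff.rfl

theorem gaugeAction_X (a : g) (p : Low deg × ℕ) :
    gaugeAction b B deg f a (MvPolynomial.X p) =
      (lambdaAdd (der F (Low deg)))^[p.2] (gaugeAction b B deg f a (var F p.1)) := by
  unfold gaugeAction lambdaBracket var
  rw [incl_X, incl_X, MvPolynomial.mkDerivation_X, MvPolynomial.mkDerivation_X]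
  dsimp only
  rw [Function.iterate_zero, id]
  generalize Polynomial.C (gen b ⁅a, b p.1.1⁆) + _ + _ = q
  induction p.2 with
  | zero => rfl
  | succ n ih => rw [Function.iterate_succ_apply', map_lambdaAdd, ih, Function.iterate_succ_apply']

theorem gaugeAction_var (a : g) (i : Low deg) :
    gaugeAction b B deg f a (var F i) = Polynomial.C (rho b B deg f (gen b ⁅a, b i.1⁆)) +
      Polynomial.C (MvPolynomial.C (B a (b i.1))) * Polynomial.X := by
  have h1 : ∀ c : F, rho b B deg f (MvPolynomial.C c) = MvPolynomial.C c :=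
    fun c => (rho b B deg f).commutes c
  unfold gaugeAction lambdaBracket var
  rw [incl_X, MvPolynomial.mkDerivation_X]
  simp [h1]

theorem gaugeAction_mul (hf : ∀ i, deg i ≤ 1 → B f (b i) = 0) (a : g)
    (v w : DiffPoly F (Low deg)) : gaugeAction b B deg f a (v * w) =
      Polynomial.C v * gaugeAction b B deg f a w + Polynomial.C w * gaugeAction b B deg f a v := by
  have h1 : ∀ p, (rho b B deg f).toRingHom (incl F deg p) = p := rho_incl b B deg f hf
  simp only [gaugeAction, map_mul, Derivation.leibniz, Polynomial.map_add, Polynomial.smul_eq_C_mul,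
    Polynomial.map_mul, Polynomial.map_C, h1]

theorem gaugeAction_add (a : g) (v w : DiffPoly F (Low deg)) :
    gaugeAction b B deg f a (v + w) = gaugeAction b B deg f a v + gaugeAction b B deg f a w := by
  simp [gaugeAction]

theorem gaugeAction_C (a : g) (c : F) : gaugeAction b B deg f a (MvPolynomial.C c) = 0 := by
  rw [gaugeAction, ← MvPolynomial.algebraMap_eq, AlgHom.commutes, Derivation.map_algebraMap,
    Polynomial.map_zero]

theorem gaugeAction_smul (a : g) (c : F) (v : DiffPoly F (Low deg)) :
    gaugeAction b B deg f a (c • v) = c • gaugeAction b B deg f a v := by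
  unfold gaugeAction
  rw [map_smul, Derivation.map_smul]
  ext1 n
  rw [Polynomial.coeff_map, Polynomial.coeff_smul, Polynomial.coeff_smul, Polynomial.coeff_map]
  exact map_smul (rho b B deg f) c _

/-- The differential algebra homomorphism with `uᵢ ↦ uᵢ + τ ρ{a_λ uᵢ}`. -/
def gaugeDual (a : g) :
    DiffPoly F (Low deg) →ₐ[F] TauExt (Polynomial (DiffPoly F (Low deg))) :=
  diffAeval (tauDer F (Low deg)) fun i =>
    constDual F _ (var F i) + TauExt.tau F _ (gaugeAction b B deg f a (var F i))

theorem gaugeDual_apply (hf : ∀ i, deg i ≤ 1 → B f (b i) = 0) (a : g) (w : DiffPoly F (Low deg)) :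
    gaugeDual b B deg f a w =
      constDual F _ w + TauExt.tau F _ (gaugeAction b B deg f a w) := by
  induction w using MvPolynomial.induction_on with
  | C c =>
    rw [gaugeAction_C, map_zero, add_zero]
    exact (AlgHom.commutes _ c).trans (AlgHom.commutes (constDual F _) c).symm
  | add p q hp hq =>
    rw [map_add, hp, hq, map_add, gaugeAction_add, map_add]
    abel
  | mul_X p i hp =>
    have hX : gaugeDual b B deg f a (MvPolynomial.X i) = constDual F _ (MvPolynomial.X i) +
        TauExt.tau F _ (gaugeAction b B deg f a (MvPolynomial.X i)) := by
      rw [gaugeDual, diffAeval_X, iterate_tauDer, iterate_der_var, gaugeAction_X]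
    rw [map_mul, hp, hX, map_mul, gaugeAction_mul b B deg f hf]
    simp only [constDual_apply, add_mul, mul_add, TauExt.const_mul_tau, TauExt.tau_mul_const,
      TauExt.tau_mul_tau, map_add]
    abel

theorem gaugeAction_der (hf : ∀ i, deg i ≤ 1 → B f (b i) = 0) (a : g)
    (w : DiffPoly F (Low deg)) : gaugeAction b B deg f a (der F _ w) =
      lambdaAdd (der F _) (gaugeAction b B deg f a w) := by
  have h : gaugeDual b B deg f a (der F _ w) = tauDer F _ (gaugeDual b B deg f a w) :=
    diffAeval_der _ w
  rw [gaugeDual_apply b B deg f hf, gaugeDual_apply b B deg f hf] at h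
  have h' := iterate_tauDer w (gaugeAction b B deg f a w) 1
  rw [Function.iterate_one] at h'
  rw [h'] at h
  exact TauExt.tau_injective (add_left_cancel h)

end Bracket

/-! ### Generators of the W-algebra -/

theorem IsGauge.baseMap {F R R' E : Type*} [Field F] [CommRing R] [Algebra F R] [CommRing R']
    [Algebra F R'] [Ring E] [Algebra F E] {δ : Derivation F R R} {δ' : Derivation F R' R'}
    {h : R →ₐ[F] R'} (hδ : ∀ a, h (δ a) = δ' (h a)) {N L L' : R ⊗[F] E}
    (hg : IsGauge (tensDer E δ) N L L') :
    IsGauge (tensDer E δ') (ClassicalW.baseMap E h N) (ClassicalW.baseMap E h L)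
      (ClassicalW.baseMap E h L') := by
  unfold IsGauge at *
  rw [← baseMap_tensDer hδ, ← hg, map_sub, map_mul, map_mul]

theorem one_sub_tmul_sub_one_mem {F R E : Type*} [Field F] [CommRing R] [Algebra F R]
    [Ring E] [Algebra F E] {Q : Submodule F E} (r : R) {a : E} (ha : a ∈ Q) :
    1 - r ⊗ₜ[F] a - 1 ∈ tens ⊤ Q := by
  rw [sub_sub_cancel_left]
  exact neg_mem (tmul_mem_tens trivial ha)

theorem baseMap_sub_one_mem {F R R' E : Type*} [Field F] [CommRing R] [Algebra F R]
    [CommRing R'] [Algebra F R'] [Ring E] [Algebra F E] {Q : Submodule F E} (c : R →ₐ[F] R')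
    {A : R ⊗[F] E} (hA : A - 1 ∈ tens ⊤ Q) : baseMap E c A - 1 ∈ tens ⊤ Q := by
  rw [← map_one (baseMap E c), ← map_sub]
  exact baseMap_mem_tens_top c hA

theorem rho_gen {F g ι : Type*} [Field F] [LieRing g] [LieAlgebra F g] [Fintype ι]
    (b : Module.Basis ι F g) (B : LinearMap.BilinForm F g) (deg : ι → ℤ) (f c : g) :
    rho b B deg f (gen b c) =
      ∑ j : Low deg, b.repr c j.1 • var F j +
        MvPolynomial.C (B f c) := by
  classical
  have h1 : ∀ i, rho b B deg f (var F i) =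
      (if h : deg i ≤ 1 then var F (⟨i, h⟩ : Low deg) else 0) +
        MvPolynomial.C (B f (b i)) := fun i => diffAeval_var _ i
  rw [gen, map_sum]
  simp only [map_smul, h1, smul_add, Finset.sum_add_distrib]
  congr 1
  · rw [← Finset.sum_filter_add_sum_filter_not Finset.univ (fun i => deg i ≤ 1),
      Finset.sum_subtype (Finset.univ.filter fun i => deg i ≤ 1) (p := fun i => deg i ≤ 1)
        (by simp)]
    rw [Finset.sum_eq_zero (s := Finset.univ.filter fun i => ¬ deg i ≤ 1), add_zero]
    · refine Finset.sum_congr rfl fun j _ => ?_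
      rw [dif_pos j.2]
    · intro i hi
      rw [dif_neg (Finset.mem_filter.1 hi).2, smul_zero]
  · conv_rhs => rw [← b.sum_repr c]
    simp only [map_sum, map_smul, MvPolynomial.smul_eq_C_mul, smul_eq_mul, map_mul]

namespace IsAdapted

variable {F g V ι : Type*} [Field F] [CharZero F] [LieRing g] [LieAlgebra F g]
  [AddCommGroup V] [Module F V] [LieRingModule g V] [LieModule F g V]
  {f x e : g} {b : Module.Basis ι F g} {deg : ι → ℤ} {If : Finset ι}

theorem traceForm_f (h : IsAdapted V f x e b deg If) (i : ι) (hi : deg i ≤ 1) :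
    LieModule.traceForm F g V f (b i) = 0 :=
  traceForm_eq_zero h.triple.f_mem (h.mem_piece i) (by omega)

variable [Fintype ι]

theorem toEnd_eq_sum_low (h : IsAdapted V f x e b deg If) {a : g}
    (ha : a ∈ above (piece F x) (-1)) : LieModule.toEnd F g V a =
      ∑ i : Low deg, LieModule.traceForm F g V a (b i.1) • h.U i.1 := by
  classical
  rw [h.toEnd_eq_sum a, ← Finset.sum_subtype (Finset.univ.filter fun i => deg i ≤ 1) (by simp)
    (fun i => LieModule.traceForm F g V a (b i) • h.U i)]
  symm
  refine Finset.sum_subset (Finset.filter_subset _ _) fun i _ hi => ?_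
  rw [h.traceForm_eq_zero_of_mem_above ha (by simpa using hi), zero_smul]

theorem toEnd_lie_f (h : IsAdapted V f x e b deg If) {a : g} (ha : a ∈ above (piece F x) 1) :
    LieModule.toEnd F g V ⁅f, a⁆ =
      ∑ i : Low deg, LieModule.traceForm F g V f ⁅a, b i.1⁆ • h.U i.1 := by
  rw [h.toEnd_eq_sum_low]
  · simp only [LieModule.traceForm_apply_lie_apply]
  · exact above_antitone _ (by norm_num : (-1 : ℤ) ≤ -2 + 1)
      (lie_mem_above (le_above (P := piece F x) le_rfl h.triple.f_mem) ha)

theorem U_mul_sub (h : IsAdapted V f x e b deg If) {a : g} (ha : a ∈ above (piece F x) 1)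
    (j : Low deg) : h.U j.1 * LieModule.toEnd F g V a - LieModule.toEnd F g V a * h.U j.1 =
      ∑ i : Low deg, b.repr ⁅a, b i.1⁆ j.1 • h.U i.1 := by
  rw [U, ← toEnd_lie, h.toEnd_eq_sum_low]
  · simp only [LieModule.traceForm_apply_lie_apply, h.traceForm_dual_left]
  · refine above_antitone _ (by have := j.2; omega : (-1 : ℤ) ≤ -deg j.1 + 1) ?_
    exact lie_mem_above (le_above (P := piece F x) le_rfl (h.dual_mem j.1)) ha

/-- Over an extension of `V(g_{≤ 1/2})[λ]` by elements `t m` of square zero, with `∂(t 1) = t λ`,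
the infinitesimal gauge action is the gauge transformation by `1 - t(1) a`. -/
theorem isGauge_infinitesimal (h : IsAdapted V f x e b deg If) {a : g}
    (ha : a ∈ above (piece F x) 1) {R : Type*} [CommRing R] [Algebra F R] {δ : Derivation F R R}
    (c : DiffPoly F (Low deg) →ₐ[F] R) (t : Polynomial (DiffPoly F (Low deg)) →ₗ[F] R)
    (hct : ∀ p, c p * t 1 = t (Polynomial.C p)) (htt : ∀ m m', t m * t m' = 0)
    (hδ : δ (t 1) = t Polynomial.X) :
    IsGauge (tensDer _ δ) (1 - t 1 ⊗ₜ[F] LieModule.toEnd F g V a)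
      (h.lax (fun i : Low deg => i.1) fun i => c (var F i))
      (h.lax (fun i : Low deg => i.1) fun i => c (var F i) +
        t (gaugeAction b (LieModule.traceForm F g V) deg f a (var F i))) := by
  classical
  have e2 : ∀ i : Low deg, t (gaugeAction b (LieModule.traceForm F g V) deg f a (var F i)) =
      LieModule.traceForm F g V f ⁅a, b i.1⁆ • t 1 +
      ∑ j : Low deg, b.repr ⁅a, b i.1⁆ j.1 • t (Polynomial.C (var F j)) +
      LieModule.traceForm F g V a (b i.1) • t Polynomial.X := by
    intro i
    rw [gaugeAction_var, rho_gen]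
    simp only [← map_smul, ← map_sum, ← map_add]
    congr 1
    rw [map_add, map_sum, add_comm (∑ j, _)]
    simp only [Polynomial.smul_C]
    congr 2
    · rw [← Polynomial.C_1, Polynomial.smul_C, MvPolynomial.smul_eq_C_mul, mul_one]
    · rw [← Polynomial.smul_eq_C_mul, ← algebraMap_smul (DiffPoly F (Low deg))
        (LieModule.traceForm F g V a (b i.1))]
      rfl
  generalize hφ : LieModule.toEnd F g V a = φa
  set K : R ⊗[F] Module.End F V := ∑ i : Low deg,
    t (gaugeAction b (LieModule.traceForm F g V) deg f a (var F i)) ⊗ₜ h.U i.1 with hKdef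
  set L := h.lax (fun i : Low deg => i.1) fun i => c (var F i) with hL
  have hL1 : h.lax (fun i : Low deg => i.1) (fun i => c (var F i) +
      t (gaugeAction b (LieModule.traceForm F g V) deg f a (var F i))) = L + K := by
    rw [hL, lax, lax, add_assoc, ← Finset.sum_add_distrib]
    simp only [TensorProduct.add_tmul]
  -- the infinitesimal change of `L` is its commutator with `a`, up to the derivative of `t 1`
  have hK : K = L * (t 1 ⊗ₜ φa) - (t 1 ⊗ₜ φa) * L + t Polynomial.X ⊗ₜ[F] φa := by
    have e1 : L * (t 1 ⊗ₜ φa) - (t 1 ⊗ₜ φa) * L = t 1 ⊗ₜ[F] LieModule.toEnd F g V ⁅f, a⁆ +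
        ∑ j : Low deg, t (Polynomial.C (var F j)) ⊗ₜ[F] (h.U j.1 * φa - φa * h.U j.1) := by
      rw [hL, lax, add_mul, mul_add, add_sub_add_comm]
      congr 1
      · rw [toEnd_lie, TensorProduct.tmul_sub, hφ]
        simp only [Algebra.TensorProduct.tmul_mul_tmul, one_mul, mul_one]
      · rw [Finset.sum_mul, Finset.mul_sum, ← Finset.sum_sub_distrib]
        refine Finset.sum_congr rfl fun j _ => ?_
        simp only [Algebra.TensorProduct.tmul_mul_tmul, TensorProduct.tmul_sub,
          mul_comm (t 1), hct]
    have e3 := h.toEnd_eq_sum_low (above_antitone (piece F x) (by norm_num : (-1 : ℤ) ≤ 1) ha)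
    rw [hφ] at e3
    have hU := h.U_mul_sub ha
    rw [hφ] at hU
    rw [e1, h.toEnd_lie_f ha]
    simp only [hU, TensorProduct.tmul_sum, hKdef, e2, TensorProduct.add_tmul,
      TensorProduct.sum_tmul, Finset.sum_add_distrib, TensorProduct.tmul_smul,
      TensorProduct.smul_tmul']
    rw [e3]
    simp only [TensorProduct.tmul_sum, TensorProduct.tmul_smul, TensorProduct.smul_tmul']
    congr 2
    exact Finset.sum_comm
  have hKt : K * (t 1 ⊗ₜ φa) = 0 := by
    simp only [hKdef, Finset.sum_mul, Algebra.TensorProduct.tmul_mul_tmul, htt,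
      TensorProduct.zero_tmul, Finset.sum_const_zero]
  rw [hL1, IsGauge, map_sub, tensDer_one, tensDer_tmul, hδ, zero_sub, sub_mul, mul_sub, add_mul L K
    (t 1 ⊗ₜ φa), hKt, one_mul, mul_one, hK]
  abel

/-- Over the dual numbers, the infinitesimal gauge action is the gauge transformation by
`1 - τ a`. -/
theorem isGauge_dual (h : IsAdapted V f x e b deg If) {a : g} (ha : a ∈ above (piece F x) 1) :
    IsGauge (tensDer _ (tauDer F (Low deg)))
      (1 - TauExt.tau F (Polynomial (DiffPoly F (Low deg))) 1 ⊗ₜ[F]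
        LieModule.toEnd F g V a)
      (h.lax (fun i : Low deg => i.1) fun i => constDual F (Low deg) (var F i))
      (h.lax (fun i : Low deg => i.1)
        fun i => gaugeDual b (LieModule.traceForm F g V) deg f a (var F i)) := by
  have h1 := h.isGauge_infinitesimal ha (constDual F (Low deg)) (TauExt.tau F _)
    (δ := tauDer F (Low deg))
    (fun p => by rw [constDual_apply, TauExt.const_mul_tau, mul_one])
    TauExt.tau_mul_tau
    (by rw [TauExt.der_tau, mul_one, Derivation.map_one_eq_zero, add_zero])
  simpa only [gaugeDual, diffAeval_var] using h1

variable [FiniteDimensional F V] [LieModule.IsFaithful F g V]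

/-- The coefficients of a canonical form of `∂ + φ(f) + ∑ uᵢ Uⁱ` are annihilated by the
infinitesimal gauge action, by uniqueness of canonical forms over the dual numbers. -/
theorem mem_WAlg_of_isGauge (h : IsAdapted V f x e b deg If) {K : ℕ}
    (hK : filt (LieModule.toEnd F g V x) K = ⊥)
    {N N' : DiffPoly F (Low deg) ⊗[F] Module.End F V} {l : If → DiffPoly F (Low deg)}
    (h1 : N * N' = 1) (h2 : N' * N = 1)
    (hN : N - 1 ∈ tens ⊤ (filt (LieModule.toEnd F g V x) 1))
    (hN' : N' - 1 ∈ tens ⊤ (filt (LieModule.toEnd F g V x) 1))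
    (hg : IsGauge (tensDer _ (der F (Low deg))) N (h.lax (fun i : Low deg => i.1) (var F))
      (h.lax (fun i : If => i.1) l)) (i : If) :
    l i ∈ WAlg b (LieModule.traceForm F g V) deg f x 0 0 := by
  rw [mem_WAlg_iff]
  intro a ha
  have g0 := hg.baseMap (δ' := tauDer F (Low deg)) (h := constDual F (Low deg))
    constDual_der
  have g1 := hg.baseMap (δ' := tauDer F (Low deg))
    (h := gaugeDual b (LieModule.traceForm F g V) deg f a) (diffAeval_der _)
  rw [baseMap_lax, baseMap_lax] at g0 g1
  have g0' := g0.inv (tensDer_mul _) (tensDer_one _)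
    (N' := baseMap _ (constDual F (Low deg)) N') (by rw [← map_mul, h1, map_one])
    (by rw [← map_mul, h2, map_one])
  have g2 := (g0'.comp (tensDer_mul _) (h.isGauge_dual ha)).comp (tensDer_mul _) g1
  have hmul : ∀ a ∈ filt (LieModule.toEnd F g V x) 1, ∀ c ∈ filt (LieModule.toEnd F g V x) 1,
      a * c ∈ filt (LieModule.toEnd F g V x) 1 :=
    fun a ha c hc => filt_antitone _ (by norm_num) (mul_mem_filt ha hc)
  have heq := h.eq_of_isGauge hK (mul_sub_one_mem_tens hmul (baseMap_sub_one_mem _ hN)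
    (mul_sub_one_mem_tens hmul (one_sub_tmul_sub_one_mem _ (lieFilt_le_filt x 1 ⟨a, ha, rfl⟩))
      (baseMap_sub_one_mem _ hN'))) g2
  have := congrFun heq i
  rw [gaugeDual_apply b (LieModule.traceForm F g V) deg f h.traceForm_f, left_eq_add] at this
  exact TauExt.tau_injective (this.trans (map_zero _).symm)

/-- The coefficients of a canonical form of `∂ + φ(f) + ∑ uᵢ Uⁱ` project to the differential
variables of `V(g^f)`, since the image of this operator is already in canonical form. -/
theorem projCentralizer_of_isGauge (h : IsAdapted V f x e b deg If) {K : ℕ}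
    (hK : filt (LieModule.toEnd F g V x) K = ⊥)
    {N : DiffPoly F (Low deg) ⊗[F] Module.End F V} {l : If → DiffPoly F (Low deg)}
    (hN : N - 1 ∈ tens ⊤ (filt (LieModule.toEnd F g V x) 1))
    (hg : IsGauge (tensDer _ (der F (Low deg))) N (h.lax (fun i : Low deg => i.1) (var F))
      (h.lax (fun i : If => i.1) l)) (i : If) :
    projCentralizer F deg If (l i) = var F i := by
  classical
  have g1 := hg.baseMap (δ' := der F If) (projCentralizer_der deg If)
  rw [baseMap_lax, baseMap_lax] at g1
  let q : ι → DiffPoly F If := fun i => if hi : i ∈ If then var F (⟨i, hi⟩ : If) else 0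
  have e1 : (fun i : Low deg => projCentralizer F deg If (var F i)) = fun i => q i.1 := by
    funext i
    exact (diffAeval_var _ i).trans (by simp [q])
  have e2 : h.lax (fun i : Low deg => i.1) (fun i => q i.1) =
      h.lax (fun i : If => i.1) (var F) := by
    rw [h.lax_subtype (fun i => deg i ≤ 1) q fun i hi => dif_neg fun hi' => hi
      ((h.deg_nonpos hi').trans zero_le_one),
      ← h.lax_subtype (fun i => i ∈ If) q fun i hi => dif_neg hi]
    congr 1
    funext i
    simp [q]
  rw [e1, e2] at g1
  refine (congrFun (h.eq_of_isGauge hK ?_ g1) i).symm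
  exact baseMap_sub_one_mem _ hN

end IsAdapted

/-! ### Restriction of the projection to the W-algebra is injective -/

section Weight

variable {F σ : Type*} [Field F]

/-- The polynomials all of whose monomials have weight at least `n`. -/
def wtFilt (F : Type*) {σ : Type*} [Field F] (wt : σ → ℤ) (n : ℤ) :
    Submodule F (MvPolynomial σ F) where
  carrier := {p | ∀ m, Finsupp.weight wt m < n → p.coeff m = 0}
  zero_mem' := fun _ _ => MvPolynomial.coeff_zero _
  add_mem' := fun hp hq m hm => by rw [MvPolynomial.coeff_add, hp m hm, hq m hm, add_zero]
  smul_mem' := fun c p hp m hm => by rw [MvPolynomial.coeff_smul, hp m hm, smul_zero]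

theorem mul_mem_wtFilt {wt : σ → ℤ} {a b : ℤ} {p q : MvPolynomial σ F} (hp : p ∈ wtFilt F wt a)
    (hq : q ∈ wtFilt F wt b) : p * q ∈ wtFilt F wt (a + b) := by
  classical
  intro m hm
  rw [MvPolynomial.coeff_mul]
  refine Finset.sum_eq_zero fun z hz => ?_
  rw [← Finset.HasAntidiagonal.mem_antidiagonal.1 hz, map_add] at hm
  by_cases h : Finsupp.weight wt z.1 < a
  · rw [hp _ h, zero_mul]
  · rw [hq _ (by omega), mul_zero]

theorem monomial_mem_wtFilt {wt : σ → ℤ} {n : ℤ} {m : σ →₀ ℕ} (h : n ≤ Finsupp.weight wt m)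
    (r : F) : MvPolynomial.monomial m r ∈ wtFilt F wt n := by
  classical
  intro m' hm'
  rw [MvPolynomial.coeff_monomial, if_neg]
  rintro rfl
  omega

theorem C_mem_wtFilt {wt : σ → ℤ} {n : ℤ} (h : n ≤ 0) (r : F) :
    MvPolynomial.C r ∈ wtFilt F wt n :=
  monomial_mem_wtFilt (by rwa [map_zero]) r

theorem X_mem_wtFilt {wt : σ → ℤ} {n : ℤ} {i : σ} (h : n ≤ wt i) :
    MvPolynomial.X i ∈ wtFilt F wt n :=
  monomial_mem_wtFilt (by rwa [Finsupp.weight_single, one_smul]) 1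

theorem wtFilt_antitone (wt : σ → ℤ) : Antitone (wtFilt F wt) :=
  fun _ _ h _ hp m hm => hp m (hm.trans_le h)

/-- A derivation that raises the weights of the variables by at least `c` raises all weights by
at least `c`. -/
theorem map_mem_wtFilt {wt : σ → ℤ} {c : ℤ}
    (θ : Derivation F (MvPolynomial σ F) (MvPolynomial σ F))
    (hθ : ∀ i, θ (MvPolynomial.X i) ∈ wtFilt F wt (wt i + c)) {n : ℤ} {p : MvPolynomial σ F}
    (hp : p ∈ wtFilt F wt n) : θ p ∈ wtFilt F wt (n + c) := by
  classical
  have e : θ = MvPolynomial.mkDerivation F fun i => θ (MvPolynomial.X i) :=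
    MvPolynomial.derivation_ext fun i => by rw [MvPolynomial.mkDerivation_X]
  rw [← MvPolynomial.support_sum_monomial_coeff p, map_sum]
  refine Submodule.sum_mem _ fun m hm => ?_
  have hmn : n ≤ Finsupp.weight wt m :=
    not_lt.1 fun h => MvPolynomial.mem_support_iff.1 hm (hp m h)
  rw [e, MvPolynomial.mkDerivation_monomial]
  refine Submodule.smul_mem _ _ (Submodule.sum_mem _ fun i hi => ?_)
  have h1 := Finsupp.weight_sub_single_add (w := wt) (Finsupp.mem_support_iff.1 hi)
  exact wtFilt_antitone wt (by omega) (mul_mem_wtFilt (monomial_mem_wtFilt le_rfl _) (hθ i))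

end Weight

section DiffPoly

variable {F κ : Type*} [Field F]

/-- The weight of the `n`-th derivative of a differential variable is `n + 1`. -/
def derWt (κ : Type*) (p : κ × ℕ) : ℤ := p.2 + 1

theorem der_mem_wtFilt {n : ℤ} {p : DiffPoly F κ} (hp : p ∈ wtFilt F (derWt κ) n) :
    der F κ p ∈ wtFilt F (derWt κ) (n + 1) := by
  refine map_mem_wtFilt _ (fun i => ?_) hp
  rw [der_X]
  exact X_mem_wtFilt (by simp [derWt])

end DiffPoly

section Projection

variable {F ι : Type*} [Field F] (deg : ι → ℤ) (If : Finset ι)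

theorem exists_notMem_of_projCentralizer_eq_zero {w : DiffPoly F (Low deg)}
    (hw : projCentralizer F deg If w = 0) (hIf : ∀ i ∈ If, deg i ≤ 1)
    {m : (Low deg × ℕ) →₀ ℕ} (hm : m ∈ w.support) : ∃ p, p.1.1 ∉ If ∧ m p ≠ 0 := by
  classical
  set 𝒥 : Ideal (DiffPoly F (Low deg)) :=
    Ideal.span (MvPolynomial.X '' {p : Low deg × ℕ | p.1.1 ∉ If}) with h𝒥
  let σ : DiffPoly F If →ₐ[F] DiffPoly F (Low deg) :=
    diffAeval (der F (Low deg)) fun i : If => var F (⟨i.1, hIf i.1 i.2⟩ : Low deg)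
  have key : ((Ideal.Quotient.mkₐ F 𝒥).comp σ).comp (projCentralizer F deg If) =
      Ideal.Quotient.mkₐ F 𝒥 := by
    refine MvPolynomial.algHom_ext fun p => ?_
    rw [AlgHom.comp_apply, AlgHom.comp_apply, projCentralizer, diffAeval_X]
    by_cases hp : p.1.1 ∈ If
    · rw [dif_pos hp, iterate_der_var]
      simp only [σ]
      rw [diffAeval_X, iterate_der_var]
    · rw [dif_neg hp, PseudoDiffOp.iter_zero, map_zero, map_zero]
      exact (Ideal.Quotient.eq_zero_iff_mem.2 
        (Ideal.subset_span (Set.mem_image_of_mem _ hp))).symm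
  have h0 : Ideal.Quotient.mkₐ F 𝒥 w = 0 := by
    rw [← key, AlgHom.comp_apply, hw, map_zero]
  exact MvPolynomial.mem_ideal_span_X_image.1 (Ideal.Quotient.eq_zero_iff_mem.1 h0) m hm

end Projection

section GaugeCoeff

variable {F g ι : Type*} [Field F] [LieRing g] [LieAlgebra F g] [Fintype ι]
  (b : Module.Basis ι F g) (B : LinearMap.BilinForm F g) (deg : ι → ℤ) (f : g)

/-- The coefficient of `λᵏ` in the infinitesimal gauge action of `a`. -/
def gaugeCoeff (hf : ∀ i, deg i ≤ 1 → B f (b i) = 0) (a : g) (k : ℕ) :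
    Derivation F (DiffPoly F (Low deg)) (DiffPoly F (Low deg)) :=
  Derivation.mk'
    { toFun := fun w => (gaugeAction b B deg f a w).coeff k
      map_add' := fun v w => by rw [gaugeAction_add, Polynomial.coeff_add]
      map_smul' := fun c v => by rw [gaugeAction_smul, Polynomial.coeff_smul, RingHom.id_apply] }
    fun v w => by
      simp only [LinearMap.coe_mk, AddHom.coe_mk, gaugeAction_mul b B deg f hf,
        Polynomial.coeff_add, Polynomial.coeff_C_mul, smul_eq_mul]

theorem gaugeCoeff_apply (hf : ∀ i, deg i ≤ 1 → B f (b i) = 0) (a : g) (k : ℕ)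
    (w : DiffPoly F (Low deg)) :
    gaugeCoeff b B deg f hf a k w = (gaugeAction b B deg f a w).coeff k := rfl

theorem coeff_lambdaAdd {R : Type*} [CommRing R] [Algebra F R] (δ : Derivation F R R)
    (p : Polynomial R) (k : ℕ) : (lambdaAdd δ p).coeff k =
      (if k = 0 then 0 else p.coeff (k - 1)) + δ (p.coeff k) := by
  rw [lambdaAdd_eq, Polynomial.coeff_add, coeff_polyDer]
  cases k <;> simp

variable {b B deg f} in
/-- If `(f|[a, uᵢ]) = δᵢⱼ`, then, up to terms of higher weight, the coefficient of `λᵏ` in the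
infinitesimal gauge action of `a` is the partial derivative by the `k`-th derivative of `uⱼ`. -/
theorem gaugeAction_coeff_sub_mem {a : g} {j : Low deg} [DecidableEq ι]
    (ha : ∀ i, B f ⁅a, b i⁆ = if i = j.1 then 1 else 0) (i : Low deg) (n k : ℕ) :
    (gaugeAction b B deg f a (MvPolynomial.X (i, n))).coeff k -
      (if (i, n) = (j, k) then 1 else 0) ∈ wtFilt F (derWt (Low deg)) (n + 1 - k) := by
  rw [gaugeAction_X]
  dsimp only
  induction n generalizing k with
  | zero =>
    rw [Function.iterate_zero, id, gaugeAction_var, Polynomial.coeff_add, Polynomial.coeff_C_mul,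
      Polynomial.coeff_C, Polynomial.coeff_X]
    match k with
    | 0 =>
      have e : (if (i, 0) = (j, 0) then (1 : DiffPoly F (Low deg)) else 0) =
          MvPolynomial.C (B f ⁅a, b i.1⁆) := by
        rw [ha]
        by_cases h : i = j
        · simp [h]
        · simp [h, Subtype.coe_inj]
      rw [e, rho_gen]
      simp only [if_true, one_ne_zero, if_false, mul_zero, add_zero, add_sub_cancel_right]
      refine Submodule.sum_mem _ fun l _ => Submodule.smul_mem _ _ (X_mem_wtFilt ?_)
      simp [derWt]
    | 1 =>
      simp only [Prod.mk.injEq, zero_ne_one, and_false, if_false, one_ne_zero, if_true, mul_one,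
        zero_add, sub_zero]
      exact C_mem_wtFilt (by norm_num) _
    | k + 2 => simp
  | succ n ih =>
    rw [Function.iterate_succ_apply', coeff_lambdaAdd]
    have h1 : der F (Low deg)
        (((lambdaAdd (der F (Low deg)))^[n] (gaugeAction b B deg f a (var F i))).coeff k) ∈
        wtFilt F (derWt (Low deg)) ((n + 1 : ℕ) + 1 - k) := by
      have h2 := der_mem_wtFilt (ih k)
      have h3 : der F (Low deg) (if (i, n) = (j, k) then 1 else 0) = 0 := by
        split_ifs
        · exact Derivation.map_one_eq_zero _
        · exact map_zero _
      rw [map_sub, h3, sub_zero] at h2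
      exact wtFilt_antitone _ (by push_cast; omega) h2
    match k with
    | 0 => simpa using h1
    | k + 1 =>
      rw [if_neg k.succ_ne_zero, add_sub_right_comm (α := DiffPoly F (Low deg)), Nat.add_sub_cancel]
      refine add_mem ?_ h1
      have h2 := ih k
      simp only [Prod.mk.injEq, Nat.add_right_cancel_iff] at h2 ⊢
      exact wtFilt_antitone _ (by push_cast; omega) h2

end GaugeCoeff

namespace IsAdapted

variable {F g V ι : Type*} [Field F] [CharZero F] [LieRing g] [LieAlgebra F g]
  [AddCommGroup V] [Module F V] [LieRingModule g V] [LieModule F g V]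
  {f x e : g} {b : Module.Basis ι F g} {deg : ι → ℤ} {If : Finset ι} [Fintype ι]
  [FiniteDimensional F V] [LieModule.IsFaithful F g V]

/-- An element of the W-algebra whose projection vanishes is zero: a monomial of minimal weight
contains a derivative of some `uⱼ` outside `V(g^f)`, and the gauge action of `a ∈ g_{≥ 1/2}` with
`[f, a] = uʲ` does not annihilate it. -/
theorem eq_zero_of_projCentralizer_eq_zero (h : IsAdapted V f x e b deg If)
    {w : DiffPoly F (Low deg)} (hw : w ∈ WAlg b (LieModule.traceForm F g V) deg f x 0 0)
    (hπ : projCentralizer F deg If w = 0) : w = 0 := by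
  classical
  by_contra hne
  obtain ⟨m, hm, hmin⟩ := Finset.exists_min_image w.support (Finsupp.weight (derWt (Low deg)))
    (MvPolynomial.support_nonempty.2 hne)
  obtain ⟨⟨j, k⟩, hj, hmj⟩ := exists_notMem_of_projCentralizer_eq_zero deg If hπ
    (fun i hi => (h.deg_nonpos hi).trans zero_le_one) hm
  obtain ⟨a, ha, hfa⟩ := h.exists_lift hj
  set l := Finsupp.weight (derWt (Low deg)) m
  have hwl : w ∈ wtFilt F (derWt (Low deg)) l := fun m' hm' => by
    by_contra hc
    exact absurd (hmin m' (MvPolynomial.mem_support_iff.2 hc)) (not_le.2 hm')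
  have hact : gaugeAction b (LieModule.traceForm F g V) deg f a w = 0 :=
    mem_WAlg_iff b _ deg f |>.1 hw a
      (le_above (P := piece F x) (by have := j.2; omega : (1 : ℤ) ≤ 2 - deg j.1) ha)
  have hθ := map_mem_wtFilt (c := -k)
    (gaugeCoeff b (LieModule.traceForm F g V) deg f h.traceForm_f a k -
      MvPolynomial.pderiv (j, k)) (fun p => ?_) hwl
  · rw [Derivation.sub_apply, gaugeCoeff_apply, hact, Polynomial.coeff_zero, zero_sub] at hθ
    have hsub := Finsupp.weight_sub_single_add (w := derWt (Low deg)) hmj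
    have h1 := hθ (m - Finsupp.single (j, k) 1) (by
      simp only [derWt] at hsub
      omega)
    rw [MvPolynomial.coeff_neg, MvPolynomial.coeff_pderiv,
      tsub_add_cancel_of_le (Finsupp.single_le_iff.2 (Nat.one_le_iff_ne_zero.2 hmj))] at h1
    refine (mul_ne_zero (MvPolynomial.mem_support_iff.1 hm) ?_) (neg_eq_zero.1 h1)
    exact Nat.cast_add_one_ne_zero _
  · rw [Derivation.sub_apply, gaugeCoeff_apply, MvPolynomial.pderiv_X]
    have h2 := gaugeAction_coeff_sub_mem (b := b) (B := LieModule.traceForm F g V) (f := f)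
      (a := a) (j := j) (fun i => ?_) p.1 p.2 k
    · rw [Pi.single_apply]
      exact h2
    · rw [← LieModule.traceForm_apply_lie_apply, hfa, h.traceForm_dual_left, b.repr_self,
        Finsupp.single_apply]

end IsAdapted

/-! ### Quasideterminants under homomorphisms and gauge transformations -/

section Functoriality

variable {F : Type*} [Field F] {Ψ Ψ' : Type*} [Ring Ψ] [Algebra F Ψ] [Ring Ψ'] [Algebra F Ψ']
  {V V' : Type*} [AddCommGroup V] [Module F V] [AddCommGroup V'] [Module F V']

theorem sandwich_baseMap (Φ : Ψ →ₐ[F] Ψ') (J : V →ₗ[F] V') (I : V' →ₗ[F] V)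
    (A : Ψ ⊗[F] Module.End F V) :
    sandwich J I (baseMap _ Φ A) = baseMap _ Φ (sandwich J I A) := by
  induction A with
  | zero => simp only [map_zero]
  | add x y hx hy => simp only [map_add, hx, hy]
  | tmul ψ a => rw [baseMap_tmul, sandwich_tmul, sandwich_tmul, baseMap_tmul]

theorem inverse_map {S S' : Type*} [Ring S] [Algebra F S] [Ring S'] [Algebra F S']
    (h : S →ₐ[F] S') {a : S} (ha : IsUnit a) :
    Ring.inverse (h a) = h (Ring.inverse a) :=
  inverse_eq_of_mul_eq_one (by rw [← map_mul, Ring.mul_inverse_cancel a ha, map_one])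
    (by rw [← map_mul, Ring.inverse_mul_cancel a ha, map_one])

theorem sandwich_inverse_baseMap (Φ : Ψ →ₐ[F] Ψ') (J : V →ₗ[F] V') (I : V' →ₗ[F] V)
    {A : Ψ ⊗[F] Module.End F V} (hA : IsUnit A) :
    sandwich J I (Ring.inverse (baseMap _ Φ A)) =
      baseMap _ Φ (sandwich J I (Ring.inverse A)) := by
  rw [← sandwich_baseMap]
  exact congrArg _ (inverse_map (baseMap _ Φ) hA)

theorem QuasidetExists.baseMap (Φ : Ψ →ₐ[F] Ψ') {J : V →ₗ[F] V'} {I : V' →ₗ[F] V}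
    {A : Ψ ⊗[F] Module.End F V} (h : QuasidetExists J I A) :
    QuasidetExists J I (ClassicalW.baseMap _ Φ A) :=
  ⟨h.1.map _, by rw [sandwich_inverse_baseMap Φ J I h.1]; exact h.2.map _⟩

theorem QuasidetExists.quasidet_baseMap (Φ : Ψ →ₐ[F] Ψ') {J : V →ₗ[F] V'} {I : V' →ₗ[F] V}
    {A : Ψ ⊗[F] Module.End F V} (h : QuasidetExists J I A) :
    quasidet J I (ClassicalW.baseMap _ Φ A) = ClassicalW.baseMap _ Φ (quasidet J I A) := by
  rw [quasidet, sandwich_inverse_baseMap Φ J I h.1]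
  exact inverse_map (ClassicalW.baseMap _ Φ) h.2

end Functoriality

section Gauge

variable {F : Type*} [Field F] [CharZero F] {V : Type*} [AddCommGroup V] [Module F V]

theorem mem_filt_of_mem_endPiece {X T : Module.End F V} {D : ℕ} (hT : T ∈ endPiece X (D : F)) :
    T ∈ filt X (2 * D) := by
  refine endPiece_le_filt X le_rfl ?_
  simpa using hT

/-- `J` annihilates the values of endomorphisms of positive degree. -/
theorem sandwich_mul_eq_zero_left {X T : Module.End F V} {D : ℕ} (hbot : filt X (2 * D + 1) = ⊥)
    (hT : T ∈ endPiece X (D : F)) {Ψ : Type*} [Ring Ψ] [Algebra F Ψ]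
    {y : Ψ ⊗[F] Module.End F V} (hy : y ∈ tens ⊤ (filt X 1)) (z : Ψ ⊗[F] Module.End F V) :
    sandwich T.rangeRestrict (LinearMap.range T).subtype (y * z) = 0 := by
  suffices h : y * z ∈ LinearMap.ker (sandwich T.rangeRestrict (LinearMap.range T).subtype) from h
  induction z with
  | zero => simp
  | add z z' hz hz' => rw [mul_add]; exact add_mem hz hz'
  | tmul ψ c =>
    refine (tens_le (S := (LinearMap.ker
      (sandwich T.rangeRestrict (LinearMap.range T).subtype)).comap
        (LinearMap.mulRight F (ψ ⊗ₜ[F] c)))).2 (fun ψ' _ a ha => ?_) hy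
    have h0 : T * a = 0 := by
      have := mul_mem_filt (mem_filt_of_mem_endPiece hT) ha
      rwa [hbot, Submodule.mem_bot] at this
    rw [Submodule.mem_comap, LinearMap.mulRight_apply, Algebra.TensorProduct.tmul_mul_tmul,
      LinearMap.mem_ker, sandwich_tmul]
    have h1 : T.rangeRestrict ∘ₗ (a * c) ∘ₗ (LinearMap.range T).subtype = 0 := by
      ext v
      exact LinearMap.congr_fun h0 (c v)
    exact (congrArg _ h1).trans (TensorProduct.tmul_zero _ _)

/-- Endomorphisms of positive degree annihilate the image of `I`. -/
theorem sandwich_mul_eq_zero_right {X T : Module.End F V} {D : ℕ} (hbot : filt X (2 * D + 1) = ⊥)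
    (hT : T ∈ endPiece X (D : F)) {Ψ : Type*} [Ring Ψ] [Algebra F Ψ]
    {y : Ψ ⊗[F] Module.End F V} (hy : y ∈ tens ⊤ (filt X 1)) (z : Ψ ⊗[F] Module.End F V) :
    sandwich T.rangeRestrict (LinearMap.range T).subtype (z * y) = 0 := by
  suffices h : z * y ∈ LinearMap.ker (sandwich T.rangeRestrict (LinearMap.range T).subtype) from h
  induction z with
  | zero => simp
  | add z z' hz hz' => rw [add_mul]; exact add_mem hz hz'
  | tmul ψ c =>
    refine (tens_le (S := (LinearMap.ker
      (sandwich T.rangeRestrict (LinearMap.range T).subtype)).comap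
        (LinearMap.mulLeft F (ψ ⊗ₜ[F] c)))).2 (fun ψ' _ a ha => ?_) hy
    have h0 : a * T = 0 := by
      have := mul_mem_filt ha (mem_filt_of_mem_endPiece hT)
      rwa [add_comm, hbot, Submodule.mem_bot] at this
    rw [Submodule.mem_comap, LinearMap.mulLeft_apply, Algebra.TensorProduct.tmul_mul_tmul,
      LinearMap.mem_ker, sandwich_tmul]
    have h1 : T.rangeRestrict ∘ₗ (c * a) ∘ₗ (LinearMap.range T).subtype = 0 := by
      ext ⟨_, v, rfl⟩
      have h2 : a (T v) = 0 := LinearMap.congr_fun h0 v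
      simp [h2]
    exact (congrArg _ h1).trans (TensorProduct.tmul_zero _ _)

/-- Gauge transformations by operators `1 + (positive degree)` do not change the
`(I, J)`-quasideterminant. -/
theorem quasidet_eq_of_isGauge {X T : Module.End F V} {D : ℕ} (hbot : filt X (2 * D + 1) = ⊥)
    (hT : T ∈ endPiece X (D : F)) {R : Type*} [CommRing R] [Algebra F R] {δ : Derivation F R R}
    {N N' L L' : R ⊗[F] Module.End F V} (h1 : N * N' = 1) (h2 : N' * N = 1)
    (hN : N - 1 ∈ tens ⊤ (filt X 1)) (hN' : N' - 1 ∈ tens ⊤ (filt X 1))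
    (hg : IsGauge (tensDer _ δ) N L L')
    (h : QuasidetExists T.rangeRestrict (LinearMap.range T).subtype
      (PseudoDiffOp.monomial δ 1 1 ⊗ₜ[F] 1 + constLift δ _ L')) :
    QuasidetExists T.rangeRestrict (LinearMap.range T).subtype
        (PseudoDiffOp.monomial δ 1 1 ⊗ₜ[F] 1 + constLift δ _ L) ∧
      quasidet T.rangeRestrict (LinearMap.range T).subtype
        (PseudoDiffOp.monomial δ 1 1 ⊗ₜ[F] 1 + constLift δ _ L) =
      quasidet T.rangeRestrict (LinearMap.range T).subtype
        (PseudoDiffOp.monomial δ 1 1 ⊗ₜ[F] 1 + constLift δ _ L') := by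
  have key : (PseudoDiffOp.monomial δ 1 1 ⊗ₜ[F] 1 + constLift δ _ L') * constLift δ _ N =
      constLift δ _ N * (PseudoDiffOp.monomial δ 1 1 ⊗ₜ[F] 1 + constLift δ _ L) := by
    have hg' : tensDer _ δ N = N * L - L' * N := hg.symm
    rw [add_mul, partial_mul_constLift, hg', map_sub, map_mul, map_mul, mul_add]
    abel
  have hn1 : constLift δ _ N * constLift δ _ N' = 1 := by rw [← map_mul, h1, map_one]
  have hn2 : constLift δ _ N' * constLift δ _ N = 1 := by rw [← map_mul, h2, map_one]
  have hm : constLift δ _ N - 1 ∈ tens ⊤ (filt X 1) := by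
    rw [← map_one (constLift δ _), ← map_sub]
    exact baseMap_mem_tens_top _ hN
  have hm' : constLift δ _ N' - 1 ∈ tens ⊤ (filt X 1) := by
    rw [← map_one (constLift δ _), ← map_sub]
    exact baseMap_mem_tens_top _ hN'
  generalize PseudoDiffOp.monomial δ 1 1 ⊗ₜ[F] 1 + constLift δ _ L' = A' at *
  generalize PseudoDiffOp.monomial δ 1 1 ⊗ₜ[F] 1 + constLift δ _ L = A at *
  generalize constLift δ _ N = n at *
  generalize constLift δ _ N' = n' at *
  have hA : A = n' * A' * n := by rw [mul_assoc, key, ← mul_assoc, hn2, one_mul]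
  set Y := Ring.inverse A'
  have hY1 : A' * Y = 1 := Ring.mul_inverse_cancel _ h.1
  have hY2 : Y * A' = 1 := Ring.inverse_mul_cancel _ h.1
  have hr1 : A * (n' * Y * n) = 1 := by
    rw [hA, show n' * A' * n * (n' * Y * n) = n' * (A' * ((n * n') * Y)) * n by
      simp only [mul_assoc], hn1, one_mul, hY1, mul_one, hn2]
  have hr2 : (n' * Y * n) * A = 1 := by
    rw [hA, show n' * Y * n * (n' * A' * n) = n' * (Y * ((n * n') * A')) * n by
      simp only [mul_assoc], hn1, one_mul, hY2, mul_one, hn2]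
  have hs : sandwich T.rangeRestrict (LinearMap.range T).subtype (Ring.inverse A) =
      sandwich T.rangeRestrict (LinearMap.range T).subtype Y := by
    have e : n' * Y * n = Y + (n' - 1) * (Y * n) + Y * (n - 1) := by
      simp only [sub_mul, mul_sub, one_mul, mul_one, mul_assoc]
      abel
    rw [inverse_eq_of_mul_eq_one hr1 hr2, e, map_add, map_add,
      sandwich_mul_eq_zero_left hbot hT hm', sandwich_mul_eq_zero_right hbot hT hm, add_zero,
      add_zero]
  refine ⟨⟨⟨⟨A, n' * Y * n, hr1, hr2⟩, rfl⟩, ?_⟩, ?_⟩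
  · rw [hs]
    exact h.2
  · rw [quasidet, hs, quasidet]

end Gauge

section Restrict

variable {F R : Type*} [Field F] [CommRing R] [Algebra F R]

/-- The restriction of a derivation to a stable subalgebra. -/
def restrictDer (δ : Derivation F R R) (W : Subalgebra F R) (hW : ∀ w ∈ W, δ w ∈ W) :
    Derivation F W W :=
  Derivation.mk' ((δ : R →ₗ[F] R).restrict (p := Subalgebra.toSubmodule W)
      (q := Subalgebra.toSubmodule W) hW)
    fun a b => Subtype.ext (δ.leibniz a.1 b.1)

theorem coe_restrictDer (δ : Derivation F R R) (W : Subalgebra F R) (hW : ∀ w ∈ W, δ w ∈ W)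
    (w : W) : W.val (restrictDer δ W hW w) = δ (W.val w) := rfl

theorem baseMap_map_val_mem_range {E : Type*} [Ring E] [Algebra F E] {δ : Derivation F R R}
    {W : Subalgebra F R} (hW : ∀ w ∈ W, δ w ∈ W)
    (A : PseudoDiffOp (restrictDer δ W hW) ⊗[F] E) :
    baseMap E (PseudoDiffOp.map W.val (coe_restrictDer δ W hW)) A ∈
      LinearMap.range (LinearMap.rTensor E (PseudoDiffOp.coeffsIn δ W).subtype) := by
  induction A with
  | zero => rw [map_zero]; exact zero_mem _
  | add x y hx hy => rw [map_add]; exact add_mem hx hy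
  | tmul a u =>
    rw [baseMap_tmul]
    exact ⟨(⟨PseudoDiffOp.map W.val (coe_restrictDer δ W hW) a, fun n => (a.coeff n).2⟩ :
      PseudoDiffOp.coeffsIn δ W) ⊗ₜ u, LinearMap.rTensor_tmul ..⟩

theorem baseMap_map_firstOrder {R' : Type*} [CommRing R'] [Algebra F R'] {δ : Derivation F R R}
    {δ' : Derivation F R' R'} (h : R →ₐ[F] R') (hδ : ∀ a, h (δ a) = δ' (h a))
    {V : Type*} [AddCommGroup V] [Module F V] (M : Module.End F V) {κ : Type*} [Fintype κ]
    (a : κ → R) (N : κ → Module.End F V) :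
    baseMap _ (PseudoDiffOp.map h hδ) (firstOrder δ M a N) =
      firstOrder δ' M (fun i => h (a i)) N := by
  simp only [firstOrder, map_add, map_sum, baseMap_tmul, PseudoDiffOp.map_monomial, map_one]

end Restrict

/-! ### The W-algebra and its generators -/

section Stable

variable {F g ι : Type*} [Field F] [LieRing g] [LieAlgebra F g] [Fintype ι]
  {b : Module.Basis ι F g} {B : LinearMap.BilinForm F g} {deg : ι → ℤ} {f : g}

theorem der_mem_WAlg {x : g} (hf : ∀ i, deg i ≤ 1 → B f (b i) = 0) {w : DiffPoly F (Low deg)}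
    (hw : w ∈ WAlg b B deg f x 0 0) : der F _ w ∈ WAlg b B deg f x 0 0 := by
  rw [mem_WAlg_iff] at hw ⊢
  intro a ha
  rw [gaugeAction_der b B deg f hf, hw a ha, lambdaAdd_eq, mul_zero, map_zero, add_zero]

/-- The bracket `{a_λ ·}_ε` does not depend on `ε` if `[s, a] = 0`. -/
theorem lambdaBracket_eq (s : g) (ε : F) {a : g} (h : ∀ c, B s ⁅a, c⁆ = 0) :
    lambdaBracket b B s ε a = lambdaBracket b B 0 0 a := by
  unfold lambdaBracket
  congr 1
  funext p
  rw [h, zero_mul, mul_zero]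

end Stable

theorem IsTriple.filt_eq_bot {F g V : Type*} [Field F] [CharZero F] [LieRing g] [LieAlgebra F g]
    [AddCommGroup V] [Module F V] [FiniteDimensional F V] [LieRingModule g V] [LieModule F g V]
    {f x e : g} (h : IsTriple f x e) :
    filt (LieModule.toEnd F g V x)
      (2 * (nilpotencyClass (LieModule.toEnd F g V f) - 1 : ℕ) + 1) = ⊥ :=
  eq_bot_iff.2 (above_le.2 fun _ hm =>
    (endPiece_eq_bot h h.pow_toEnd_f_eq_zero (by omega)).le)

namespace IsAdapted

variable {F g V ι : Type*} [Field F] [LieRing g] [LieAlgebra F g]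
  [AddCommGroup V] [Module F V] [LieRingModule g V] [LieModule F g V]
  {f x e : g} {b : Module.Basis ι F g} {deg : ι → ℤ} {If : Finset ι} [Fintype ι]

theorem firstOrder_eq_lax (h : IsAdapted V f x e b deg If) {R : Type*} [CommRing R] [Algebra F R]
    (δ : Derivation F R R) {κ : Type*} [Fintype κ] (j : κ → ι) (q : κ → R)
    (M : Module.End F V) :
    firstOrder δ (LieModule.toEnd F g V f + M) q (fun i => h.U (j i)) =
      PseudoDiffOp.monomial δ 1 1 ⊗ₜ[F] 1 + constLift δ _ (h.lax j q + 1 ⊗ₜ M) := by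
  rw [firstOrder_eq, TensorProduct.tmul_add, lax, add_right_comm]

variable [CharZero F]

theorem bddAbove_pieces (h : IsAdapted V f x e b deg If) :
    BddAbove {n : ℤ | piece F x n ≠ ⊥} := by
  refine ((Set.finite_range fun i => -deg i).subset fun n hn => ?_).bddAbove
  obtain ⟨a, ha, ha0⟩ := Submodule.exists_mem_ne_zero_of_ne_bot hn
  obtain ⟨i, hi⟩ := h.exists_eq_deg ha ha0
  exact ⟨i, by dsimp only; omega⟩

theorem lie_eq_zero_of_mem_twiceDepth (h : IsAdapted V f x e b deg If) {s : g}
    (hs : s ∈ piece F x (twiceDepth F x)) {a : g} (ha : a ∈ above (piece F x) 1) :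
    ⁅s, a⁆ = 0 := by
  have h1 := lie_mem_above (le_above (P := piece F x) le_rfl hs) ha
  have h2 : above (piece F x) (twiceDepth F x + 1) = ⊥ := by
    refine eq_bot_iff.2 (above_le.2 fun m hm => ?_)
    by_contra hne
    have : m ≤ twiceDepth F x := le_csSup h.bddAbove_pieces fun h0 => hne h0.le
    omega
  rwa [h2, Submodule.mem_bot] at h1

theorem WAlg_eq (h : IsAdapted V f x e b deg If) {s : g}
    (hs : s ∈ piece F x (twiceDepth F x)) (ε : F) :
    WAlg b (LieModule.traceForm F g V) deg f x s ε =
      WAlg b (LieModule.traceForm F g V) deg f x 0 0 := by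
  have key : ∀ a ∈ above (piece F x) 1, lambdaBracket b (LieModule.traceForm F g V) s ε a =
      lambdaBracket b (LieModule.traceForm F g V) 0 0 a := fun a ha =>
    lambdaBracket_eq s ε fun c => by
      rw [← LieModule.traceForm_apply_lie_apply, h.lie_eq_zero_of_mem_twiceDepth hs ha, map_zero,
        LinearMap.zero_apply]
  ext w
  exact forall₂_congr fun a ha => by rw [key a ha]

/-- The largest eigenvalue of `ad x` is not negative, as the spectrum of `ad x` is symmetric. -/
theorem toEnd_mem_filt_of_mem_twiceDepth (h : IsAdapted V f x e b deg If) {s : g}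
    (hs : s ∈ piece F x (twiceDepth F x)) :
    LieModule.toEnd F g V s ∈ filt (LieModule.toEnd F g V x) (-1) := by
  by_cases hs0 : s = 0
  · rw [hs0, map_zero]
    exact zero_mem _
  obtain ⟨i, hi⟩ := h.exists_eq_deg hs hs0
  have h1 : deg i ≤ twiceDepth F x := le_csSup h.bddAbove_pieces fun h0 =>
    b.ne_zero i ((Submodule.mem_bot F).1 (h0 ▸ h.mem_piece i))
  exact endPiece_le_filt _ (by omega) (toEnd_mem_endPiece hs)

variable [FiniteDimensional F V]

theorem quasidetExists_firstOrder (h : IsAdapted V f x e b deg If) {R : Type*} [CommRing R]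
    [Algebra F R] (δ : Derivation F R R) {κ : Type*} [Fintype κ] {j : κ → ι}
    (hj : ∀ k, deg (j k) ≤ 1) (q : κ → R) {M : Module.End F V}
    (hM : M ∈ filt (LieModule.toEnd F g V x) (-1)) {T : Module.End F V} {D : ℕ}
    (hbot : filt (LieModule.toEnd F g V x) (2 * D + 1) = ⊥)
    (hT : T ∈ endPiece (LieModule.toEnd F g V x) (D : F))
    (hc : IsCompl (LinearMap.ker T) ((LinearMap.range T).map (LieModule.toEnd F g V f ^ D))) :
    QuasidetExists T.rangeRestrict (LinearMap.range T).subtype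
      (firstOrder δ (LieModule.toEnd F g V f + M) q fun i => h.U (j i)) := by
  rw [h.firstOrder_eq_lax, lax, add_assoc]
  refine quasidetExists hbot ?_ hT hc (add_mem (Submodule.sum_mem _ fun k _ => ?_)
    (tmul_mem_tens trivial hM))
  · exact endPiece_le_filt _ le_rfl (toEnd_mem_endPiece h.triple.f_mem)
  · exact tmul_mem_tens trivial (filt_antitone _ (by have := hj k; omega) (h.U_mem (j k)))

/-- The canonical form of `∂ + φ(f) + ∑ uᵢ Uⁱ`, with a gauge transformation that commutes with the
action of `g_d`. -/
theorem exists_canonical_form (h : IsAdapted V f x e b deg If) :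
    ∃ N N' : DiffPoly F (Low deg) ⊗[F] Module.End F V, ∃ l : If → DiffPoly F (Low deg),
      N * N' = 1 ∧ N' * N = 1 ∧
      N - 1 ∈ tens ⊤ (filt (LieModule.toEnd F g V x) 1) ∧
      N' - 1 ∈ tens ⊤ (filt (LieModule.toEnd F g V x) 1) ∧
      (∀ s ∈ piece F x (twiceDepth F x),
        Commute N (1 ⊗ₜ LieModule.toEnd F g V s)) ∧
      IsGauge (tensDer _ (der F (Low deg))) N (h.lax (fun i : Low deg => i.1) (var F))
        (h.lax (fun i : If => i.1) l) := by
  let C : Subalgebra F (Module.End F V) := Subalgebra.centralizer F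
    (LieModule.toEnd F g V '' {s : g | s ∈ piece F x (twiceDepth F x)})
  have hle : lieFilt F V x 1 ≤ Subalgebra.toSubmodule C := by
    rintro _ ⟨a, ha, rfl⟩
    refine (Subalgebra.mem_centralizer_iff F).2 ?_
    rintro _ ⟨s, hs, rfl⟩
    rw [← sub_eq_zero]
    refine (toEnd_lie s a).symm.trans ?_
    rw [h.lie_eq_zero_of_mem_twiceDepth hs ha, map_zero]
  obtain ⟨N, N', l, h1, h2, hN, hN', hg⟩ := h.exists_gauge (der F (Low deg))
    (K := 2 * (nilpotencyClass (LieModule.toEnd F g V f) - 1 : ℕ) + 1)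
    (by exact_mod_cast h.triple.filt_eq_bot)
    (𝒦 := filt (LieModule.toEnd F g V x) 1 ⊓ Subalgebra.toSubmodule C)
    (fun a ha c hc => ⟨filt_antitone _ (by norm_num) (mul_mem_filt ha.1 hc.1),
      C.mul_mem ha.2 hc.2⟩)
    (le_inf (lieFilt_le_filt x 1) hle) (var F)
  refine ⟨N, N', l, h1, h2, tens_mono le_rfl inf_le_left hN, tens_mono le_rfl inf_le_left hN',
    fun s hs => ?_, hg⟩
  have h3 : tens ⊤ (filt (LieModule.toEnd F g V x) 1 ⊓ Subalgebra.toSubmodule C) ≤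
      Subalgebra.toSubmodule (Subalgebra.centralizer F
        {(1 : DiffPoly F (Low deg)) ⊗ₜ[F] LieModule.toEnd F g V s}) := by
    refine tens_le.2 fun r _ a ha => ?_
    refine Subalgebra.mem_centralizer_iff F |>.2 fun y hy => ?_
    rw [Set.mem_singleton_iff.1 hy, Algebra.TensorProduct.tmul_mul_tmul,
      Algebra.TensorProduct.tmul_mul_tmul, one_mul, mul_one,
      (Subalgebra.mem_centralizer_iff F).1 ha.2 _ ⟨s, hs, rfl⟩]
  have h4 := (Subalgebra.mem_centralizer_iff F).1 (h3 hN) _ rfl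
  rw [← sub_add_cancel N 1]
  exact Commute.add_left (Eq.symm h4) (Commute.one_left _)

variable [LieModule.IsFaithful F g V]

/-- Elements `l i` of the W-algebra that project to the differential variables of `V(g^f)` are free
generators of the W-algebra. -/
theorem exists_algEquiv (h : IsAdapted V f x e b deg If) {l : If → DiffPoly F (Low deg)}
    (hl : ∀ i, l i ∈ WAlg b (LieModule.traceForm F g V) deg f x 0 0)
    (hπ : ∀ i, projCentralizer F deg If (l i) = var F i) :
    ∃ w : DiffPoly F If ≃ₐ[F] WAlg b (LieModule.traceForm F g V) deg f x 0 0,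
      (∀ p, (w (der F If p) : DiffPoly F (Low deg)) = der F (Low deg) (w p)) ∧
      (∀ p, projCentralizer F deg If (w p) = p) ∧
      ∀ i, (w (var F i) : DiffPoly F (Low deg)) = l i := by
  set W := WAlg b (LieModule.traceForm F g V) deg f x 0 0
  let δ := restrictDer (der F (Low deg)) W fun w hw => der_mem_WAlg h.traceForm_f hw
  let ψ : DiffPoly F If →ₐ[F] W := diffAeval δ fun i => ⟨l i, hl i⟩
  have hψδ : ∀ p, (ψ (der F If p) : DiffPoly F (Low deg)) = der F (Low deg) (ψ p) := fun p => by
    simp only [ψ]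
    rw [diffAeval_der]
    rfl
  have hψl : ∀ i, (ψ (var F i) : DiffPoly F (Low deg)) = l i := fun i => by
    simp only [ψ]
    rw [diffAeval_var]
  have hψ : ∀ p, ((projCentralizer F deg If).comp W.val) (ψ p) = p := by
    have h1 := eq_diffAeval (h := ((projCentralizer F deg If).comp W.val).comp ψ)
      (δ := der F If) fun p => by
        simp only [AlgHom.comp_apply, ψ]
        rw [diffAeval_der, coe_restrictDer, projCentralizer_der]
    have h2 := eq_diffAeval (h := AlgHom.id F (DiffPoly F If)) (δ := der F If) fun p => rfl
    intro p
    refine (congrArg (· p) (congrArg DFunLike.coe (h1.trans (Eq.trans ?_ h2.symm))) :)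
    congr 1
    funext i
    simp only [AlgHom.comp_apply, ψ, diffAeval_var]
    exact hπ i
  refine ⟨AlgEquiv.ofBijective ψ ⟨Function.LeftInverse.injective hψ, fun v =>
    ⟨projCentralizer F deg If v, ?_⟩⟩, fun p => ?_, hψ, fun i => ?_⟩
  · refine Subtype.ext (sub_eq_zero.1 (h.eq_zero_of_projCentralizer_eq_zero
      (sub_mem (ψ (projCentralizer F deg If v)).2 v.2) ?_))
    rw [map_sub]
    exact sub_eq_zero.2 (hψ _)
  · exact hψδ p
  · exact hψl i

end IsAdapted

end ClassicalW

end

theorem mainTheorem1 {F : Type*} [Field F] [CharZero F]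
    {g : Type*} [LieRing g] [LieAlgebra F g] (hred : IsReductive F g)
    {V : Type*} [AddCommGroup V] [Module F V] [FiniteDimensional F V]
    [LieRingModule g V] [LieModule F g V] [LieModule.IsFaithful F g V]
    (hB : (LieModule.traceForm F g V).Nondegenerate)
    {f x e : g} (htriple : IsTriple f x e)
    -- a basis of `g` adapted to the `ad x`-grading and containing a basis of the centralizer of `f`
    {ι : Type*} [Fintype ι] [DecidableEq ι] (b : Module.Basis ι F g)
    (deg : ι → ℤ) (hdeg : ∀ i, b i ∈ piece F x (deg i))
    (If : Finset ι) (hIf : Submodule.span F (b '' If) = LinearMap.ker (LieAlgebra.ad F g f)) :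
    let φ := LieModule.toEnd F g V
    let B := LieModule.traceForm F g V
    let u' := B.dualBasis hB b
    -- `W(g, f)`
    let W := WAlg b B deg f x 0 0
    let D : ℕ := nilpotencyClass (φ f) - 1
    -- the differential algebra isomorphism `w : V(g^f) → W(g, f)` inverse to the projection
    ∃ w : DiffPoly F If ≃ₐ[F] W,
      (∀ p, (w (der F If p) : DiffPoly F (Low deg)) = der F (Low deg) (w p)) ∧
      (∀ p, projCentralizer F deg If (w p) = p) ∧
      ∀ s ∈ piece F x (twiceDepth F x), ∀ ε : F,
        WAlg b B deg f x s ε = W ∧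
        ∀ T ∈ endPiece (φ x) (D : F),
          IsCompl (LinearMap.ker T) ((LinearMap.range T).map (φ f ^ D)) →
          let J := T.rangeRestrict
          let I := (LinearMap.range T).subtype
          -- `∂ + F + ∑_{i ∈ I_{≤ 1/2}} uᵢ Uⁱ + ε S`
          let A := firstOrder (der F (Low deg)) (φ f + ε • φ s)
            (fun i : Low deg => var F i) (fun i => φ (u' i))
          -- `∂ + F + ∑_{i ∈ I_f} wᵢ Uⁱ + ε S`
          let A' := firstOrder (der F (Low deg)) (φ f + ε • φ s)
            (fun i : If => (w (var F i) : DiffPoly F (Low deg))) (fun i => φ (u' i))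
          QuasidetExists J I A ∧
          quasidet J I A ∈ LinearMap.range (LinearMap.rTensor (Module.End F (LinearMap.range T))
            (PseudoDiffOp.coeffsIn (der F (Low deg)) W).subtype) ∧
          QuasidetExists J I A' ∧
          quasidet J I A = quasidet J I A' := by
  intro φ B u' W D
  have h : IsAdapted V f x e b deg If := ⟨htriple, hB, hdeg, hIf⟩
  -- the canonical form of `∂ + φ(f) + ∑ uᵢ Uⁱ` provides the generators
  have hbot := htriple.filt_eq_bot (F := F) (V := V)
  have hU : ∀ i, φ (u' i) = h.U i := fun i => by rw [IsAdapted.U, h.dual_eq]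
  obtain ⟨N, N', l, h1, h2, hN, hN', hcomm, hg⟩ := h.exists_canonical_form
  have hK : filt (LieModule.toEnd F g V x) ((2 * D + 1 : ℕ) : ℤ) = ⊥ := by exact_mod_cast hbot
  have hl := h.mem_WAlg_of_isGauge hK h1 h2 hN hN' hg
  obtain ⟨w, hw, hwπ, hwl⟩ := h.exists_algEquiv hl (h.projCentralizer_of_isGauge hK hN hg)
  refine ⟨w, hw, hwπ, fun s hs ε => ⟨h.WAlg_eq hs ε, fun T hT hc => ?_⟩⟩
  intro J I A A'
  have hM := Submodule.smul_mem _ ε (h.toEnd_mem_filt_of_mem_twiceDepth hs)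
  have hW : ∀ w ∈ W, der F (Low deg) w ∈ W := fun w hw => der_mem_WAlg h.traceForm_f hw
  -- the operator `A'` is defined over the W-algebra
  have hex := h.quasidetExists_firstOrder (restrictDer (der F (Low deg)) W hW)
    (fun k : If => (h.deg_nonpos k.2).trans zero_le_one) (fun i => ⟨l i, hl i⟩) hM hbot hT hc
  have hA' : A' = baseMap _ (PseudoDiffOp.map W.val (coe_restrictDer (der F (Low deg)) W hW))
      (firstOrder (restrictDer (der F (Low deg)) W hW) (φ f + ε • φ s)
        (fun i : If => (⟨l i, hl i⟩ : W)) fun i => h.U i.1) := by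
    rw [baseMap_map_firstOrder]
    simp only [A', hwl, hU]
    rfl
  have hexA' : QuasidetExists J I A' := hA' ▸ hex.baseMap _
  -- the gauge transformation from `A` to `A'`
  have hgS : IsGauge (tensDer _ (der F (Low deg))) N
      (h.lax (fun i : Low deg => i.1) (var F) + 1 ⊗ₜ (ε • φ s))
      (h.lax (fun i : If => i.1) l + 1 ⊗ₜ (ε • φ s)) := by
    have h3 : N * 1 ⊗ₜ (ε • φ s) = 1 ⊗ₜ (ε • φ s) * N := by
      rw [TensorProduct.tmul_smul, mul_smul_comm, smul_mul_assoc]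
      exact congrArg _ (hcomm s hs)
    rw [IsGauge, mul_add, add_mul, h3, add_sub_add_right_eq_sub]
    exact hg
  have hA'2 : A' = PseudoDiffOp.monomial (der F (Low deg)) 1 1 ⊗ₜ[F] 1 +
      constLift _ _ (h.lax (fun i : If => i.1) l + 1 ⊗ₜ (ε • φ s)) := by
    rw [← h.firstOrder_eq_lax]
    simp only [A', hwl, hU]
    rfl
  have hA : A = PseudoDiffOp.monomial (der F (Low deg)) 1 1 ⊗ₜ[F] 1 +
      constLift _ _ (h.lax (fun i : Low deg => i.1) (var F) + 1 ⊗ₜ (ε • φ s)) := by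
    rw [← h.firstOrder_eq_lax]
    simp only [A, hU]
    rfl
  obtain ⟨hexA, heq⟩ := quasidet_eq_of_isGauge hbot hT h1 h2 hN hN' hgS (hA'2 ▸ hexA')
  rw [← hA] at hexA heq
  rw [← hA'2] at heq
  refine ⟨hexA, ?_, hexA', heq⟩
  rw [heq, hA', hex.quasidet_baseMap]
  exact baseMap_map_val_mem_range hW _
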